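/- Let $M$ be an $n$-dimensional smooth manifold (Hausdorff, second countable, without boundary), let $t_1<t_2$, and let $x:M\times[t_1,t_2]\to\mathbb{R}^{n+m}$ be a smooth map such that every $x(\cdot,t)$ is an immersion and $\partial_t x=\vec H$ on $M\times[t_1,t_2]$, where $\vec H(\cdot,t)$ denotes the mean curvature vector of $x(\cdot,t)$. Assume that for every $t\in[t_1,t_2]$ the Riemannian metric induced by $x(\cdot,t)$ is complete. Suppose that $x$ is a shrinking breather: there are a constant $\alpha\in(0,1)$, an isometry $F:\mathbb{R}^{n+m}\to\mathbb{R}^{n+m}$ and a diffeomorphism $\phi:M\to M$ such that $$x(p,t_2)=\alpha\,F\big(x(\phi(p),t_1)\big)\qquad\text{for all }p\in M.$$ Suppose further that for some real constant $\gamma<\frac{1-\alpha^2}{4(t_2-t_1)}$ $$\int_M e^{-\gamma|x(\cdot,t_1)|^2}\,d\mu_{t_1}<\infty,$$ where $\mu_{t_1}$ is the Riemannian measure induced by the immersion $x(\cdot,t_1)$. Then $x$ is a self-shrinker: there are a point $x_0\in\mathbb{R}^{n+m}$ and a time $t_0>t_2$ such that for every $t\in[t_1,t_2]$ the rescaled immersion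 $z=(t_0-t)^{-1/2}\,(x(\cdot,t)-x_0)$ satisfies the self-shrinker equation $\vec H_z=-\tfrac12 z^\perp$; equivalently, $$\vec H(p,t)=-\frac{(x(p,t)-x_0)^\perp}{2(t_0-t)}\qquad\text{for all }(p,t)\in M\times[t_1,t_2],$$ where $\perp$ denotes the component normal to the immersion at the point in question. -/

import Mathlib

open scoped Manifold ContDiff Topology
open MeasureTheory

noncomputable section

namespace MCF

section Geometry

variable (n : ℕ) {M : Type*} [TopologicalSpace M] [ChartedSpace (EuclideanSpace ℝ (Fin n)) M]
  {E : Type*} [NormedAddCommGroup E] [InnerProductSpace ℝ E] [FiniteDimensional ℝ E]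

/-- The differential of `f : M → E` at `p`, as a linear map from the tangent space of `M` at `p`
(which is the model space) to `E`. -/
def differential (f : M → E) (p : M) : EuclideanSpace ℝ (Fin n) →L[ℝ] E :=
  mfderiv (𝓡 n) 𝓘(ℝ, E) f p

/-- `f : M → E` is a smooth immersion. -/
structure IsImmersion (f : M → E) : Prop where
  smooth : ContMDiff (𝓡 n) 𝓘(ℝ, E) ∞ f
  injective_differential : ∀ p : M, Function.Injective (differential n f p)

/-- The expression `f ∘ χₚ⁻¹` of `f` in the preferred chart `χₚ` at `p`. -/
def localRep (f : M → E) (p : M) : EuclideanSpace ℝ (Fin n) → E :=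
  f ∘ (extChartAt (𝓡 n) p).symm

/-- The coordinate vector `∂ᵢ u (z)`. -/
def coordDeriv (u : EuclideanSpace ℝ (Fin n) → E) (i : Fin n) (z : EuclideanSpace ℝ (Fin n)) : E :=
  fderiv ℝ u z (EuclideanSpace.single i 1)

/-- The matrix `gᵢⱼ = ⟨∂ᵢ u, ∂ⱼ u⟩` at `z` of the metric induced by the parametrization `u`. -/
def metricMatrix (u : EuclideanSpace ℝ (Fin n) → E) (z : EuclideanSpace ℝ (Fin n)) :
    Matrix (Fin n) (Fin n) ℝ :=
  Matrix.gram ℝ (fun i => coordDeriv n u i z)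

/-- The component `v^⊥` of `v : E` normal to the immersion `f` at `p`: the orthogonal projection
of `v` to the orthogonal complement of the image of the differential. -/
def normalPart (f : M → E) (p : M) (v : E) : E :=
  ((differential n f p : EuclideanSpace ℝ (Fin n) →ₗ[ℝ] E).range)ᗮ.starProjection v

/-- The mean curvature vector `H = ∑ᵢⱼ gⁱʲ (∂ᵢ ∂ⱼ f)^⊥` of the immersion `f` at `p`, that is, the
trace with respect to the induced metric of the (normal-valued) second fundamental form. It is
computed in the preferred chart at `p`. -/
def meanCurvature (f : M → E) (p : M) : E :=
  ∑ i : Fin n, ∑ j : Fin n,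
    (metricMatrix n (localRep n f p) (extChartAt (𝓡 n) p p))⁻¹ i j •
      normalPart n f p (coordDeriv n (coordDeriv n (localRep n f p) j) i (extChartAt (𝓡 n) p p))

/-- The distance on `M` of the metric induced by `f`: the infimum of the lengths of `C¹` paths,
where the length of a tangent vector `v` at `p` is `|df_p v|`. -/
def inducedEDist (f : M → E) (p q : M) : ENNReal :=
  letI : ∀ a : M, ENorm (TangentSpace (𝓡 n) a) := fun a => ⟨fun v => ‖differential n f a v‖ₑ⟩
  Manifold.riemannianEDist (𝓡 n) p q

/-- The metric induced by `f` is complete: Cauchy sequences converge. -/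
def IsCompleteImmersion (f : M → E) : Prop :=
  ∀ u : ℕ → M,
    (∀ ε : ENNReal, 0 < ε → ∃ N : ℕ, ∀ i ≥ N, ∀ j ≥ N, inducedEDist n f (u i) (u j) < ε) →
    ∃ p : M, Filter.Tendsto u Filter.atTop (𝓝 p)

/-- The Riemannian measure `√(det g) dz` of the metric induced by `f` in the preferred chart
at `p`, as a measure on `M` concentrated on the domain of that chart. -/
def chartMeasure [MeasurableSpace M] (f : M → E) (p : M) : Measure M :=
  (((volume : Measure (EuclideanSpace ℝ (Fin n))).restrict (extChartAt (𝓡 n) p).target).withDensity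
    (fun z => ENNReal.ofReal (Real.sqrt (metricMatrix n (localRep n f p) z).det))).map
      (extChartAt (𝓡 n) p).symm

/-- The Riemannian measure on `M` induced by the immersion `f`. It is the measure which is given
by `√(det g) dz` in each chart, i.e. whose restriction to the domain of the preferred chart at `p`
is `chartMeasure f p`; on a second countable manifold this is the least measure dominating all of
the measures `chartMeasure f p` (the supremum is taken in the complete lattice of measures). -/
def inducedMeasure [MeasurableSpace M] (f : M → E) : Measure M :=
  ⨆ p : M, chartMeasure n f p

/-- `x`, given for times in `[t₁, t₂]`, is a smooth immersed solution `∂ₜ x = H` to the mean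
curvature flow. (The values `x t` for `t ∉ [t₁, t₂]` are irrelevant.) -/
structure IsMeanCurvatureFlow (x : ℝ → M → E) (t₁ t₂ : ℝ) : Prop where
  smooth : ContMDiffOn ((𝓡 n).prod 𝓘(ℝ, ℝ)) 𝓘(ℝ, E) ∞ (fun q : M × ℝ => x q.2 q.1)
    (Set.univ ×ˢ Set.Icc t₁ t₂)
  immersion : ∀ t ∈ Set.Icc t₁ t₂, IsImmersion n (x t)
  evolution : ∀ t ∈ Set.Icc t₁ t₂, ∀ p : M,
    HasDerivWithinAt (fun s => x s p) (meanCurvature n (x t) p) (Set.Icc t₁ t₂) t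

/-- `x` repeats itself at time `t₂` up to scaling by `α`, an isometry `F` of the ambient space and
a self-diffeomorphism `φ` of `M`: `x(p, t₂) = α F(x(φ(p), t₁))`. -/
def IsBreather (x : ℝ → M → E) (t₁ t₂ α : ℝ) : Prop :=
  IsMeanCurvatureFlow n x t₁ t₂ ∧ t₁ < t₂ ∧ 0 < α ∧
    ∃ F : E → E, Isometry F ∧ ∃ φ : M ≃ₘ^∞⟮𝓡 n, 𝓡 n⟯ M, ∀ p : M, x t₂ p = α • F (x t₁ (φ p))

/-- A shrinking breather is a breather with ratio `α < 1`. -/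
def IsShrinkingBreather (x : ℝ → M → E) (t₁ t₂ α : ℝ) : Prop :=
  IsBreather n x t₁ t₂ α ∧ α < 1

/-- The immersed submanifold `f` is a self-shrinker: `H = - (1/2) f^⊥`. -/
structure IsSelfShrinker (f : M → E) : Prop where
  immersion : IsImmersion n f
  equation : ∀ p : M, meanCurvature n f p = -(1 / 2 : ℝ) • normalPart n f p (f p)

/-- The flow `x` on `[t₁, t₂]` is a self-shrinker, with respect to some center `x₀` and some
extinction time `t₀ > t₂`: each rescaled time slice `(x(·, t) - x₀) / √(t₀ - t)` is a
self-shrinker. Equivalently, `H = - (x - x₀)^⊥ / (2 (t₀ - t))` for all `t ∈ [t₁, t₂]`. -/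
def IsSelfShrinkingFlow (x : ℝ → M → E) (t₁ t₂ : ℝ) : Prop :=
  ∃ (x₀ : E) (t₀ : ℝ), t₂ < t₀ ∧ ∀ t ∈ Set.Icc t₁ t₂,
    IsSelfShrinker n (fun p => (Real.sqrt (t₀ - t))⁻¹ • (x t p - x₀))

end Geometry

end MCF

end

/-! The theorem is the equality case of Huisken's monotonicity formula, carried out on a noncompact
`M` without curvature bounds. The similarity v ↦ αF(v) is a contraction. Take its fixed point x₀ as
origin and choose t₀ with t₀ - t₂ = α²(t₀ - t₁). Let Φ(t) be the integral over `M` of (t₀ -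
t)^(-n/2) exp(-|x - x₀|²/(4(t₀ - t))) dμ_t. This integral is invariant under parabolic rescaling and
reparametrization, so the breather relation gives Φ(t₂) = Φ(t₁)
(`IsExtendedFlow.integral_kernelDensity_eq`). The monotonicity formula says that Φ' is minus the
weighted integral of |H + (x - x₀)^⊥/(2(t₀ - t))|². Hence this defect vanishes, which is the
self-shrinker equation.

The formula combines three facts. The area element satisfies ∂ₜ√g = -|H|²√g, so dμ_t = exp(-∫|H|²)
dμ_{t₁}, and every integral can be taken against the fixed measure μ_{t₁}. The time derivative of
the resulting density is, up to positive factors, minus the Laplacian of a Gaussian, minus the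
weighted square of the defect (`kernelDensityDeriv_eq`). The Laplacian integrates to zero by
completeness (`integral_gaussianLaplacian_eq_zero`): by Hopf and Rinow there are compactly supported
cutoffs with Lipschitz constants tending to zero, and Green's formula applies to them.

Integrability is where γ enters. The bound (1 - α²)/(4(t₂ - t₁)) equals 1/(4(t₀ - t₁)), so some
Gaussian whose exponent is strictly smaller than that of the heat kernel at time t₁ is integrable.
If its exponent c evolves by c' = 2c², Young's inequality shows that w = exp(-c|x|² - ∫|H|²)
satisfies w' ≤ -½|H|²w (`exp_weight_decay`). This bounds w by its initial value and makes |H|²w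
integrable in space-time. Since c stays below the exponent of the kernel by a fixed margin, w(1 +
|H|²) dominates all integrands. Fubini then replaces differentiation under the integral sign:
integrability on time slices is needed only for almost every t, and continuity yields the remaining
times. -/

noncomputable section

namespace MCF

/-! ### Gram matrices and the derivative of √det -/

section LinearAlgebra

open scoped InnerProductSpace Matrix

variable {ι : Type*} [Fintype ι] [DecidableEq ι]
  {E : Type*} [NormedAddCommGroup E] [InnerProductSpace ℝ E]

lemma gram_det_pos {b : ι → E} (hb : LinearIndependent ℝ b) : 0 < (Matrix.gram ℝ b).det :=
  (Matrix.posDef_gram_of_linearIndependent hb).det_pos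

lemma gram_isUnit_det {b : ι → E} (hb : LinearIndependent ℝ b) : IsUnit (Matrix.gram ℝ b).det :=
  (gram_det_pos hb).ne'.isUnit

lemma gram_inv_symm (b : ι → E) (i j : ι) :
    (Matrix.gram ℝ b)⁻¹ i j = (Matrix.gram ℝ b)⁻¹ j i := by
  have h : ((Matrix.gram ℝ b)⁻¹).IsHermitian := (Matrix.isHermitian_gram (𝕜 := ℝ) b).inv
  simpa using h.apply j i

lemma sum_gram_mul_inv {b : ι → E} (hb : LinearIndependent ℝ b) (i k : ι) :
    ∑ j, ⟪b i, b j⟫_ℝ * (Matrix.gram ℝ b)⁻¹ j k = if i = k then 1 else 0 := by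
  have h := congrFun (congrFun (Matrix.mul_nonsing_inv _ (gram_isUnit_det hb)) i) k
  simpa [Matrix.mul_apply, Matrix.one_apply] using h

lemma sum_inv_mul_gram {b : ι → E} (hb : LinearIndependent ℝ b) (i k : ι) :
    ∑ j, (Matrix.gram ℝ b)⁻¹ i j * ⟪b j, b k⟫_ℝ = if i = k then 1 else 0 := by
  have h := congrFun (congrFun (Matrix.nonsing_inv_mul _ (gram_isUnit_det hb)) i) k
  simpa [Matrix.mul_apply, Matrix.one_apply] using h

/-- The projection to the orthogonal complement of a span, in terms of the Gram matrix. -/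
lemma starProjection_orthogonal_span [FiniteDimensional ℝ E] {b : ι → E}
    (hb : LinearIndependent ℝ b) {K : Submodule ℝ E}
    (hK : K = Submodule.span ℝ (Set.range b)) (v : E) :
    Kᗮ.starProjection v =
      v - ∑ i, ∑ j, ((Matrix.gram ℝ b)⁻¹ i j * ⟪b j, v⟫_ℝ) • b i := by
  subst hK
  refine Submodule.eq_starProjection_of_mem_of_inner_eq_zero ?_ ?_
  · rw [Submodule.mem_orthogonal]
    intro u hu
    induction hu using Submodule.span_induction with
    | mem x hx =>
      obtain ⟨k, rfl⟩ := hx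
      rw [inner_sub_right, inner_sum]
      simp_rw [inner_sum, inner_smul_right]
      rw [Finset.sum_comm, sub_eq_zero]
      have : ∀ j, ∑ i, (Matrix.gram ℝ b)⁻¹ i j * ⟪b j, v⟫_ℝ * ⟪b k, b i⟫_ℝ
          = (if k = j then 1 else 0) * ⟪b j, v⟫_ℝ := by
        intro j
        rw [← sum_gram_mul_inv hb k j, Finset.sum_mul]
        exact Finset.sum_congr rfl fun i _ => by ring
      simp [this]
    | zero => simp
    | add x y _ _ hx hy => rw [inner_add_left, hx, hy, add_zero]
    | smul a x _ hx => rw [inner_smul_left, hx, mul_zero]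
  · intro w hw
    rw [sub_sub_cancel]
    rw [Submodule.mem_orthogonal] at hw
    refine hw _ ?_
    exact Submodule.sum_mem _ fun i _ => Submodule.sum_mem _ fun j _ =>
      Submodule.smul_mem _ _ (Submodule.subset_span ⟨i, rfl⟩)

/-- Jacobi's formula. -/
lemma hasFDerivAt_det {F : Type*} [NormedAddCommGroup F] [NormedSpace ℝ F]
    {A : F → Matrix ι ι ℝ} {A' : ι → ι → F →L[ℝ] ℝ} {z : F}
    (hA : ∀ i j, HasFDerivAt (fun y => A y i j) (A' i j) z) :
    HasFDerivAt (fun y => (A y).det)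
      (∑ i, ∑ j, (A z).adjugate i j • A' j i) z := by
  have h1 : HasFDerivAt (fun y => (A y).det)
      (∑ σ : Equiv.Perm ι, ((Equiv.Perm.sign σ : ℤ) : ℝ) •
        ∑ i, (∏ j ∈ Finset.univ.erase i, A z (σ j) j) • A' (σ i) i) z := by
    simp_rw [Matrix.det_apply']
    refine HasFDerivAt.fun_sum fun σ _ => ?_
    refine HasFDerivAt.const_mul ?_ _
    exact HasFDerivAt.finsetProd fun i _ => hA (σ i) i
  convert h1 using 1
  ext v
  -- Cramer's rule: a row of the adjugate paired with the derivative of a column is the determinant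
  -- with that column replaced.
  have h2 : ∀ i, ∑ j, (A z).adjugate i j * A' j i v = ((A z).updateCol i fun j => A' j i v).det := by
    intro i
    rw [← Matrix.cramer_apply, Matrix.cramer_eq_adjugate_mulVec]
    rfl
  simp only [FunLike.coe_sum, Finset.sum_apply, FunLike.coe_smul,
    Pi.smul_apply, smul_eq_mul, h2]
  simp_rw [Matrix.det_apply', Finset.mul_sum]
  rw [Finset.sum_comm]
  refine Finset.sum_congr rfl fun σ _ => Finset.sum_congr rfl fun i _ => ?_
  rw [← Finset.mul_prod_erase _ _ (Finset.mem_univ i)]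
  rw [Matrix.updateCol_self, mul_comm (A' _ _ _)]
  congr 2
  refine Finset.prod_congr rfl fun j hj => ?_
  rw [Matrix.updateCol_ne (Finset.ne_of_mem_erase hj)]

/-- The derivative of `√det` for matrices with positive determinant. -/
lemma hasFDerivAt_sqrt_det {F : Type*} [NormedAddCommGroup F] [NormedSpace ℝ F]
    {A : F → Matrix ι ι ℝ} {A' : ι → ι → F →L[ℝ] ℝ} {z : F}
    (hA : ∀ i j, HasFDerivAt (fun y => A y i j) (A' i j) z) (hz : 0 < (A z).det) :
    HasFDerivAt (fun y => √(A y).det)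
      ((√(A z).det / 2) • ∑ i, ∑ j, (A z)⁻¹ i j • A' j i) z := by
  convert (hasFDerivAt_det hA).sqrt hz.ne' using 1
  have h3 : (A z).adjugate = (A z).det • (A z)⁻¹ := by
    rw [Matrix.inv_def, Ring.inverse_eq_inv', smul_smul, mul_inv_cancel₀ hz.ne', one_smul]
  have h4 : √(A z).det / 2 = 1 / (2 * √(A z).det) * (A z).det := by
    have h5 := Real.mul_self_sqrt hz.le
    have h6 := Real.sqrt_pos.2 hz
    field_simp
    nlinarith
  simp_rw [h3, h4, mul_smul, Matrix.smul_apply, smul_assoc, Finset.smul_sum]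

end LinearAlgebra

/-! ### Normal projection and mean curvature of a parametrization -/

section Parametrizations

open scoped InnerProductSpace Matrix

variable {n : ℕ} {E : Type*} [NormedAddCommGroup E] [InnerProductSpace ℝ E]

/-- The metric trace of a bilinear form is independent of the basis: the Gram matrices are related
by G' = PᵀGP, so P G'⁻¹ Pᵀ = G⁻¹. It is applied to the normal part of the Hessian. -/
lemma sum_inv_gram_smul_congr {ι : Type*} [Fintype ι] [DecidableEq ι] {b b' : ι → E}
    {B B' : ι → ι → E} {P : Matrix ι ι ℝ} (hP : IsUnit P.det)
    (hb' : ∀ i, b' i = ∑ k, P k i • b k)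
    (hB' : ∀ i j, B' i j = ∑ k, ∑ l, (P k i * P l j) • B k l) :
    ∑ i, ∑ j, (Matrix.gram ℝ b')⁻¹ i j • B' i j = ∑ k, ∑ l, (Matrix.gram ℝ b)⁻¹ k l • B k l := by
  have h1 : Matrix.gram ℝ b' = Pᵀ * Matrix.gram ℝ b * P := by
    ext i j
    simp only [Matrix.gram_apply, hb', Matrix.mul_apply, Matrix.transpose_apply, sum_inner,
      inner_sum, inner_smul_left, inner_smul_right, Finset.sum_mul, Finset.mul_sum]
    refine Finset.sum_congr rfl fun l _ => Finset.sum_congr rfl fun k _ => ?_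
    simp only [conj_trivial]
    ring
  have h2 : P * (Matrix.gram ℝ b')⁻¹ * Pᵀ = (Matrix.gram ℝ b)⁻¹ := by
    have hPt : IsUnit Pᵀ.det := by rwa [Matrix.det_transpose]
    rw [h1, Matrix.mul_inv_rev, Matrix.mul_inv_rev, ← Matrix.mul_assoc,
      Matrix.mul_nonsing_inv _ hP, Matrix.one_mul, Matrix.mul_assoc,
      Matrix.nonsing_inv_mul _ hPt, Matrix.mul_one]
  simp_rw [hB', Finset.smul_sum, smul_smul, ← h2, Matrix.mul_apply, Matrix.transpose_apply,
    Finset.sum_mul, Finset.sum_smul]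
  calc _ = ∑ i, ∑ j, ∑ k, ∑ l, ((Matrix.gram ℝ b')⁻¹ i j * (P k i * P l j)) • B k l := rfl
    _ = ∑ i, ∑ k, ∑ j, ∑ l, ((Matrix.gram ℝ b')⁻¹ i j * (P k i * P l j)) • B k l :=
        Finset.sum_congr rfl fun i _ => Finset.sum_comm
    _ = ∑ k, ∑ i, ∑ j, ∑ l, ((Matrix.gram ℝ b')⁻¹ i j * (P k i * P l j)) • B k l :=
        Finset.sum_comm
    _ = ∑ k, ∑ i, ∑ l, ∑ j, ((Matrix.gram ℝ b')⁻¹ i j * (P k i * P l j)) • B k l :=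
        Finset.sum_congr rfl fun k _ => Finset.sum_congr rfl fun i _ => Finset.sum_comm
    _ = ∑ k, ∑ l, ∑ i, ∑ j, ((Matrix.gram ℝ b')⁻¹ i j * (P k i * P l j)) • B k l :=
        Finset.sum_congr rfl fun k _ => Finset.sum_comm
    _ = ∑ k, ∑ l, ∑ j, ∑ i, ((Matrix.gram ℝ b')⁻¹ i j * (P k i * P l j)) • B k l :=
        Finset.sum_congr rfl fun k _ => Finset.sum_congr rfl fun i _ => Finset.sum_comm
    _ = _ := by
        refine Finset.sum_congr rfl fun k _ => Finset.sum_congr rfl fun l _ =>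
          Finset.sum_congr rfl fun j _ => Finset.sum_congr rfl fun i _ => ?_
        congr 1
        ring

lemma euclidean_eq_sum (v : EuclideanSpace ℝ (Fin n)) :
    v = ∑ i, v i • EuclideanSpace.single i (1 : ℝ) := by
  ext j
  simp [Pi.single_apply]

lemma map_eq_sum {F : Type*} [NormedAddCommGroup F] [NormedSpace ℝ F]
    (L : EuclideanSpace ℝ (Fin n) →L[ℝ] F) (v : EuclideanSpace ℝ (Fin n)) :
    L v = ∑ i, v i • L (EuclideanSpace.single i (1 : ℝ)) := by
  conv_lhs => rw [euclidean_eq_sum v]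
  simp

lemma range_eq_span (L : EuclideanSpace ℝ (Fin n) →L[ℝ] E) :
    (L : EuclideanSpace ℝ (Fin n) →ₗ[ℝ] E).range =
      Submodule.span ℝ (Set.range fun i => L (EuclideanSpace.single i (1 : ℝ))) := by
  apply le_antisymm
  · rintro _ ⟨v, rfl⟩
    rw [ContinuousLinearMap.coe_coe, map_eq_sum L v]
    exact Submodule.sum_mem _ fun i _ => Submodule.smul_mem _ _ (Submodule.subset_span ⟨i, rfl⟩)
  · rw [Submodule.span_le]
    rintro _ ⟨i, rfl⟩
    exact ⟨_, rfl⟩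

lemma linearIndependent_of_injective {L : EuclideanSpace ℝ (Fin n) →L[ℝ] E}
    (hL : Function.Injective L) :
    LinearIndependent ℝ fun i => L (EuclideanSpace.single i (1 : ℝ)) := by
  rw [Fintype.linearIndependent_iff]
  intro g hg i
  have h : L (∑ i, g i • EuclideanSpace.single i (1 : ℝ)) = L 0 := by simpa using hg
  have := congrArg (fun v : EuclideanSpace ℝ (Fin n) => v i) (hL h)
  simpa [Pi.single_apply] using this

/-- The normal component at `z` with respect to a parametrization `u`. -/
def paramNormal [FiniteDimensional ℝ E] (u : EuclideanSpace ℝ (Fin n) → E)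
    (z : EuclideanSpace ℝ (Fin n)) (v : E) : E :=
  ((fderiv ℝ u z : EuclideanSpace ℝ (Fin n) →ₗ[ℝ] E).range)ᗮ.starProjection v

/-- The mean curvature vector of a parametrization `u` at `z`. -/
def paramMeanCurvature [FiniteDimensional ℝ E] (u : EuclideanSpace ℝ (Fin n) → E)
    (z : EuclideanSpace ℝ (Fin n)) : E :=
  ∑ i : Fin n, ∑ j : Fin n, (metricMatrix n u z)⁻¹ i j •
    paramNormal u z (coordDeriv n (coordDeriv n u j) i z)

lemma paramNormal_sum [FiniteDimensional ℝ E] {ι : Type*} (s : Finset ι)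
    (u : EuclideanSpace ℝ (Fin n) → E) (z : EuclideanSpace ℝ (Fin n)) (f : ι → E) :
    paramNormal u z (∑ i ∈ s, f i) = ∑ i ∈ s, paramNormal u z (f i) := map_sum _ _ _

lemma paramNormal_add [FiniteDimensional ℝ E] (u : EuclideanSpace ℝ (Fin n) → E)
    (z : EuclideanSpace ℝ (Fin n)) (v w : E) :
    paramNormal u z (v + w) = paramNormal u z v + paramNormal u z w := map_add _ _ _

lemma paramNormal_smul [FiniteDimensional ℝ E] (u : EuclideanSpace ℝ (Fin n) → E)
    (z : EuclideanSpace ℝ (Fin n)) (c : ℝ) (w : E) :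
    paramNormal u z (c • w) = c • paramNormal u z w := map_smul _ _ _

lemma paramNormal_tangent [FiniteDimensional ℝ E] (u : EuclideanSpace ℝ (Fin n) → E)
    (z v : EuclideanSpace ℝ (Fin n)) : paramNormal u z (fderiv ℝ u z v) = 0 := by
  refine (Submodule.starProjection_apply_eq_zero_iff _).2 ?_
  rw [Submodule.orthogonal_orthogonal]
  exact ⟨v, rfl⟩

lemma inner_paramNormal_tangent [FiniteDimensional ℝ E] (u : EuclideanSpace ℝ (Fin n) → E)
    (z v : EuclideanSpace ℝ (Fin n)) (w : E) : ⟪paramNormal u z w, fderiv ℝ u z v⟫_ℝ = 0 := by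
  have h : paramNormal u z w ∈ ((fderiv ℝ u z : EuclideanSpace ℝ (Fin n) →ₗ[ℝ] E).range)ᗮ :=
    Submodule.starProjection_apply_mem _ _
  rw [real_inner_comm]
  exact (Submodule.mem_orthogonal _ _).1 h _ ⟨v, rfl⟩

lemma paramNormal_eq_self [FiniteDimensional ℝ E] {u : EuclideanSpace ℝ (Fin n) → E}
    {z : EuclideanSpace ℝ (Fin n)} {w : E} (h : ∀ i, ⟪w, coordDeriv n u i z⟫_ℝ = 0) :
    paramNormal u z w = w := by
  refine Submodule.starProjection_eq_self_iff.2 ?_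
  rw [Submodule.mem_orthogonal]
  rintro _ ⟨v, rfl⟩
  rw [ContinuousLinearMap.coe_coe, map_eq_sum, sum_inner]
  refine Finset.sum_eq_zero fun i _ => ?_
  rw [inner_smul_left, real_inner_comm]
  have := h i
  rw [coordDeriv] at this
  rw [this, mul_zero]

lemma paramNormal_eq_sub [FiniteDimensional ℝ E] {u : EuclideanSpace ℝ (Fin n) → E}
    {z : EuclideanSpace ℝ (Fin n)} (hu : Function.Injective (fderiv ℝ u z)) (w : E) :
    paramNormal u z w = w - ∑ i, ∑ j, ((metricMatrix n u z)⁻¹ i j * ⟪coordDeriv n u j z, w⟫_ℝ) •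
      coordDeriv n u i z :=
  starProjection_orthogonal_span (linearIndependent_of_injective hu) (range_eq_span _) w

/-- The mean curvature vector is invariant under a change of parameters. -/
lemma paramMeanCurvature_comp [FiniteDimensional ℝ E] {u v : EuclideanSpace ℝ (Fin n) → E}
    {ψ : EuclideanSpace ℝ (Fin n) → EuclideanSpace ℝ (Fin n)} {z : EuclideanSpace ℝ (Fin n)}
    (hψ : ContDiffAt ℝ 2 ψ z) (hv : ContDiffAt ℝ 2 v (ψ z)) (hu : u =ᶠ[𝓝 z] v ∘ ψ)
    (hψ' : Function.Injective (fderiv ℝ ψ z)) :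
    paramMeanCurvature u z = paramMeanCurvature v (ψ z) := by
  have hψd : ∀ᶠ y in 𝓝 z, DifferentiableAt ℝ ψ y :=
    (hψ.eventually (by simp)).mono fun y hy => hy.differentiableAt (by simp)
  have hvd : ∀ᶠ y in 𝓝 z, DifferentiableAt ℝ v (ψ y) :=
    (hψ.continuousAt.eventually (hv.eventually (by simp))).mono
      fun y hy => hy.differentiableAt (by simp)
  have hfd : ∀ᶠ y in 𝓝 z, fderiv ℝ u y = (fderiv ℝ v (ψ y)).comp (fderiv ℝ ψ y) := by
    filter_upwards [hψd, hvd, hu.eventuallyEq_nhds] with y h1 h2 h3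
    rw [h3.fderiv_eq, fderiv_comp y h2 h1]
  set P : Matrix (Fin n) (Fin n) ℝ :=
    Matrix.of fun k i => (fderiv ℝ ψ z (EuclideanSpace.single i 1)) k with hPdef
  have hP : IsUnit P.det := by
    rw [← Matrix.isUnit_iff_isUnit_det, ← Matrix.mulVec_injective_iff_isUnit]
    intro x y hxy
    have key : ∀ x : Fin n → ℝ, ∀ k, (P *ᵥ x) k = (fderiv ℝ ψ z (WithLp.toLp 2 x)) k := by
      intro x k
      rw [map_eq_sum]
      simp [Matrix.mulVec, dotProduct, hPdef, mul_comm]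
    have h2 : fderiv ℝ ψ z (WithLp.toLp 2 x) = fderiv ℝ ψ z (WithLp.toLp 2 y) := by
      ext k
      rw [← key, ← key, hxy]
    simpa using hψ' h2
  have hb : ∀ i, coordDeriv n u i z = ∑ k, P k i • coordDeriv n v k (ψ z) := by
    intro i
    simp only [coordDeriv]
    rw [hfd.self_of_nhds, ContinuousLinearMap.comp_apply, map_eq_sum]
    rfl
  have hrange : (fderiv ℝ u z : EuclideanSpace ℝ (Fin n) →ₗ[ℝ] E).range =
      (fderiv ℝ v (ψ z) : EuclideanSpace ℝ (Fin n) →ₗ[ℝ] E).range := by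
    have hsurj : Function.Surjective (fderiv ℝ ψ z) :=
      LinearMap.surjective_of_injective (f := (fderiv ℝ ψ z).toLinearMap) hψ'
    rw [hfd.self_of_nhds]
    ext w
    constructor
    · rintro ⟨a, rfl⟩; exact ⟨_, rfl⟩
    · rintro ⟨a, rfl⟩
      obtain ⟨c, rfl⟩ := hsurj a
      exact ⟨c, rfl⟩
  have hN : ∀ w, paramNormal u z w = paramNormal v (ψ z) w := by
    intro w; simp only [paramNormal, hrange]
  refine sum_inv_gram_smul_congr hP hb fun i j => ?_
  have hD : HasFDerivAt (coordDeriv n u j)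
      ((fderiv ℝ v (ψ z)).comp ((fderiv ℝ (fderiv ℝ ψ) z).flip (EuclideanSpace.single j 1)) +
        (((fderiv ℝ (fderiv ℝ v) (ψ z)).comp (fderiv ℝ ψ z)).flip
          (fderiv ℝ ψ z (EuclideanSpace.single j 1)))) z := by
    have h1 : HasFDerivAt (fderiv ℝ ψ) (fderiv ℝ (fderiv ℝ ψ) z) z :=
      ((hψ.fderiv_right (m := 1) (by norm_num)).differentiableAt (by simp)).hasFDerivAt
    have h2 : HasFDerivAt (fderiv ℝ v) (fderiv ℝ (fderiv ℝ v) (ψ z)) (ψ z) :=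
      ((hv.fderiv_right (m := 1) (by norm_num)).differentiableAt (by simp)).hasFDerivAt
    have h3 := (h2.comp z hψd.self_of_nhds.hasFDerivAt).clm_apply
      (h1.clm_apply (hasFDerivAt_const (EuclideanSpace.single j (1 : ℝ)) z))
    have h4 : coordDeriv n u j =ᶠ[𝓝 z] fun y => (fderiv ℝ v ∘ ψ) y
        (fderiv ℝ ψ y (EuclideanSpace.single j 1)) := by
      filter_upwards [hfd] with y hy
      simp [coordDeriv, hy]
    refine (h3.congr_of_eventuallyEq h4).congr_fderiv ?_
    ext w
    simp
  -- The chain rule for second derivatives. The first term, with the Hessian of ψ, is tangent to the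
  -- image of v and disappears under the normal projection; the other terms transform as a bilinear
  -- form.
  have hD2 : coordDeriv n (coordDeriv n u j) i z =
      fderiv ℝ v (ψ z) (fderiv ℝ (fderiv ℝ ψ) z (EuclideanSpace.single i 1)
        (EuclideanSpace.single j 1)) +
      ∑ k, ∑ l, (P k i * P l j) • coordDeriv n (coordDeriv n v l) k (ψ z) := by
    have h2 : DifferentiableAt ℝ (fderiv ℝ v) (ψ z) :=
      (hv.fderiv_right (m := 1) (by norm_num)).differentiableAt (by simp)
    have h5 : ∀ k l, coordDeriv n (coordDeriv n v l) k (ψ z) =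
        fderiv ℝ (fderiv ℝ v) (ψ z) (EuclideanSpace.single k 1) (EuclideanSpace.single l 1) := by
      intro k l
      have h6 : HasFDerivAt (coordDeriv n v l) _ (ψ z) :=
        h2.hasFDerivAt.clm_apply (hasFDerivAt_const (EuclideanSpace.single l (1 : ℝ)) (ψ z))
      rw [coordDeriv, h6.fderiv]
      simp
    rw [coordDeriv, hD.fderiv]
    simp only [add_apply, ContinuousLinearMap.comp_apply,
      ContinuousLinearMap.flip_apply, h5]
    congr 1
    rw [map_eq_sum (fderiv ℝ (fderiv ℝ v) (ψ z)), sum_apply]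
    refine Finset.sum_congr rfl fun k _ => ?_
    rw [smul_apply, map_eq_sum (fderiv ℝ (fderiv ℝ v) (ψ z) (EuclideanSpace.single k 1)),
      Finset.smul_sum]
    refine Finset.sum_congr rfl fun l _ => ?_
    rw [smul_smul]
    rfl
  rw [hD2, paramNormal_add, hN, hN, paramNormal_tangent, zero_add]
  simp_rw [paramNormal_sum, paramNormal_smul]

end Parametrizations

/-! ### The mean curvature vector as a divergence -/

section Divergence

open scoped InnerProductSpace Matrix

variable {n : ℕ} {E : Type*} [NormedAddCommGroup E] [InnerProductSpace ℝ E]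

lemma linearIndependent_coordDeriv {u : EuclideanSpace ℝ (Fin n) → E}
    {z : EuclideanSpace ℝ (Fin n)} (hu : Function.Injective (fderiv ℝ u z)) :
    LinearIndependent ℝ fun i => coordDeriv n u i z :=
  linearIndependent_of_injective hu

lemma metricMatrix_det_pos {u : EuclideanSpace ℝ (Fin n) → E}
    {z : EuclideanSpace ℝ (Fin n)} (hu : Function.Injective (fderiv ℝ u z)) :
    0 < (metricMatrix n u z).det :=
  gram_det_pos (linearIndependent_coordDeriv hu)

lemma contDiffAt_coordDeriv {u : EuclideanSpace ℝ (Fin n) → E}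
    {z : EuclideanSpace ℝ (Fin n)} {k : ℕ∞ω} (hu : ContDiffAt ℝ (k + 1) u z) (i : Fin n) :
    ContDiffAt ℝ k (coordDeriv n u i) z :=
  (hu.fderiv_right le_rfl).clm_apply contDiffAt_const

lemma coordDeriv_coordDeriv {u : EuclideanSpace ℝ (Fin n) → E}
    {z : EuclideanSpace ℝ (Fin n)} (hu : ContDiffAt ℝ 2 u z) (i j : Fin n) :
    coordDeriv n (coordDeriv n u j) i z =
      fderiv ℝ (fderiv ℝ u) z (EuclideanSpace.single i 1) (EuclideanSpace.single j 1) := by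
  have h2 : DifferentiableAt ℝ (fderiv ℝ u) z :=
    (hu.fderiv_right (m := 1) (by norm_num)).differentiableAt (by simp)
  have h6 : HasFDerivAt (coordDeriv n u j) _ z :=
    h2.hasFDerivAt.clm_apply (hasFDerivAt_const (EuclideanSpace.single j (1 : ℝ)) z)
  rw [coordDeriv, h6.fderiv]
  simp

lemma coordDeriv_comm {u : EuclideanSpace ℝ (Fin n) → E}
    {z : EuclideanSpace ℝ (Fin n)} (hu : ContDiffAt ℝ 2 u z) (i j : Fin n) :
    coordDeriv n (coordDeriv n u j) i z = coordDeriv n (coordDeriv n u i) j z := by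
  rw [coordDeriv_coordDeriv hu, coordDeriv_coordDeriv hu]
  exact (hu.isSymmSndFDerivAt (by simp)).eq _ _

section Regularity

variable {F : Type*} [NormedAddCommGroup F] [NormedSpace ℝ F]
  {ι : Type*} [Fintype ι] [DecidableEq ι]

lemma contDiffAt_det {k : ℕ∞ω} {A : F → Matrix ι ι ℝ} {z : F}
    (hA : ∀ i j, ContDiffAt ℝ k (fun y => A y i j) z) :
    ContDiffAt ℝ k (fun y => (A y).det) z := by
  simp_rw [Matrix.det_apply']
  exact ContDiffAt.sum fun σ _ => contDiffAt_const.mul (contDiffAt_prod fun i _ => hA (σ i) i)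

lemma contDiffAt_inv_entry {k : ℕ∞ω} {A : F → Matrix ι ι ℝ} {z : F}
    (hA : ∀ i j, ContDiffAt ℝ k (fun y => A y i j) z) (hz : (A z).det ≠ 0) (i j : ι) :
    ContDiffAt ℝ k (fun y => (A y)⁻¹ i j) z := by
  have h : ∀ y, (A y)⁻¹ i j = ((A y).det)⁻¹ * ((A y).updateRow j (Pi.single i 1)).det := by
    intro y
    rw [Matrix.inv_def, Ring.inverse_eq_inv', Matrix.smul_apply, Matrix.adjugate_apply,
      smul_eq_mul]
  simp_rw [h]
  refine ((contDiffAt_det hA).inv hz).mul (contDiffAt_det fun a b => ?_)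
  by_cases ha : a = j
  · subst ha; simpa using contDiffAt_const
  · simpa [Matrix.updateRow_ne ha] using hA a b

end Regularity

section

variable {u : EuclideanSpace ℝ (Fin n) → E} {z : EuclideanSpace ℝ (Fin n)}

lemma contDiffAt_metricMatrix {k : ℕ∞ω} (hu : ContDiffAt ℝ (k + 1) u z) (i j : Fin n) :
    ContDiffAt ℝ k (fun y => metricMatrix n u y i j) z :=
  (contDiffAt_coordDeriv hu i).inner ℝ (contDiffAt_coordDeriv hu j)

lemma contDiffAt_sqrt_det {k : ℕ∞ω} (hu : ContDiffAt ℝ (k + 1) u z)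
    (hz : Function.Injective (fderiv ℝ u z)) :
    ContDiffAt ℝ k (fun y => √(metricMatrix n u y).det) z :=
  (contDiffAt_det (contDiffAt_metricMatrix hu)).sqrt (metricMatrix_det_pos hz).ne'

lemma contDiffAt_metricMatrix_inv {k : ℕ∞ω} (hu : ContDiffAt ℝ (k + 1) u z)
    (hz : Function.Injective (fderiv ℝ u z)) (i j : Fin n) :
    ContDiffAt ℝ k (fun y => (metricMatrix n u y)⁻¹ i j) z :=
  contDiffAt_inv_entry (contDiffAt_metricMatrix hu) (metricMatrix_det_pos hz).ne' i j

/-- The `i`-th component `∑ⱼ √g gⁱʲ ∂ⱼ u` of the density-weighted gradient of `u`. -/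
def conormal (u : EuclideanSpace ℝ (Fin n) → E) (i : Fin n) (y : EuclideanSpace ℝ (Fin n)) : E :=
  ∑ j, (√(metricMatrix n u y).det * (metricMatrix n u y)⁻¹ i j) • coordDeriv n u j y

lemma contDiffAt_conormal {k : ℕ∞ω} (hu : ContDiffAt ℝ (k + 1) u z)
    (hz : Function.Injective (fderiv ℝ u z)) (i : Fin n) :
    ContDiffAt ℝ k (conormal u i) z :=
  ContDiffAt.sum fun j _ => ((contDiffAt_sqrt_det hu hz).mul
    (contDiffAt_metricMatrix_inv hu hz i j)).smul (contDiffAt_coordDeriv hu j)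

lemma inner_conormal_coordDeriv (hz : Function.Injective (fderiv ℝ u z)) (i k : Fin n) :
    ⟪conormal u i z, coordDeriv n u k z⟫_ℝ = if i = k then √(metricMatrix n u z).det else 0 := by
  simp_rw [conormal, sum_inner, inner_smul_left, conj_trivial, mul_assoc]
  rw [← Finset.mul_sum]
  have := sum_inv_mul_gram (linearIndependent_coordDeriv hz) i k
  rw [metricMatrix, this]
  simp

/-- The divergence of the density-weighted gradient of an immersion is the mean curvature
vector: `∑ᵢ ∂ᵢ(√g gⁱʲ ∂ⱼ u) = √g H`. -/
lemma sum_coordDeriv_conormal [FiniteDimensional ℝ E] (hu : ContDiffAt ℝ 2 u z)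
    (hz : ∀ᶠ y in 𝓝 z, Function.Injective (fderiv ℝ u y)) :
    ∑ i, coordDeriv n (conormal u i) i z =
      √(metricMatrix n u z).det • paramMeanCurvature u z := by
  have hz0 := hz.self_of_nhds
  have hu' : ContDiffAt ℝ (1 + 1) u z := by norm_num; exact hu
  set s := fun y => √(metricMatrix n u y).det with hs
  have hd : ∀ i, DifferentiableAt ℝ (coordDeriv n u i) z := fun i =>
    (contDiffAt_coordDeriv hu' i).differentiableAt (by simp)
  have hP : ∀ i, DifferentiableAt ℝ (conormal u i) z := fun i =>
    (contDiffAt_conormal hu' hz0 i).differentiableAt (by simp)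
  -- The divergence has no tangential part: differentiate ⟨`conormal` i, ∂ₖu⟩ = √g δᵢₖ and sum over
  -- i. By Jacobi's formula the derivative of √g cancels the term in which ∂ₖu is differentiated.
  have htan : ∀ k, ⟪∑ i, coordDeriv n (conormal u i) i z, coordDeriv n u k z⟫_ℝ = 0 := by
    intro k
    have h1 : ∀ i, ⟪coordDeriv n (conormal u i) i z, coordDeriv n u k z⟫_ℝ =
        (if i = k then fderiv ℝ s z (EuclideanSpace.single k 1) else 0) -
        ⟪conormal u i z, coordDeriv n (coordDeriv n u k) i z⟫_ℝ := by
      intro i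
      have h2 : (fun y => ⟪conormal u i y, coordDeriv n u k y⟫_ℝ) =ᶠ[𝓝 z]
          fun y => if i = k then s y else 0 := by
        filter_upwards [hz] with y hy using inner_conormal_coordDeriv hy i k
      have h3 := fderiv_inner_apply ℝ (hP i) (hd k) (EuclideanSpace.single i (1 : ℝ))
      rw [h2.fderiv_eq] at h3
      rw [eq_sub_iff_add_eq, add_comm]
      refine h3.symm.trans ?_
      by_cases hik : i = k
      · subst hik; simp
      · simp [hik]
    have hg : ∀ i j, HasFDerivAt (fun y => metricMatrix n u y i j)
        (fderiv ℝ (fun y => metricMatrix n u y i j) z) z := fun i j =>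
      ((contDiffAt_metricMatrix hu' i j).differentiableAt (by simp)).hasFDerivAt
    have hsd := hasFDerivAt_sqrt_det hg (metricMatrix_det_pos hz0)
    have hgd : ∀ i j, fderiv ℝ (fun y => metricMatrix n u y i j) z (EuclideanSpace.single k 1) =
        ⟪coordDeriv n u i z, coordDeriv n (coordDeriv n u j) k z⟫_ℝ +
        ⟪coordDeriv n (coordDeriv n u i) k z, coordDeriv n u j z⟫_ℝ := fun i j =>
      fderiv_inner_apply ℝ (hd i) (hd j) _
    rw [sum_inner, Finset.sum_congr rfl fun i _ => h1 i, Finset.sum_sub_distrib, hs, hsd.fderiv]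
    simp only [Finset.sum_ite_eq', Finset.mem_univ, if_true, smul_apply, sum_apply, hgd,
      smul_eq_mul, mul_add, Finset.sum_add_distrib]
    have h4 : ∑ i, ∑ j, (metricMatrix n u z)⁻¹ i j *
          ⟪coordDeriv n (coordDeriv n u j) k z, coordDeriv n u i z⟫_ℝ =
        ∑ i, ∑ j, (metricMatrix n u z)⁻¹ i j *
          ⟪coordDeriv n u j z, coordDeriv n (coordDeriv n u i) k z⟫_ℝ := by
      rw [Finset.sum_comm]
      refine Finset.sum_congr rfl fun i _ => Finset.sum_congr rfl fun j _ => ?_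
      rw [metricMatrix, gram_inv_symm, real_inner_comm]
    have h5 : ∑ i, ⟪conormal u i z, coordDeriv n (coordDeriv n u k) i z⟫_ℝ =
        √(metricMatrix n u z).det * ∑ i, ∑ j, (metricMatrix n u z)⁻¹ i j *
          ⟪coordDeriv n u j z, coordDeriv n (coordDeriv n u i) k z⟫_ℝ := by
      rw [Finset.mul_sum]
      refine Finset.sum_congr rfl fun i _ => ?_
      simp_rw [conormal, sum_inner, inner_smul_left, conj_trivial, mul_assoc]
      rw [← Finset.mul_sum]
      congr 1
      refine Finset.sum_congr rfl fun j _ => ?_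
      rw [coordDeriv_comm hu]
    rw [h4, h5]
    ring
  -- Being normal, the divergence equals its normal projection. There the terms that differentiate
  -- the coefficients √g gⁱʲ drop out, because ∂ⱼu is tangent.
  rw [← paramNormal_eq_self htan, paramNormal_sum, paramMeanCurvature, Finset.smul_sum]
  refine Finset.sum_congr rfl fun i _ => ?_
  have h6 : HasFDerivAt (conormal u i) _ z := HasFDerivAt.fun_sum fun j (_ : j ∈ Finset.univ) =>
    HasFDerivAt.fun_smul (((contDiffAt_sqrt_det hu' hz0).mul
      (contDiffAt_metricMatrix_inv hu' hz0 i j)).differentiableAt (by simp)).hasFDerivAt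
        (hd j).hasFDerivAt
  rw [coordDeriv, h6.fderiv, sum_apply, paramNormal_sum, Finset.smul_sum]
  refine Finset.sum_congr rfl fun j _ => ?_
  rw [add_apply, paramNormal_add, smul_apply, paramNormal_smul]
  rw [ContinuousLinearMap.smulRight_apply, paramNormal_smul]
  have h7 : paramNormal u z (coordDeriv n u j z) = 0 := paramNormal_tangent u z _
  rw [h7, smul_zero, add_zero, smul_smul]
  rfl

/-- The divergence form of the Laplacian of a Gaussian along an immersion. -/
lemma sum_coordDeriv_gaussian_conormal [FiniteDimensional ℝ E] (a : ℝ) (hu : ContDiffAt ℝ 2 u z)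
    (hz : ∀ᶠ y in 𝓝 z, Function.Injective (fderiv ℝ u y)) :
    ∑ i, coordDeriv n (fun y => -2 * a * Real.exp (-a * ‖u y‖ ^ 2) * ⟪u y, conormal u i y⟫_ℝ) i z =
      √(metricMatrix n u z).det * (Real.exp (-a * ‖u z‖ ^ 2) *
        (-2 * a * n - 2 * a * ⟪u z, paramMeanCurvature u z⟫_ℝ +
          4 * a ^ 2 * (‖u z‖ ^ 2 - ‖paramNormal u z (u z)‖ ^ 2))) := by
  have hz0 := hz.self_of_nhds
  have hu' : ContDiffAt ℝ (1 + 1) u z := by norm_num; exact hu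
  have hud : DifferentiableAt ℝ u z := hu.differentiableAt (by simp)
  have hP : ∀ i, DifferentiableAt ℝ (conormal u i) z := fun i =>
    (contDiffAt_conormal hu' hz0 i).differentiableAt (by simp)
  have h1 : ∀ i, coordDeriv n (fun y => -2 * a * Real.exp (-a * ‖u y‖ ^ 2) *
      ⟪u y, conormal u i y⟫_ℝ) i z = Real.exp (-a * ‖u z‖ ^ 2) * (
        4 * a ^ 2 * (⟪u z, coordDeriv n u i z⟫_ℝ * ⟪u z, conormal u i z⟫_ℝ)
        - 2 * a * ⟪conormal u i z, coordDeriv n u i z⟫_ℝ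
        - 2 * a * ⟪u z, coordDeriv n (conormal u i) i z⟫_ℝ) := by
    intro i
    have h2 : HasFDerivAt (fun y => -2 * a * Real.exp (-a * ‖u y‖ ^ 2) * ⟪u y, conormal u i y⟫_ℝ)
      _ z := ((((hud.hasFDerivAt.norm_sq).const_mul (-a)).exp).const_mul (-2 * a)).fun_mul
        (hud.hasFDerivAt.inner ℝ (hP i).hasFDerivAt)
    rw [coordDeriv, h2.fderiv]
    simp only [add_apply, smul_apply, ContinuousLinearMap.comp_apply,
      ContinuousLinearMap.prod_apply, fderivInnerCLM_apply, smul_eq_mul, coordDeriv,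
      innerSL_apply_apply]
    rw [real_inner_comm (conormal u i z)]
    ring
  have h3 : ∑ i, ⟪u z, coordDeriv n u i z⟫_ℝ * ⟪u z, conormal u i z⟫_ℝ =
      √(metricMatrix n u z).det * (‖u z‖ ^ 2 - ‖paramNormal u z (u z)‖ ^ 2) := by
    have h4 : ‖u z‖ ^ 2 - ‖paramNormal u z (u z)‖ ^ 2 = ⟪u z, u z - paramNormal u z (u z)⟫_ℝ := by
      have h5 : ⟪u z - paramNormal u z (u z), paramNormal u z (u z)⟫_ℝ = 0 :=
        Submodule.starProjection_inner_eq_zero _ _ (Submodule.starProjection_apply_mem _ _)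
      rw [inner_sub_left, sub_eq_zero] at h5
      rw [inner_sub_right, h5, real_inner_self_eq_norm_sq, real_inner_self_eq_norm_sq]
    rw [h4, paramNormal_eq_sub hz0, sub_sub_cancel, inner_sum, Finset.mul_sum]
    refine Finset.sum_congr rfl fun i _ => ?_
    simp_rw [conormal, inner_sum, inner_smul_right, Finset.mul_sum]
    refine Finset.sum_congr rfl fun j _ => ?_
    rw [real_inner_comm (u z) (coordDeriv n u j z)]
    ring
  have h6 : ∑ i, ⟪conormal u i z, coordDeriv n u i z⟫_ℝ = n * √(metricMatrix n u z).det := by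
    simp [inner_conormal_coordDeriv hz0]
  have h7 : ∑ i, ⟪u z, coordDeriv n (conormal u i) i z⟫_ℝ =
      √(metricMatrix n u z).det * ⟪u z, paramMeanCurvature u z⟫_ℝ := by
    rw [← inner_sum, sum_coordDeriv_conormal hu hz, inner_smul_right]
  rw [Finset.sum_congr rfl fun i _ => h1 i, ← Finset.mul_sum, Finset.sum_sub_distrib,
    Finset.sum_sub_distrib, ← Finset.mul_sum, ← Finset.mul_sum, ← Finset.mul_sum, h3, h6, h7]
  ring

end

end Divergence

/-! ### First variation of the area element -/

section Evolution

open scoped InnerProductSpace Matrix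

variable {n : ℕ} {E : Type*} [NormedAddCommGroup E] [InnerProductSpace ℝ E]

lemma inner_paramNormal_right [FiniteDimensional ℝ E] {u : EuclideanSpace ℝ (Fin n) → E}
    {z : EuclideanSpace ℝ (Fin n)} {v : E} (hv : ∀ i, ⟪v, coordDeriv n u i z⟫_ℝ = 0) (w : E) :
    ⟪v, paramNormal u z w⟫_ℝ = ⟪v, w⟫_ℝ := by
  have h := Submodule.inner_starProjection_left_eq_right
    (((fderiv ℝ u z : EuclideanSpace ℝ (Fin n) →ₗ[ℝ] E).range)ᗮ) v w
  rw [paramNormal, ← h]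
  congr 1
  exact paramNormal_eq_self hv

lemma fderiv_slice {F G : Type*} [NormedAddCommGroup F] [NormedSpace ℝ F]
    [NormedAddCommGroup G] [NormedSpace ℝ G] {U : F × ℝ → G} {y : F} {s : ℝ}
    (hU : DifferentiableAt ℝ U (y, s)) (v : F) :
    fderiv ℝ (fun y' => U (y', s)) y v = fderiv ℝ U (y, s) (v, 0) := by
  have h0 : HasFDerivAt (fun y' : F => (y', s)) ((ContinuousLinearMap.id ℝ F).prod 0) y :=
    (hasFDerivAt_id y).prodMk (hasFDerivAt_const s y)
  have h : HasFDerivAt (fun y' => U (y', s)) _ y := hU.hasFDerivAt.comp y h0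
  rw [h.fderiv]
  simp

/-- The evolution of the area element under a normal variation. -/
lemma hasDerivAt_sqrt_det_metricMatrix [FiniteDimensional ℝ E]
    {U : EuclideanSpace ℝ (Fin n) × ℝ → E} {z : EuclideanSpace ℝ (Fin n)} {t : ℝ}
    (hU : ContDiffAt ℝ 2 U (z, t))
    (hz : Function.Injective (fderiv ℝ (fun y => U (y, t)) z))
    (hN : ∀ᶠ y in 𝓝 z, ∀ i,
      ⟪fderiv ℝ U (y, t) (0, 1), coordDeriv n (fun y' => U (y', t)) i y⟫_ℝ = 0) :
    HasDerivAt (fun s => √(metricMatrix n (fun y => U (y, s)) z).det)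
      (-⟪fderiv ℝ U (z, t) (0, 1), paramMeanCurvature (fun y => U (y, t)) z⟫_ℝ *
        √(metricMatrix n (fun y => U (y, t)) z).det) t := by
  set u : EuclideanSpace ℝ (Fin n) → E := fun y => U (y, t) with hu_def
  have hcy : ContinuousAt (fun y : EuclideanSpace ℝ (Fin n) => (y, t)) z := by fun_prop
  have hcs : ContinuousAt (fun s : ℝ => (z, s)) t := by fun_prop
  have hdU : ∀ᶠ q in 𝓝 (z, t), DifferentiableAt ℝ U q :=
    (hU.eventually (by simp)).mono fun q hq => hq.differentiableAt (by simp)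
  have hu : ContDiffAt ℝ 2 u z := hU.comp z (contDiffAt_id.prodMk contDiffAt_const)
  have hD2 : HasFDerivAt (fderiv ℝ U) (fderiv ℝ (fderiv ℝ U) (z, t)) (z, t) :=
    ((hU.fderiv_right (m := 1) (by norm_num)).differentiableAt (by simp)).hasFDerivAt
  have hsym := (hU.isSymmSndFDerivAt (by simp)).eq
  have hcoord : ∀ᶠ s in 𝓝 t, ∀ i, coordDeriv n (fun y => U (y, s)) i z =
      fderiv ℝ U (z, s) (EuclideanSpace.single i 1, 0) := by
    filter_upwards [hcs.eventually hdU] with s hs i using fderiv_slice hs _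
  have hcoord' : ∀ᶠ y in 𝓝 z, ∀ i, coordDeriv n u i y =
      fderiv ℝ U (y, t) (EuclideanSpace.single i 1, 0) := by
    filter_upwards [hcy.eventually hdU] with s hs i using fderiv_slice hs _
  have hDy : HasFDerivAt (fun y => fderiv ℝ U (y, t)) ((fderiv ℝ (fderiv ℝ U) (z, t)).comp
      ((ContinuousLinearMap.id ℝ _).prod 0)) z :=
    hD2.comp z ((hasFDerivAt_id z).prodMk (hasFDerivAt_const t z))
  have hDs : HasFDerivAt (fun s => fderiv ℝ U (z, s)) ((fderiv ℝ (fderiv ℝ U) (z, t)).comp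
      ((0 : ℝ →L[ℝ] EuclideanSpace ℝ (Fin n)).prod (ContinuousLinearMap.id ℝ ℝ))) t :=
    hD2.comp t ((hasFDerivAt_const z t).prodMk (hasFDerivAt_id t))
  have hc : ∀ i, HasDerivAt (fun s => coordDeriv n (fun y => U (y, s)) i z)
      (fderiv ℝ (fderiv ℝ U) (z, t) (EuclideanSpace.single i 1, 0) (0, 1)) t := by
    intro i
    have h1 := (hDs.clm_apply
      (hasFDerivAt_const (EuclideanSpace.single i (1 : ℝ), (0 : ℝ)) t)).hasDerivAt
    refine (h1.congr_of_eventuallyEq (hcoord.mono fun s hs => hs i)).congr_deriv ?_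
    simp only [add_apply, ContinuousLinearMap.comp_apply, ContinuousLinearMap.flip_apply,
      ContinuousLinearMap.prod_apply]
    simp [hsym (0, 1)]
  -- The velocity is normal at all nearby points, so ⟨∂ₜU, ∂ⱼu⟩ = 0 may be differentiated in space.
  -- This trades the derivative of the velocity for the second fundamental form.
  have hswap : ∀ i j, ⟪fderiv ℝ (fderiv ℝ U) (z, t) (EuclideanSpace.single i 1, 0) (0, 1),
      coordDeriv n u j z⟫_ℝ = -⟪fderiv ℝ U (z, t) (0, 1), coordDeriv n (coordDeriv n u j) i z⟫_ℝ := by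
    intro i j
    have h1 : HasFDerivAt (fun y => fderiv ℝ U (y, t) (0, 1)) _ z :=
      hDy.clm_apply (hasFDerivAt_const ((0 : EuclideanSpace ℝ (Fin n)), (1 : ℝ)) z)
    have h2 : DifferentiableAt ℝ (coordDeriv n u j) z :=
      (contDiffAt_coordDeriv (k := 1) (by norm_num; exact hu) j).differentiableAt (by simp)
    have h3 := fderiv_inner_apply ℝ h1.differentiableAt h2 (EuclideanSpace.single i (1 : ℝ))
    have h4 : (fun y => ⟪fderiv ℝ U (y, t) (0, 1), coordDeriv n u j y⟫_ℝ) =ᶠ[𝓝 z] fun _ => 0 :=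
      hN.mono fun y hy => hy j
    rw [h4.fderiv_eq, h1.fderiv] at h3
    simp only [fderiv_fun_const, Pi.zero_apply, zero_apply, add_apply,
      ContinuousLinearMap.comp_apply, ContinuousLinearMap.flip_apply,
      ContinuousLinearMap.prod_apply, map_zero, zero_add] at h3
    have h5 := h3.symm
    rw [add_comm] at h5
    exact eq_neg_of_add_eq_zero_left h5
  have hg : ∀ i j, HasDerivAt (fun s => metricMatrix n (fun y => U (y, s)) z i j)
      (-⟪fderiv ℝ U (z, t) (0, 1), coordDeriv n (coordDeriv n u i) j z⟫_ℝ
        - ⟪fderiv ℝ U (z, t) (0, 1), coordDeriv n (coordDeriv n u j) i z⟫_ℝ) t := by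
    intro i j
    refine ((hc i).inner ℝ (hc j)).congr_deriv ?_
    rw [real_inner_comm, ← hu_def, hswap, hswap]
    ring
  have h := (hasFDerivAt_sqrt_det (fun i j => (hg i j).hasFDerivAt)
    (metricMatrix_det_pos hz)).hasDerivAt
  refine h.congr_deriv ?_
  rw [paramMeanCurvature]
  simp only [smul_apply, sum_apply, ContinuousLinearMap.toSpanSingleton_apply,
    smul_eq_mul, inner_sum, inner_smul_right, inner_paramNormal_right hN.self_of_nhds]
  have h1 : ∑ i, ∑ j, (metricMatrix n u z)⁻¹ i j * (1 *
      (-⟪fderiv ℝ U (z, t) (0, 1), coordDeriv n (coordDeriv n u j) i z⟫_ℝ -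
        ⟪fderiv ℝ U (z, t) (0, 1), coordDeriv n (coordDeriv n u i) j z⟫_ℝ)) =
      -2 * ∑ i, ∑ j, (metricMatrix n u z)⁻¹ i j *
        ⟪fderiv ℝ U (z, t) (0, 1), coordDeriv n (coordDeriv n u j) i z⟫_ℝ := by
    rw [Finset.mul_sum]
    refine Finset.sum_congr rfl fun i _ => ?_
    rw [Finset.mul_sum]
    refine Finset.sum_congr rfl fun j _ => ?_
    rw [coordDeriv_comm hu j i]
    ring
  rw [h1]
  ring

end Evolution

/-! ### Independence of the chart -/

section Charts

set_option linter.unusedSectionVars false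

variable {n : ℕ} {M : Type*} [TopologicalSpace M] [ChartedSpace (EuclideanSpace ℝ (Fin n)) M]
  {E : Type*} [NormedAddCommGroup E] [InnerProductSpace ℝ E]

lemma extChartAt_coe_eq (p : M) : ⇑(extChartAt (𝓡 n) p) = chartAt (EuclideanSpace ℝ (Fin n)) p := by
  ext; simp

lemma extChartAt_symm_coe_eq (p : M) :
    ⇑(extChartAt (𝓡 n) p).symm = (chartAt (EuclideanSpace ℝ (Fin n)) p).symm := by
  ext; simp

lemma extChartAt_target_eq (p : M) :
    (extChartAt (𝓡 n) p).target = (chartAt (EuclideanSpace ℝ (Fin n)) p).target := by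
  simp

lemma localRep_eq (f : M → E) (p : M) :
    localRep n f p = f ∘ (chartAt (EuclideanSpace ℝ (Fin n)) p).symm := by
  rw [localRep, extChartAt_symm_coe_eq]

lemma differential_eq_fderiv_localRep {f : M → E} {p : M}
    (hf : MDifferentiableAt (𝓡 n) 𝓘(ℝ, E) f p) :
    differential n f p = fderiv ℝ (localRep n f p) (extChartAt (𝓡 n) p p) := by
  rw [differential, hf.mfderiv]
  simp [localRep, writtenInExtChartAt]
  rfl

variable [IsManifold (𝓡 n) ∞ M]
  {e : OpenPartialHomeomorph M (EuclideanSpace ℝ (Fin n))}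

lemma contDiffOn_comp_symm {F : Type*} [NormedAddCommGroup F] [NormedSpace ℝ F]
    (he : e ∈ IsManifold.maximalAtlas (𝓡 n) ∞ M) {f : M → F}
    (hf : ContMDiffOn (𝓡 n) 𝓘(ℝ, F) ∞ f e.source) : ContDiffOn ℝ ∞ (f ∘ e.symm) e.target := by
  rw [← contMDiffOn_iff_contDiffOn]
  exact hf.comp (contMDiffOn_symm_of_mem_maximalAtlas he) e.mapsTo_symm

lemma contDiffAt_comp_symm {F : Type*} [NormedAddCommGroup F] [NormedSpace ℝ F]
    (he : e ∈ IsManifold.maximalAtlas (𝓡 n) ∞ M) {f : M → F}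
    (hf : ContMDiff (𝓡 n) 𝓘(ℝ, F) ∞ f) {z : EuclideanSpace ℝ (Fin n)} (hz : z ∈ e.target) :
    ContDiffAt ℝ ∞ (f ∘ e.symm) z :=
  (contDiffOn_comp_symm he hf.contMDiffOn).contDiffAt (e.open_target.mem_nhds hz)

lemma contDiffAt_transition {e' : OpenPartialHomeomorph M (EuclideanSpace ℝ (Fin n))}
    (he : e ∈ IsManifold.maximalAtlas (𝓡 n) ∞ M) (he' : e' ∈ IsManifold.maximalAtlas (𝓡 n) ∞ M)
    {z : EuclideanSpace ℝ (Fin n)} (hz : z ∈ e.target) (hz' : e.symm z ∈ e'.source) :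
    ContDiffAt ℝ ∞ (e' ∘ e.symm) z := by
  rw [← contMDiffAt_iff_contDiffAt]
  exact (contMDiffAt_of_mem_maximalAtlas he' hz').comp z
    (contMDiffAt_symm_of_mem_maximalAtlas he hz)

lemma injective_fderiv_of_leftInverse {F G : Type*} [NormedAddCommGroup F] [NormedSpace ℝ F]
    [NormedAddCommGroup G] [NormedSpace ℝ G] {g : F → G} {h : G → F} {z : F}
    (hg : DifferentiableAt ℝ g z) (hh : DifferentiableAt ℝ h (g z))
    (hgh : ∀ᶠ y in 𝓝 z, h (g y) = y) : Function.Injective (fderiv ℝ g z) := by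
  have h1 : HasFDerivAt (h ∘ g) ((fderiv ℝ h (g z)).comp (fderiv ℝ g z)) z :=
    hh.hasFDerivAt.comp z hg.hasFDerivAt
  have h2 : HasFDerivAt (h ∘ g) (ContinuousLinearMap.id ℝ F) z :=
    (hasFDerivAt_id z).congr_of_eventuallyEq hgh
  have h3 := h1.unique h2
  refine Function.LeftInverse.injective (g := fderiv ℝ h (g z)) fun v => ?_
  exact congrArg (fun L : F →L[ℝ] F => L v) h3

lemma injective_fderiv_transition {e' : OpenPartialHomeomorph M (EuclideanSpace ℝ (Fin n))}
    (he : e ∈ IsManifold.maximalAtlas (𝓡 n) ∞ M) (he' : e' ∈ IsManifold.maximalAtlas (𝓡 n) ∞ M)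
    {z : EuclideanSpace ℝ (Fin n)} (hz : z ∈ e.target) (hz' : e.symm z ∈ e'.source) :
    Function.Injective (fderiv ℝ (e' ∘ e.symm) z) := by
  have h1 : e'.symm (e' (e.symm z)) = e.symm z := e'.left_inv hz'
  refine injective_fderiv_of_leftInverse (h := e ∘ e'.symm)
    ((contDiffAt_transition he he' hz hz').differentiableAt (by simp)) ?_ ?_
  · refine (contDiffAt_transition he' he (e'.map_source hz') ?_).differentiableAt (by simp)
    rw [h1]
    exact e.map_target hz
  · have h2 : ∀ᶠ y in 𝓝 z, e.symm y ∈ e'.source :=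
      (e.symm.continuousAt hz).eventually (e'.open_source.mem_nhds hz')
    filter_upwards [h2, e.open_target.mem_nhds hz] with y hy hy'
    simp [e'.left_inv hy, e.right_inv hy']

lemma chartAt_mem (p : M) :
    chartAt (EuclideanSpace ℝ (Fin n)) p ∈ IsManifold.maximalAtlas (𝓡 n) ∞ M :=
  IsManifold.chart_mem_maximalAtlas p

lemma comp_symm_eventuallyEq {F : Type*} (f : M → F)
    {e' : OpenPartialHomeomorph M (EuclideanSpace ℝ (Fin n))}
    {z : EuclideanSpace ℝ (Fin n)} (hz : z ∈ e.target) (hz' : e.symm z ∈ e'.source) :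
    f ∘ e.symm =ᶠ[𝓝 z] (f ∘ e'.symm) ∘ (e' ∘ e.symm) := by
  have h2 : ∀ᶠ y in 𝓝 z, e.symm y ∈ e'.source :=
    (e.symm.continuousAt hz).eventually (e'.open_source.mem_nhds hz')
  filter_upwards [h2] with y hy
  simp [e'.left_inv hy]

/-- The differential of a smooth map in terms of its expression in an arbitrary chart. -/
lemma exists_differential_eq {f : M → E} (hf : ContMDiff (𝓡 n) 𝓘(ℝ, E) ∞ f)
    (he : e ∈ IsManifold.maximalAtlas (𝓡 n) ∞ M) {p : M} (hp : p ∈ e.source) :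
    differential n f p = (fderiv ℝ (f ∘ e.symm) (e p)).comp
      (fderiv ℝ (e ∘ (chartAt (EuclideanSpace ℝ (Fin n)) p).symm)
        (chartAt (EuclideanSpace ℝ (Fin n)) p p)) := by
  have hz := mem_chart_target (EuclideanSpace ℝ (Fin n)) p
  have hz' : (chartAt (EuclideanSpace ℝ (Fin n)) p).symm
      (chartAt (EuclideanSpace ℝ (Fin n)) p p) ∈ e.source := by simpa using hp
  have h3 : (e ∘ (chartAt (EuclideanSpace ℝ (Fin n)) p).symm)
      (chartAt (EuclideanSpace ℝ (Fin n)) p p) = e p := by simp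
  rw [differential_eq_fderiv_localRep (hf.mdifferentiable (by simp) p), localRep_eq,
    extChartAt_coe_eq, (comp_symm_eventuallyEq f hz hz').fderiv_eq,
    fderiv_comp _ _ ((contDiffAt_transition (chartAt_mem p) he hz hz').differentiableAt (by simp)),
    h3]
  rw [h3]
  exact (contDiffAt_comp_symm he hf (e.map_source hp)).differentiableAt (by simp)

lemma surjective_fderiv_transition (he : e ∈ IsManifold.maximalAtlas (𝓡 n) ∞ M) {p : M}
    (hp : p ∈ e.source) :
    Function.Surjective (fderiv ℝ (e ∘ (chartAt (EuclideanSpace ℝ (Fin n)) p).symm)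
        (chartAt (EuclideanSpace ℝ (Fin n)) p p)) := by
  refine LinearMap.surjective_of_injective (f := ContinuousLinearMap.toLinearMap _) ?_
  exact injective_fderiv_transition (chartAt_mem p) he (mem_chart_target _ p) (by simpa using hp)

lemma range_differential {f : M → E} (hf : ContMDiff (𝓡 n) 𝓘(ℝ, E) ∞ f)
    (he : e ∈ IsManifold.maximalAtlas (𝓡 n) ∞ M) {p : M} (hp : p ∈ e.source) :
    (differential n f p : EuclideanSpace ℝ (Fin n) →ₗ[ℝ] E).range =
      (fderiv ℝ (f ∘ e.symm) (e p) : EuclideanSpace ℝ (Fin n) →ₗ[ℝ] E).range := by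
  rw [exists_differential_eq hf he hp]
  ext w
  constructor
  · rintro ⟨a, rfl⟩; exact ⟨_, rfl⟩
  · rintro ⟨a, rfl⟩
    obtain ⟨c, rfl⟩ := surjective_fderiv_transition he hp a
    exact ⟨c, rfl⟩

lemma IsImmersion.injective_fderiv {f : M → E} (hf : IsImmersion n f)
    (he : e ∈ IsManifold.maximalAtlas (𝓡 n) ∞ M) {z : EuclideanSpace ℝ (Fin n)}
    (hz : z ∈ e.target) : Function.Injective (fderiv ℝ (f ∘ e.symm) z) := by
  have h1 := exists_differential_eq hf.smooth he (e.map_target hz)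
  rw [e.right_inv hz] at h1
  intro a b hab
  obtain ⟨a, rfl⟩ := surjective_fderiv_transition he (e.map_target hz) a
  obtain ⟨b, rfl⟩ := surjective_fderiv_transition he (e.map_target hz) b
  have h2 := hf.injective_differential (e.symm z) (a₁ := a) (a₂ := b)
  rw [h1] at h2
  rw [h2 hab]

lemma normalPart_eq_paramNormal [FiniteDimensional ℝ E] {f : M → E}
    (hf : ContMDiff (𝓡 n) 𝓘(ℝ, E) ∞ f)
    (he : e ∈ IsManifold.maximalAtlas (𝓡 n) ∞ M) {p : M} (hp : p ∈ e.source) (v : E) :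
    normalPart n f p v = paramNormal (f ∘ e.symm) (e p) v := by
  simp only [normalPart, paramNormal, range_differential hf he hp]

/-- The mean curvature vector can be computed in an arbitrary chart. -/
lemma meanCurvature_eq_paramMeanCurvature [FiniteDimensional ℝ E] {f : M → E}
    (hf : ContMDiff (𝓡 n) 𝓘(ℝ, E) ∞ f)
    (he : e ∈ IsManifold.maximalAtlas (𝓡 n) ∞ M) {p : M} (hp : p ∈ e.source) :
    meanCurvature n f p = paramMeanCurvature (f ∘ e.symm) (e p) := by
  have hz := mem_chart_target (EuclideanSpace ℝ (Fin n)) p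
  have hz' : (chartAt (EuclideanSpace ℝ (Fin n)) p).symm
      (chartAt (EuclideanSpace ℝ (Fin n)) p p) ∈ e.source := by simpa using hp
  have h3 : (e ∘ (chartAt (EuclideanSpace ℝ (Fin n)) p).symm)
      (chartAt (EuclideanSpace ℝ (Fin n)) p p) = e p := by simp
  have h2 : (2 : ℕ∞ω) ≤ ∞ := by norm_cast
  have h1 := paramMeanCurvature_comp (u := f ∘ (chartAt (EuclideanSpace ℝ (Fin n)) p).symm)
    ((contDiffAt_transition (chartAt_mem p) he hz hz').of_le h2)
    (by rw [h3]; exact (contDiffAt_comp_symm he hf (e.map_source hp)).of_le h2)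
    (comp_symm_eventuallyEq f hz hz') (injective_fderiv_transition (chartAt_mem p) he hz hz')
  rw [h3] at h1
  rw [← h1, meanCurvature, paramMeanCurvature, localRep_eq, extChartAt_coe_eq]
  simp only [normalPart_eq_paramNormal hf (chartAt_mem p) (mem_chart_source _ p)]

end Charts

/-! ### The induced Riemannian measure -/

section InducedMeasure

set_option linter.unusedSectionVars false

open scoped InnerProductSpace Matrix ENNReal

variable {n : ℕ} {M : Type*} [TopologicalSpace M] [ChartedSpace (EuclideanSpace ℝ (Fin n)) M]
  {E : Type*} [NormedAddCommGroup E] [InnerProductSpace ℝ E]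

lemma det_gram_comp (L : EuclideanSpace ℝ (Fin n) →L[ℝ] E)
    (T : EuclideanSpace ℝ (Fin n) →L[ℝ] EuclideanSpace ℝ (Fin n)) :
    (Matrix.gram ℝ fun i => L (T (EuclideanSpace.single i (1 : ℝ)))).det =
      T.det ^ 2 * (Matrix.gram ℝ fun i => L (EuclideanSpace.single i (1 : ℝ))).det := by
  set P : Matrix (Fin n) (Fin n) ℝ := Matrix.of fun k i => (T (EuclideanSpace.single i 1)) k
    with hP
  have h1 : Matrix.gram ℝ (fun i => L (T (EuclideanSpace.single i (1 : ℝ)))) =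
      Pᵀ * Matrix.gram ℝ (fun i => L (EuclideanSpace.single i (1 : ℝ))) * P := by
    ext i j
    rw [Matrix.gram_apply, map_eq_sum L (T (EuclideanSpace.single i 1)),
      map_eq_sum L (T (EuclideanSpace.single j 1))]
    simp only [Matrix.gram_apply, hP, Matrix.of_apply, Matrix.mul_apply, Matrix.transpose_apply,
      sum_inner, inner_sum, inner_smul_left, inner_smul_right, Finset.sum_mul, Finset.mul_sum]
    simp only [conj_trivial, mul_left_comm, mul_comm]
  have h2 : T.det = P.det := by
    have h3 := LinearMap.det_toMatrix (EuclideanSpace.basisFun (Fin n) ℝ).toBasis T.toLinearMap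
    rw [ContinuousLinearMap.det, ← h3]
    congr 1
  rw [h1, Matrix.det_mul, Matrix.det_mul, Matrix.det_transpose, h2]
  ring

/-- The area element `√(det g)` of `f` in the chart `e`. -/
def areaElement (f : M → E) (e : OpenPartialHomeomorph M (EuclideanSpace ℝ (Fin n)))
    (z : EuclideanSpace ℝ (Fin n)) : ℝ :=
  √(metricMatrix n (f ∘ e.symm) z).det

/-- The measure on `M` given by the area element of `f` in the chart `e`. -/
def paramMeasure [MeasurableSpace M] (f : M → E)
    (e : OpenPartialHomeomorph M (EuclideanSpace ℝ (Fin n))) : Measure M :=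
  ((volume.restrict e.target).withDensity
    (fun z => ENNReal.ofReal (areaElement f e z))).map e.symm

lemma chartMeasure_eq [MeasurableSpace M] (f : M → E) (p : M) :
    chartMeasure n f p = paramMeasure f (chartAt (EuclideanSpace ℝ (Fin n)) p) := by
  rw [chartMeasure, paramMeasure, extChartAt_symm_coe_eq, extChartAt_target_eq, localRep_eq]
  rfl

variable [IsManifold (𝓡 n) ∞ M] {e e' : OpenPartialHomeomorph M (EuclideanSpace ℝ (Fin n))}
  {f : M → E}

lemma continuousOn_areaElement (hf : ContMDiff (𝓡 n) 𝓘(ℝ, E) ∞ f)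
    (he : e ∈ IsManifold.maximalAtlas (𝓡 n) ∞ M) : ContinuousOn (areaElement f e) e.target := by
  intro z hz
  have h1 : ContDiffAt ℝ (0 + 1) (f ∘ e.symm) z :=
    (contDiffAt_comp_symm he hf hz).of_le (by norm_num)
  exact ((contDiffAt_det (contDiffAt_metricMatrix h1)).continuousAt.sqrt).continuousWithinAt

lemma areaElement_pos (hf : IsImmersion n f) (he : e ∈ IsManifold.maximalAtlas (𝓡 n) ∞ M)
    {z : EuclideanSpace ℝ (Fin n)} (hz : z ∈ e.target) : 0 < areaElement f e z :=
  Real.sqrt_pos.2 (metricMatrix_det_pos (hf.injective_fderiv he hz))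

/-- The transformation rule for area elements. -/
lemma areaElement_transition (hf : ContMDiff (𝓡 n) 𝓘(ℝ, E) ∞ f)
    (he : e ∈ IsManifold.maximalAtlas (𝓡 n) ∞ M) (he' : e' ∈ IsManifold.maximalAtlas (𝓡 n) ∞ M)
    {z : EuclideanSpace ℝ (Fin n)} (hz : z ∈ e.target) (hz' : e.symm z ∈ e'.source) :
    areaElement f e z =
      |(fderiv ℝ (e' ∘ e.symm) z).det| * areaElement f e' (e' (e.symm z)) := by
  have h1 : fderiv ℝ (f ∘ e.symm) z =
      (fderiv ℝ (f ∘ e'.symm) (e' (e.symm z))).comp (fderiv ℝ (e' ∘ e.symm) z) := by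
    rw [(comp_symm_eventuallyEq f hz hz').fderiv_eq, fderiv_comp]
    · rfl
    · exact (contDiffAt_comp_symm he' hf (e'.map_source hz')).differentiableAt (by simp)
    · exact (contDiffAt_transition he he' hz hz').differentiableAt (by simp)
  have h2 : (metricMatrix n (f ∘ e.symm) z).det = (fderiv ℝ (e' ∘ e.symm) z).det ^ 2 *
      (metricMatrix n (f ∘ e'.symm) (e' (e.symm z))).det := by
    have := det_gram_comp (fderiv ℝ (f ∘ e'.symm) (e' (e.symm z))) (fderiv ℝ (e' ∘ e.symm) z)
    simp only [metricMatrix, coordDeriv, h1]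
    exact this
  rw [areaElement, h2, Real.sqrt_mul (sq_nonneg _), Real.sqrt_sq_eq_abs]
  rfl

variable [MeasurableSpace M] [BorelSpace M]

lemma aemeasurable_symm {κ : Measure (EuclideanSpace ℝ (Fin n))}
    (hκ : κ ≪ volume.restrict e.target) : AEMeasurable e.symm κ :=
  (e.continuousOn_symm.aemeasurable e.open_target.measurableSet).mono_ac hκ

lemma measurableSet_target_inter_preimage {s : Set M} (hs : MeasurableSet s) :
    MeasurableSet (e.target ∩ e.symm ⁻¹' s) := by
  classical
  -- Outside the target, `e.symm` takes uncontrolled values. Replacing it there by a constant gives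
  -- a measurable map.
  have h := e.continuousOn_symm.measurable_piecewise
    (g := fun _ => (e.symm 0)) continuousOn_const e.open_target.measurableSet hs
  convert h.inter e.open_target.measurableSet using 1
  ext z
  by_cases hz : z ∈ e.target <;> simp [hz, Set.piecewise]

lemma paramMeasure_apply {s : Set M} (hs : MeasurableSet s) :
    paramMeasure f e s = ∫⁻ z in e.target ∩ e.symm ⁻¹' s, ENNReal.ofReal (areaElement f e z) := by
  have h1 : NullMeasurableSet (e.symm ⁻¹' s) (volume.restrict e.target) :=
    (aemeasurable_symm Measure.AbsolutelyContinuous.rfl).nullMeasurableSet_preimage hs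
  rw [paramMeasure, Measure.map_apply_of_aemeasurable
    (aemeasurable_symm (withDensity_absolutelyContinuous _ _)) hs, withDensity_apply₀ _ h1,
    Measure.restrict_restrict₀ h1, Set.inter_comm]

lemma paramMeasure_inter_source {s : Set M} (hs : MeasurableSet s) :
    paramMeasure f e (s ∩ e.source) = paramMeasure f e s := by
  rw [paramMeasure_apply hs, paramMeasure_apply (hs.inter e.open_source.measurableSet)]
  congr 2
  ext z
  simp only [Set.mem_inter_iff, Set.mem_preimage]
  constructor
  · rintro ⟨h1, h2, -⟩; exact ⟨h1, h2⟩
  · rintro ⟨h1, h2⟩; exact ⟨h1, h2, e.map_target h1⟩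

/-- The measures given by the area elements in two charts agree on the overlap. -/
lemma paramMeasure_congr (hf : ContMDiff (𝓡 n) 𝓘(ℝ, E) ∞ f)
    (he : e ∈ IsManifold.maximalAtlas (𝓡 n) ∞ M) (he' : e' ∈ IsManifold.maximalAtlas (𝓡 n) ∞ M)
    {s : Set M} (hs : MeasurableSet s) (hse : s ⊆ e.source) (hse' : s ⊆ e'.source) :
    paramMeasure f e s = paramMeasure f e' s := by
  have hm := measurableSet_target_inter_preimage (e := e) hs
  have himg : (e' ∘ e.symm) '' (e.target ∩ e.symm ⁻¹' s) = e'.target ∩ e'.symm ⁻¹' s := by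
    ext w
    constructor
    · rintro ⟨z, ⟨hz, hz'⟩, rfl⟩
      refine ⟨e'.map_source (hse' hz'), ?_⟩
      simpa [e'.left_inv (hse' hz')] using hz'
    · rintro ⟨hw, hw'⟩
      refine ⟨e (e'.symm w), ⟨e.map_source (hse hw'), ?_⟩, ?_⟩
      · simpa [e.left_inv (hse hw')] using hw'
      · simp [e.left_inv (hse hw'), e'.right_inv hw]
  have hinj : Set.InjOn (e' ∘ e.symm) (e.target ∩ e.symm ⁻¹' s) := by
    rintro a ⟨ha, ha'⟩ b ⟨hb, hb'⟩ hab
    exact e.symm.injOn ha hb (e'.injOn (hse' ha') (hse' hb') hab)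
  rw [paramMeasure_apply hs, paramMeasure_apply hs, ← himg,
    lintegral_image_eq_lintegral_abs_det_fderiv_mul volume hm
      (f' := fun z => fderiv ℝ (e' ∘ e.symm) z) (fun z hz =>
        ((contDiffAt_transition he he' hz.1 (hse' hz.2)).differentiableAt
          (by simp)).hasFDerivAt.hasFDerivWithinAt) hinj]
  refine setLIntegral_congr_fun hm fun z hz => ?_
  rw [areaElement_transition hf he he' hz.1 (hse' hz.2), ENNReal.ofReal_mul (abs_nonneg _)]
  rfl

variable [SecondCountableTopology M]

lemma exists_countable_charts (n : ℕ) (M : Type*) [TopologicalSpace M]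
    [ChartedSpace (EuclideanSpace ℝ (Fin n)) M] [SecondCountableTopology M] :
    ∃ s : Set M, s.Countable ∧
      ⋃ p : s, (chartAt (EuclideanSpace ℝ (Fin n)) (p : M)).source = Set.univ := by
  obtain ⟨s, hs, hs'⟩ := TopologicalSpace.countable_cover_nhds
    (fun p : M => chart_source_mem_nhds (EuclideanSpace ℝ (Fin n)) p)
  exact ⟨s, hs, by rw [← hs']; exact Set.iUnion_subtype _ _⟩

lemma measure_ext_of_charts (n : ℕ) {M : Type*} [TopologicalSpace M]
    [ChartedSpace (EuclideanSpace ℝ (Fin n)) M] [SecondCountableTopology M]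
    [MeasurableSpace M] {μ ν : Measure M}
    (h : ∀ p : M, μ.restrict (chartAt (EuclideanSpace ℝ (Fin n)) p).source =
      ν.restrict (chartAt (EuclideanSpace ℝ (Fin n)) p).source) : μ = ν := by
  obtain ⟨s, hs, hs'⟩ := exists_countable_charts n M
  have : Countable s := hs
  exact Measure.ext_of_iUnion_eq_univ hs' fun p => h p

/-- A measurable partition of `M` subordinate to countably many charts. -/
lemma exists_chart_partition (n : ℕ) (M : Type*) [TopologicalSpace M]
    [ChartedSpace (EuclideanSpace ℝ (Fin n)) M] [SecondCountableTopology M]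
    [MeasurableSpace M] [BorelSpace M] [Nonempty M] :
    ∃ (q : ℕ → M) (D : ℕ → Set M), (∀ i, MeasurableSet (D i)) ∧
      (∀ i, D i ⊆ (chartAt (EuclideanSpace ℝ (Fin n)) (q i)).source) ∧
      Pairwise (Function.onFun Disjoint D) ∧ ⋃ i, D i = Set.univ := by
  obtain ⟨s, hs, hs'⟩ := exists_countable_charts n M
  have hne : s.Nonempty := by
    obtain ⟨p⟩ := ‹Nonempty M›
    have hp : p ∈ ⋃ p : s, (chartAt (EuclideanSpace ℝ (Fin n)) (p : M)).source := by
      rw [hs']; trivial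
    obtain ⟨a, -⟩ := Set.mem_iUnion.1 hp
    exact ⟨a, a.2⟩
  obtain ⟨q, hq⟩ := hs.exists_eq_range hne
  refine ⟨q, disjointed fun i => (chartAt (EuclideanSpace ℝ (Fin n)) (q i)).source,
    fun i => MeasurableSet.disjointed
      (fun j => (chartAt (EuclideanSpace ℝ (Fin n)) (q j)).open_source.measurableSet) i,
    fun i => disjointed_le _ i, disjoint_disjointed _, ?_⟩
  rw [iUnion_disjointed, ← hs', Set.iUnion_subtype, hq]
  exact (Set.biUnion_range (f := q)
    (g := fun p => (chartAt (EuclideanSpace ℝ (Fin n)) p).source)).symm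

/-- On the domain of a chart, the induced measure is given by the area element. -/
lemma inducedMeasure_apply_of_subset (hf : ContMDiff (𝓡 n) 𝓘(ℝ, E) ∞ f)
    (he : e ∈ IsManifold.maximalAtlas (𝓡 n) ∞ M) {s : Set M} (hs : MeasurableSet s)
    (hse : s ⊆ e.source) : inducedMeasure n f s = paramMeasure f e s := by
  rcases isEmpty_or_nonempty M with hM | hM
  · simp [Set.eq_empty_of_isEmpty s]
  obtain ⟨q, D, hD, hDq, hdisj, hcov⟩ := exists_chart_partition n M
  -- The chart measures, glued along a countable measurable partition, form one measure. It agrees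
  -- with every chart measure on the domain of that chart, and is then shown to be the supremum.
  set ν : Measure M := Measure.sum fun i =>
    (paramMeasure f (chartAt (EuclideanSpace ℝ (Fin n)) (q i))).restrict (D i) with hν
  have hdec : ∀ (κ : Measure M) (s : Set M), MeasurableSet s → κ s = ∑' i, κ (s ∩ D i) := by
    intro κ s hs
    rw [← measure_iUnion (fun i j hij => (hdisj hij).mono Set.inter_subset_right
      Set.inter_subset_right) fun i => hs.inter (hD i), ← Set.inter_iUnion, hcov, Set.inter_univ]
  have hνa : ∀ s : Set M, MeasurableSet s → ν s =
      ∑' i, paramMeasure f (chartAt (EuclideanSpace ℝ (Fin n)) (q i)) (s ∩ D i) := by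
    intro s hs
    rw [hν, Measure.sum_apply _ hs]
    exact tsum_congr fun i => Measure.restrict_apply hs
  have hνe : ∀ {e : OpenPartialHomeomorph M (EuclideanSpace ℝ (Fin n))},
      e ∈ IsManifold.maximalAtlas (𝓡 n) ∞ M → ∀ s : Set M, MeasurableSet s → s ⊆ e.source →
      ν s = paramMeasure f e s := by
    intro e he s hs hse
    rw [hνa s hs, hdec (paramMeasure f e) s hs]
    exact tsum_congr fun i => paramMeasure_congr hf (chartAt_mem _) he (hs.inter (hD i))
      (Set.inter_subset_right.trans (hDq i)) (Set.inter_subset_left.trans hse)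
  have hle : inducedMeasure n f ≤ ν := by
    refine iSup_le fun p => Measure.le_iff.2 fun s hs => ?_
    rw [chartMeasure_eq, ← paramMeasure_inter_source hs, ← hνe (chartAt_mem p) _
      (hs.inter (chartAt _ p).open_source.measurableSet) Set.inter_subset_right]
    exact measure_mono Set.inter_subset_left
  have hge : ν ≤ inducedMeasure n f := by
    refine Measure.le_iff.2 fun s hs => ?_
    rw [hνa s hs, hdec (inducedMeasure n f) s hs]
    refine ENNReal.tsum_le_tsum fun i => ?_
    rw [← chartMeasure_eq]
    exact Measure.le_iff'.1 (le_iSup (fun p : M => chartMeasure n f p) (q i)) _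
  rw [le_antisymm hle hge, hνe he s hs hse]

lemma inducedMeasure_restrict_source (hf : ContMDiff (𝓡 n) 𝓘(ℝ, E) ∞ f)
    (he : e ∈ IsManifold.maximalAtlas (𝓡 n) ∞ M) :
    (inducedMeasure n f).restrict e.source = paramMeasure f e := by
  refine Measure.ext fun s hs => ?_
  rw [Measure.restrict_apply hs, inducedMeasure_apply_of_subset hf he
    (hs.inter e.open_source.measurableSet) Set.inter_subset_right, paramMeasure_inter_source hs]

/-- Makes Fubini's theorem available on the product of `M` with the time interval. -/
lemma sFinite_inducedMeasure (hf : ContMDiff (𝓡 n) 𝓘(ℝ, E) ∞ f) :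
    SFinite (inducedMeasure n f) := by
  rcases isEmpty_or_nonempty M with hM | hM
  · rw [Measure.eq_zero_of_isEmpty (inducedMeasure n f)]; infer_instance
  obtain ⟨q, D, hD, hDq, hdisj, hcov⟩ := exists_chart_partition n M
  have h1 : inducedMeasure n f = Measure.sum fun i =>
      (paramMeasure f (chartAt (EuclideanSpace ℝ (Fin n)) (q i))).restrict (D i) := by
    have h2 := Measure.restrict_iUnion (μ := inducedMeasure n f) hdisj hD
    rw [hcov, Measure.restrict_univ] at h2
    rw [h2]
    congr 1
    ext1 i
    rw [← inducedMeasure_restrict_source hf (chartAt_mem (q i)),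
      Measure.restrict_restrict_of_subset (hDq i)]
  have h3 : ∀ p : M, SFinite (paramMeasure f (chartAt (EuclideanSpace ℝ (Fin n)) p)) := by
    intro p
    unfold paramMeasure
    infer_instance
  rw [h1]
  infer_instance

/-- Multiplying the area elements by a function multiplies the induced measure. -/
lemma inducedMeasure_eq_withDensity {f' : M → E} (hf : ContMDiff (𝓡 n) 𝓘(ℝ, E) ∞ f)
    (hf' : ContMDiff (𝓡 n) 𝓘(ℝ, E) ∞ f') {J : M → ℝ} (hJ : Continuous J)
    (h : ∀ p : M, ∀ z ∈ (chartAt (EuclideanSpace ℝ (Fin n)) p).target,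
      areaElement f' (chartAt _ p) z =
        J ((chartAt (EuclideanSpace ℝ (Fin n)) p).symm z) * areaElement f (chartAt _ p) z)
    (hJ0 : ∀ p, 0 ≤ J p) :
    inducedMeasure n f' = (inducedMeasure n f).withDensity fun p => ENNReal.ofReal (J p) := by
  refine measure_ext_of_charts n fun p => ?_
  replace h := h p
  have he := chartAt_mem (n := n) p
  generalize chartAt (EuclideanSpace ℝ (Fin n)) p = e at h he
  have hos := e.open_source.measurableSet
  have hot := e.open_target.measurableSet
  rw [inducedMeasure_restrict_source hf' he, restrict_withDensity hos,
    inducedMeasure_restrict_source hf he]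
  have hJm : Measurable fun p => ENNReal.ofReal (J p) := hJ.measurable.ennreal_ofReal
  refine Measure.ext fun s hs => ?_
  have hac := withDensity_absolutelyContinuous (volume.restrict e.target)
      (fun z => ENNReal.ofReal (areaElement f e z))
  rw [withDensity_apply _ hs]
  have ham : AEMeasurable (fun z => ENNReal.ofReal (areaElement f e z))
      (volume.restrict e.target) :=
    ((continuousOn_areaElement hf he).aemeasurable hot).ennreal_ofReal
  have hem : AEMeasurable e.symm (volume.restrict e.target) :=
    aemeasurable_symm Measure.AbsolutelyContinuous.rfl
  rw [← lintegral_indicator hs, paramMeasure, paramMeasure, lintegral_map' (hJm.indicator hs).aemeasurable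
    (aemeasurable_symm hac), lintegral_withDensity_eq_lintegral_mul₀ ham
      (g := fun z => s.indicator (fun p => ENNReal.ofReal (J p)) (e.symm z))
      ((hJm.indicator hs).comp_aemeasurable hem)]
  rw [Measure.map_apply_of_aemeasurable (aemeasurable_symm (withDensity_absolutelyContinuous _ _))
    hs, withDensity_apply₀ _ (hem.nullMeasurableSet_preimage hs),
    ← lintegral_indicator₀ (hem.nullMeasurableSet_preimage hs)]
  refine setLIntegral_congr_fun hot fun z hz => ?_
  by_cases hzs : e.symm z ∈ s
  · have hzs' : z ∈ e.symm ⁻¹' s := hzs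
    simp only [Set.indicator_of_mem hzs, Set.indicator_of_mem hzs', Pi.mul_apply]
    rw [h z hz, ENNReal.ofReal_mul (hJ0 _), mul_comm]
  · have hzs' : z ∉ e.symm ⁻¹' s := hzs
    simp [hzs, hzs']

end InducedMeasure

/-! ### Integration in charts and behaviour under similarities -/

section Integration

set_option linter.unusedSectionVars false

open scoped InnerProductSpace Matrix ENNReal

variable {n : ℕ} {M : Type*} [TopologicalSpace M] [ChartedSpace (EuclideanSpace ℝ (Fin n)) M]
  {E : Type*} [NormedAddCommGroup E] [InnerProductSpace ℝ E]

lemma coordDeriv_similarity {u : EuclideanSpace ℝ (Fin n) → E} {z : EuclideanSpace ℝ (Fin n)}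
    (hu : DifferentiableAt ℝ u z) (α : ℝ) (A : E →ₗᵢ[ℝ] E) (b : E) (i : Fin n) :
    coordDeriv n (fun y => α • A (u y) + b) i z = α • A (coordDeriv n u i z) := by
  have h : HasFDerivAt (fun y => α • A (u y) + b) _ z :=
    ((A.toContinuousLinearMap.hasFDerivAt.comp z hu.hasFDerivAt).const_smul α).add_const b
  rw [coordDeriv, h.fderiv]
  rfl

lemma metricMatrix_similarity {u : EuclideanSpace ℝ (Fin n) → E} {z : EuclideanSpace ℝ (Fin n)}
    (hu : DifferentiableAt ℝ u z) (α : ℝ) (A : E →ₗᵢ[ℝ] E) (b : E) :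
    metricMatrix n (fun y => α • A (u y) + b) z = α ^ 2 • metricMatrix n u z := by
  ext i j
  simp only [metricMatrix, Matrix.gram_apply, Matrix.smul_apply, coordDeriv_similarity hu,
    inner_smul_left, inner_smul_right, conj_trivial, A.inner_map_map, smul_eq_mul]
  ring

lemma sqrt_det_metricMatrix_similarity {u : EuclideanSpace ℝ (Fin n) → E}
    {z : EuclideanSpace ℝ (Fin n)} (hu : DifferentiableAt ℝ u z) {α : ℝ} (hα : 0 ≤ α)
    (A : E →ₗᵢ[ℝ] E) (b : E) :
    √(metricMatrix n (fun y => α • A (u y) + b) z).det = α ^ n * √(metricMatrix n u z).det := by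
  rw [metricMatrix_similarity hu, Matrix.det_smul, Fintype.card_fin, ← pow_mul, mul_comm 2 n,
    pow_mul, Real.sqrt_mul (sq_nonneg _), Real.sqrt_sq (pow_nonneg hα n)]

variable [IsManifold (𝓡 n) ∞ M] {e e' : OpenPartialHomeomorph M (EuclideanSpace ℝ (Fin n))}
  {f : M → E} [MeasurableSpace M] [BorelSpace M]

lemma measurableEmbedding_symm (e : OpenPartialHomeomorph M (EuclideanSpace ℝ (Fin n))) :
    MeasurableEmbedding fun z : e.target => e.symm z := by
  have h := (MeasurableEmbedding.subtype_coe e.open_source.measurableSet).comp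
    e.toHomeomorphSourceTarget.symm.measurableEmbedding
  exact h

/-- The inverse chart is a measurable embedding only when restricted to the target. Passing to the
subtype gives change of variables for arbitrary integrands, with no measurability assumption. -/
lemma paramMeasure_eq_map_subtype :
    paramMeasure f e = Measure.map (fun z : e.target => e.symm z)
      (Measure.comap Subtype.val ((volume.restrict e.target).withDensity
        (fun z => ENNReal.ofReal (areaElement f e z)))) := by
  have hot := e.open_target.measurableSet
  have h1 : Measure.map Subtype.val (Measure.comap (Subtype.val : e.target → _)
      ((volume.restrict e.target).withDensity (fun z => ENNReal.ofReal (areaElement f e z)))) =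
      (volume.restrict e.target).withDensity (fun z => ENNReal.ofReal (areaElement f e z)) := by
    rw [map_comap_subtype_coe hot, restrict_withDensity hot, Measure.restrict_restrict hot,
      Set.inter_self]
  have h2 : AEMeasurable e.symm ((volume.restrict e.target).withDensity
      (fun z => ENNReal.ofReal (areaElement f e z))) :=
    aemeasurable_symm (withDensity_absolutelyContinuous _ _)
  rw [paramMeasure]
  conv_lhs => rw [← h1]
  rw [AEMeasurable.map_map_of_aemeasurable (by rwa [h1]) measurable_subtype_coe.aemeasurable]
  rfl

lemma aemeasurable_areaElement (hf : ContMDiff (𝓡 n) 𝓘(ℝ, E) ∞ f)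
    (he : e ∈ IsManifold.maximalAtlas (𝓡 n) ∞ M) :
    AEMeasurable (fun z => ENNReal.ofReal (areaElement f e z)) (volume.restrict e.target) :=
  ((continuousOn_areaElement hf he).aemeasurable e.open_target.measurableSet).ennreal_ofReal

lemma areaElement_nonneg (z : EuclideanSpace ℝ (Fin n)) : 0 ≤ areaElement f e z :=
  Real.sqrt_nonneg _

variable [SecondCountableTopology M]

/-- Integrals over the domain of a chart. -/
lemma setIntegral_source (hf : ContMDiff (𝓡 n) 𝓘(ℝ, E) ∞ f)
    (he : e ∈ IsManifold.maximalAtlas (𝓡 n) ∞ M) (w : M → ℝ) :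
    ∫ p in e.source, w p ∂(inducedMeasure n f) =
      ∫ z in e.target, areaElement f e z * w (e.symm z) := by
  have hot := e.open_target.measurableSet
  have hd := aemeasurable_areaElement hf he
  have h1 := integral_subtype_comap (μ := (volume.restrict e.target).withDensity
    (fun z => ENNReal.ofReal (areaElement f e z))) hot (fun z => w (e.symm z))
  rw [inducedMeasure_restrict_source hf he, paramMeasure_eq_map_subtype,
    (measurableEmbedding_symm e).integral_map, h1, restrict_withDensity hot,
    Measure.restrict_restrict hot, Set.inter_self,
    integral_withDensity_eq_integral_toReal_smul₀ hd (by simp)]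
  simp [ENNReal.toReal_ofReal (areaElement_nonneg _)]

lemma integrableOn_source_iff (hf : ContMDiff (𝓡 n) 𝓘(ℝ, E) ∞ f)
    (he : e ∈ IsManifold.maximalAtlas (𝓡 n) ∞ M) (w : M → ℝ) :
    IntegrableOn w e.source (inducedMeasure n f) ↔
      IntegrableOn (fun z => areaElement f e z * w (e.symm z)) e.target := by
  have hot := e.open_target.measurableSet
  have hd := aemeasurable_areaElement hf he
  have h1 : Integrable (fun z : e.target => w (e.symm z))
      (Measure.comap Subtype.val ((volume.restrict e.target).withDensity
        (fun z => ENNReal.ofReal (areaElement f e z)))) ↔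
      Integrable (fun z => w (e.symm z)) ((volume.restrict e.target).withDensity
        (fun z => ENNReal.ofReal (areaElement f e z))) := by
    have h2 := (MeasurableEmbedding.subtype_coe hot).integrable_map_iff
      (μ := Measure.comap Subtype.val ((volume.restrict e.target).withDensity
        (fun z => ENNReal.ofReal (areaElement f e z)))) (g := fun z => w (e.symm z))
    rw [map_comap_subtype_coe hot, restrict_withDensity hot, Measure.restrict_restrict hot,
      Set.inter_self] at h2
    exact h2.symm
  rw [IntegrableOn, inducedMeasure_restrict_source hf he, paramMeasure_eq_map_subtype,
    (measurableEmbedding_symm e).integrable_map_iff, IntegrableOn]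
  refine h1.trans ?_
  rw [integrable_withDensity_iff_integrable_smul₀' hd (by simp)]
  simp [ENNReal.toReal_ofReal (areaElement_nonneg _)]

/-- A property that holds almost everywhere in each chart holds almost everywhere. -/
lemma ae_inducedMeasure_of_charts (hf : ContMDiff (𝓡 n) 𝓘(ℝ, E) ∞ f) {P : M → Prop}
    (h : ∀ p : M, ∀ᵐ z ∂(volume.restrict (chartAt (EuclideanSpace ℝ (Fin n)) p).target),
      P ((chartAt (EuclideanSpace ℝ (Fin n)) p).symm z)) :
    ∀ᵐ p ∂(inducedMeasure n f), P p := by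
  obtain ⟨s, hs, hs'⟩ := exists_countable_charts n M
  have : Countable s := hs
  rw [← Measure.restrict_univ (μ := inducedMeasure n f), ← hs', ae_restrict_iUnion_iff]
  rintro ⟨p, -⟩
  rw [inducedMeasure_restrict_source hf (chartAt_mem p), paramMeasure_eq_map_subtype,
    (measurableEmbedding_symm _).ae_map_iff]
  have h1 := (withDensity_absolutelyContinuous _ (fun z => ENNReal.ofReal
    (areaElement f (chartAt (EuclideanSpace ℝ (Fin n)) p) z))).ae_le (h p)
  have hot := (chartAt (EuclideanSpace ℝ (Fin n)) p).open_target.measurableSet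
  have h2 := (MeasurableEmbedding.subtype_coe hot).ae_map_iff
    (μ := Measure.comap Subtype.val
      ((volume.restrict (chartAt (EuclideanSpace ℝ (Fin n)) p).target).withDensity
        (fun z => ENNReal.ofReal (areaElement f (chartAt (EuclideanSpace ℝ (Fin n)) p) z))))
    (p := fun z => P ((chartAt (EuclideanSpace ℝ (Fin n)) p).symm z))
  rw [map_comap_subtype_coe hot, restrict_withDensity hot, Measure.restrict_restrict hot,
    Set.inter_self] at h2
  exact h2.1 h1

/-- The induced measure of an immersion charges nonempty open sets. -/
lemma inducedMeasure_pos_of_isOpen (hf : IsImmersion n f) {s : Set M} (hs : IsOpen s)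
    (hne : s.Nonempty) : 0 < inducedMeasure n f s := by
  obtain ⟨p, hp⟩ := hne
  have he := chartAt_mem (n := n) p
  have hpe := mem_chart_source (EuclideanSpace ℝ (Fin n)) p
  generalize chartAt (EuclideanSpace ℝ (Fin n)) p = e at he hpe
  refine lt_of_lt_of_le ?_ (measure_mono (Set.inter_subset_left : s ∩ e.source ⊆ s))
  have hso : IsOpen (s ∩ e.source) := hs.inter e.open_source
  rw [inducedMeasure_apply_of_subset hf.smooth he hso.measurableSet Set.inter_subset_right,
    paramMeasure_apply hso.measurableSet]
  have hop : IsOpen (e.target ∩ e.symm ⁻¹' (s ∩ e.source)) :=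
    e.continuousOn_symm.isOpen_inter_preimage e.open_target hso
  have hnon : (e.target ∩ e.symm ⁻¹' (s ∩ e.source)).Nonempty :=
    ⟨e p, e.map_source hpe, by simp [e.left_inv hpe, hp, hpe]⟩
  have hm : AEMeasurable (fun z => ENNReal.ofReal (areaElement f e z))
      (volume.restrict (e.target ∩ e.symm ⁻¹' (s ∩ e.source))) :=
    (aemeasurable_areaElement hf.smooth he).mono_measure
      (Measure.restrict_mono_set _ Set.inter_subset_left)
  rw [pos_iff_ne_zero, Ne, lintegral_eq_zero_iff' hm]
  intro h0
  have h1 := (hop.measure_pos volume hnon).ne'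
  refine h1 ?_
  rw [← Measure.restrict_apply_self]
  have h2 : ∀ᵐ z ∂(volume.restrict (e.target ∩ e.symm ⁻¹' (s ∩ e.source))),
      z ∉ e.target ∩ e.symm ⁻¹' (s ∩ e.source) := by
    filter_upwards [h0] with z hz hzs
    have h3 := areaElement_pos hf he hzs.1
    simp only [Pi.zero_apply, ENNReal.ofReal_eq_zero] at hz
    exact absurd h3 (not_lt.2 hz)
  rw [ae_iff] at h2
  simpa only [not_not, Set.ofPred_mem_eq] using h2

/-- The behaviour of the induced measure under reparametrizations and similarities of the
ambient space. -/
lemma map_inducedMeasure_similarity (hf : ContMDiff (𝓡 n) 𝓘(ℝ, E) ∞ f) {f' : M → E}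
    (hf' : ContMDiff (𝓡 n) 𝓘(ℝ, E) ∞ f') (φ : M ≃ₘ^∞⟮𝓡 n, 𝓡 n⟯ M) {α : ℝ} (hα : 0 ≤ α)
    (A : E →ₗᵢ[ℝ] E) (b : E) (h : ∀ p, f' p = α • A (f (φ p)) + b) :
    (inducedMeasure n f').map φ = ENNReal.ofReal (α ^ n) • inducedMeasure n f := by
  have hφm : Measurable φ := φ.continuous.measurable
  refine measure_ext_of_charts n fun p => ?_
  have he := chartAt_mem (n := n) p
  generalize chartAt (EuclideanSpace ℝ (Fin n)) p = e at he
  refine Measure.ext fun s hs => ?_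
  have hse := hs.inter e.open_source.measurableSet
  rw [Measure.restrict_apply hs, Measure.restrict_apply hs, Measure.map_apply hφm hse,
    Measure.smul_apply, inducedMeasure_apply_of_subset hf he hse Set.inter_subset_right]
  -- Composing the chart with φ absorbs the reparametrization: in `e'` the map `f'` is exactly the
  -- similarity applied to `f` in `e`, over the same coordinate domain.
  set e' : OpenPartialHomeomorph M (EuclideanSpace ℝ (Fin n)) :=
    φ.toHomeomorph.toOpenPartialHomeomorph ≫ₕ e with he'_def
  have htgt : e'.target = e.target := by simp [he'_def]
  have hsymm : ∀ z, e'.symm z = φ.symm (e.symm z) := fun z => rfl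
  have hsrc : e'.source = φ ⁻¹' e.source := by simp [he'_def]
  have he' : e' ∈ IsManifold.maximalAtlas (𝓡 n) ∞ M := by
    rw [IsManifold.mem_maximalAtlas_iff_contMDiffOn]
    constructor
    · have := (contMDiffOn_of_mem_maximalAtlas he).comp
        (φ.contMDiff.contMDiffOn (s := φ ⁻¹' e.source)) subset_rfl
      rw [hsrc]
      exact this
    · have := φ.symm.contMDiff.contMDiffOn (s := Set.univ) |>.comp
        (contMDiffOn_symm_of_mem_maximalAtlas he) (Set.subset_univ _)
      rw [htgt]
      exact this
  rw [inducedMeasure_apply_of_subset hf' he' (hφm hse)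
      (by rw [hsrc]; exact Set.preimage_mono Set.inter_subset_right),
    paramMeasure_apply (hφm hse), paramMeasure_apply hse]
  have hset : e'.target ∩ e'.symm ⁻¹' (φ ⁻¹' (s ∩ e.source)) =
      e.target ∩ e.symm ⁻¹' (s ∩ e.source) := by
    ext z
    simp [htgt, hsymm]
  rw [hset, smul_eq_mul, ← lintegral_const_mul'' _ ((aemeasurable_areaElement hf he).mono_measure
      (Measure.restrict_mono_set _ Set.inter_subset_left))]
  refine setLIntegral_congr_fun (measurableSet_target_inter_preimage hse) fun z hz => ?_
  have hfe : f' ∘ e'.symm = fun z => α • A ((f ∘ e.symm) z) + b := by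
    ext z
    simp [h, hsymm]
  simp only [areaElement, hfe]
  rw [sqrt_det_metricMatrix_similarity ((contDiffAt_comp_symm he hf hz.1).differentiableAt
    (by simp)) hα, ENNReal.ofReal_mul (pow_nonneg hα n)]

end Integration

/-! ### The distance of the induced metric -/

section InducedDistance

set_option linter.unusedSectionVars false

open scoped InnerProductSpace ENNReal
open Set

variable {n : ℕ} {M : Type*} [TopologicalSpace M] [ChartedSpace (EuclideanSpace ℝ (Fin n)) M]
  {E : Type*} [NormedAddCommGroup E] [InnerProductSpace ℝ E]
  [IsManifold (𝓡 n) ∞ M] {f : M → E}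

lemma differential_mfderiv_path (hf : ContMDiff (𝓡 n) 𝓘(ℝ, E) ∞ f) {γ : ℝ → M} {t : ℝ}
    (hγ : MDifferentiableAt 𝓘(ℝ, ℝ) (𝓡 n) γ t) :
    differential n f (γ t) (mfderiv 𝓘(ℝ, ℝ) (𝓡 n) γ t (1 : ℝ)) = deriv (f ∘ γ) t := by
  have h := mfderiv_comp t (hf.mdifferentiable (by simp) (γ t)) hγ
  rw [mfderiv_eq_fderiv] at h
  rw [← fderiv_apply_one_eq_deriv, h]
  rfl

lemma lintegral_differential_path (hf : ContMDiff (𝓡 n) 𝓘(ℝ, E) ∞ f) {γ : ℝ → M} {a b : ℝ}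
    (hγ : ContMDiffOn 𝓘(ℝ, ℝ) (𝓡 n) 1 γ (Icc a b)) :
    ∫⁻ t in Icc a b, ‖differential n f (γ t) (mfderiv 𝓘(ℝ, ℝ) (𝓡 n) γ t (1 : ℝ))‖ₑ =
      ∫⁻ t in Icc a b, ‖deriv (f ∘ γ) t‖ₑ := by
  rw [← restrict_Ioo_eq_restrict_Icc]
  refine setLIntegral_congr_fun measurableSet_Ioo fun t ht => ?_
  rw [differential_mfderiv_path hf]
  exact ((hγ t (Ioo_subset_Icc_self ht)).contMDiffAt (Icc_mem_nhds ht.1 ht.2)).mdifferentiableAt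
    (by simp)

/-- Homogeneity of the length of tangent vectors, on which the pseudometric axioms for
`riemannianEDist` rest. -/
lemma enormSMulClass_differential (f : M → E) (a : M) :
    letI : ENorm (TangentSpace (𝓡 n) a) := ⟨fun v => ‖differential n f a v‖ₑ⟩
    ENormSMulClass ℝ (TangentSpace (𝓡 n) a) := by
  let _ : ENorm (TangentSpace (𝓡 n) a) := ⟨fun v => ‖differential n f a v‖ₑ⟩
  refine ⟨fun r v => ?_⟩
  change ‖differential n f a (r • v)‖ₑ = ‖r‖ₑ * ‖differential n f a v‖ₑ
  have h : differential n f a (r • v) = r • differential n f a v :=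
    (differential n f a).map_smul r v
  rw [h, enorm_smul]

lemma inducedEDist_self (f : M → E) (p : M) : inducedEDist n f p p = 0 := by
  let _ : ∀ a : M, ENorm (TangentSpace (𝓡 n) a) := fun a => ⟨fun v => ‖differential n f a v‖ₑ⟩
  have : ∀ a : M, ENormSMulClass ℝ (TangentSpace (𝓡 n) a) := enormSMulClass_differential f
  exact Manifold.riemannianEDist_self

lemma inducedEDist_comm (f : M → E) (p q : M) : inducedEDist n f p q = inducedEDist n f q p := by
  let _ : ∀ a : M, ENorm (TangentSpace (𝓡 n) a) := fun a => ⟨fun v => ‖differential n f a v‖ₑ⟩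
  have : ∀ a : M, ENormSMulClass ℝ (TangentSpace (𝓡 n) a) := enormSMulClass_differential f
  exact Manifold.riemannianEDist_comm

lemma inducedEDist_triangle (f : M → E) (p q r : M) :
    inducedEDist n f p r ≤ inducedEDist n f p q + inducedEDist n f q r := by
  let _ : ∀ a : M, ENorm (TangentSpace (𝓡 n) a) := fun a => ⟨fun v => ‖differential n f a v‖ₑ⟩
  have : ∀ a : M, ENormSMulClass ℝ (TangentSpace (𝓡 n) a) := enormSMulClass_differential f
  exact Manifold.riemannianEDist_triangle

lemma inducedEDist_le_lintegral (hf : ContMDiff (𝓡 n) 𝓘(ℝ, E) ∞ f) {γ : ℝ → M} {a b : ℝ}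
    (hγ : ContMDiffOn 𝓘(ℝ, ℝ) (𝓡 n) 1 γ (Icc a b)) (hab : a ≤ b) :
    inducedEDist n f (γ a) (γ b) ≤ ∫⁻ t in Icc a b, ‖deriv (f ∘ γ) t‖ₑ := by
  let _ : ∀ a : M, ENorm (TangentSpace (𝓡 n) a) := fun a => ⟨fun v => ‖differential n f a v‖ₑ⟩
  have : ∀ a : M, ENormSMulClass ℝ (TangentSpace (𝓡 n) a) := enormSMulClass_differential f
  rw [← lintegral_differential_path hf hγ]
  have h := Manifold.riemannianEDist_le_pathELength hγ rfl rfl hab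
  rw [Manifold.pathELength_eq_lintegral_mfderiv_Icc] at h
  exact h

lemma exists_path_of_inducedEDist_lt (hf : ContMDiff (𝓡 n) 𝓘(ℝ, E) ∞ f) {p q : M} {r : ℝ≥0∞}
    (h : inducedEDist n f p q < r) :
    ∃ γ : ℝ → M, γ 0 = p ∧ γ 1 = q ∧ ContMDiffOn 𝓘(ℝ, ℝ) (𝓡 n) 1 γ (Icc 0 1) ∧
      ∫⁻ t in Icc 0 1, ‖deriv (f ∘ γ) t‖ₑ < r := by
  let _ : ∀ a : M, ENorm (TangentSpace (𝓡 n) a) := fun a => ⟨fun v => ‖differential n f a v‖ₑ⟩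
  obtain ⟨γ, h0, h1, hγ, hl⟩ := Manifold.exists_lt_of_riemannianEDist_lt h
  refine ⟨γ, h0, h1, hγ, ?_⟩
  rw [← lintegral_differential_path hf hγ]
  rw [Manifold.pathELength_eq_lintegral_mfderiv_Icc] at hl
  exact hl

variable {e : OpenPartialHomeomorph M (EuclideanSpace ℝ (Fin n))}

/-- A bound for the distance along a coordinate segment. -/
lemma inducedEDist_segment_le (hf : ContMDiff (𝓡 n) 𝓘(ℝ, E) ∞ f)
    (he : e ∈ IsManifold.maximalAtlas (𝓡 n) ∞ M) {z v : EuclideanSpace ℝ (Fin n)} {K : ℝ}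
    (hz : ∀ s ∈ Icc (0 : ℝ) 1, z + s • v ∈ e.target)
    (hK : ∀ s ∈ Icc (0 : ℝ) 1, ‖fderiv ℝ (f ∘ e.symm) (z + s • v) v‖ ≤ K) :
    inducedEDist n f (e.symm z) (e.symm (z + v)) ≤ ENNReal.ofReal K := by
  set γ : ℝ → M := fun s => e.symm (z + s • v) with hγ_def
  have hline : ∀ s : ℝ, HasDerivAt (fun s : ℝ => z + s • v) v s := fun s => by
    simpa using ((hasDerivAt_id s).smul_const v).const_add z
  have hγ : ContMDiffOn 𝓘(ℝ, ℝ) (𝓡 n) 1 γ (Icc 0 1) := by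
    have h1 : ContMDiffOn 𝓘(ℝ, ℝ) 𝓘(ℝ, EuclideanSpace ℝ (Fin n)) 1 (fun s : ℝ => z + s • v)
        (Icc 0 1) := by
      rw [contMDiffOn_iff_contDiffOn]
      fun_prop
    exact ((contMDiffOn_symm_of_mem_maximalAtlas he).of_le (by norm_num)).comp h1 hz
  have h := inducedEDist_le_lintegral hf hγ zero_le_one
  simp only [hγ_def, zero_smul, add_zero, one_smul] at h
  refine h.trans ?_
  have hderiv : ∀ s ∈ Icc (0 : ℝ) 1, deriv (f ∘ γ) s = fderiv ℝ (f ∘ e.symm) (z + s • v) v := by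
    intro s hs
    have h2 := ((contDiffAt_comp_symm he hf (hz s hs)).differentiableAt (by simp)).hasFDerivAt
    exact (h2.comp_hasDerivAt s (hline s)).deriv
  calc ∫⁻ t in Icc 0 1, ‖deriv (f ∘ γ) t‖ₑ ≤ ∫⁻ _ in Icc (0 : ℝ) 1, ENNReal.ofReal K := by
        refine setLIntegral_mono' measurableSet_Icc fun s hs => ?_
        rw [hderiv s hs, ← ofReal_norm]
        exact ENNReal.ofReal_le_ofReal (hK s hs)
    _ = ENNReal.ofReal K := by simp

/-- In a chart, the distance is locally bounded by a multiple of the coordinate distance. -/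
lemma exists_inducedEDist_le_coord (hf : ContMDiff (𝓡 n) 𝓘(ℝ, E) ∞ f)
    (he : e ∈ IsManifold.maximalAtlas (𝓡 n) ∞ M) {z : EuclideanSpace ℝ (Fin n)}
    (hz : z ∈ e.target) :
    ∃ K : ℝ, 0 ≤ K ∧ ∃ r > 0, Metric.ball z r ⊆ e.target ∧ ∀ y ∈ Metric.ball z r,
      ∀ y' ∈ Metric.ball z r,
        inducedEDist n f (e.symm y) (e.symm y') ≤ ENNReal.ofReal (K * ‖y' - y‖) := by
  have hc : ContinuousAt (fderiv ℝ (f ∘ e.symm)) z :=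
    ((contDiffAt_comp_symm he hf hz).fderiv_right (m := 0) (by norm_num)).continuousAt
  have h1 : ∀ᶠ y in 𝓝 z, ‖fderiv ℝ (f ∘ e.symm) y‖ < ‖fderiv ℝ (f ∘ e.symm) z‖ + 1 :=
    hc.norm.eventually (gt_mem_nhds (lt_add_one _))
  obtain ⟨r, hr, hr'⟩ := Metric.eventually_nhds_iff_ball.1 (h1.and (e.open_target.mem_nhds hz))
  refine ⟨‖fderiv ℝ (f ∘ e.symm) z‖ + 1, by positivity, r, hr, fun y hy => (hr' y hy).2,
    fun y hy y' hy' => ?_⟩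
  have hseg : ∀ s ∈ Icc (0 : ℝ) 1, y + s • (y' - y) ∈ Metric.ball z r := fun s hs =>
    (convex_ball z r).add_smul_sub_mem hy hy' hs
  have h2 := inducedEDist_segment_le (K := (‖fderiv ℝ (f ∘ e.symm) z‖ + 1) * ‖y' - y‖) hf he
    (z := y) (v := y' - y) (fun s hs => (hr' _ (hseg s hs)).2) (fun s hs => by
      refine (ContinuousLinearMap.le_opNorm _ _).trans ?_
      have := (hr' _ (hseg s hs)).1.le
      gcongr)
  rwa [add_sub_cancel] at h2

/-- Coordinate segments are short, so metric balls are neighbourhoods. Together with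
`exists_inducedEDist_lt_subset` this identifies the metric topology with the given one. -/
lemma eventually_inducedEDist_lt (hf : ContMDiff (𝓡 n) 𝓘(ℝ, E) ∞ f) (p : M) {c : ℝ≥0∞}
    (hc : 0 < c) : ∀ᶠ q in 𝓝 p, inducedEDist n f p q < c := by
  have he := chartAt_mem (n := n) p
  have hpe := mem_chart_source (EuclideanSpace ℝ (Fin n)) p
  generalize chartAt (EuclideanSpace ℝ (Fin n)) p = e at he hpe
  obtain ⟨K, hK, r, hr, hrt, h⟩ := exists_inducedEDist_le_coord hf he (e.map_source hpe)
  have h1 : ContinuousAt (fun q => ENNReal.ofReal (K * ‖e q - e p‖)) p := by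
    have := e.continuousAt hpe
    exact (ENNReal.continuous_ofReal.continuousAt).comp
      (continuousAt_const.mul (this.sub continuousAt_const).norm)
  have h2 : ∀ᶠ q in 𝓝 p, ENNReal.ofReal (K * ‖e q - e p‖) < c :=
    h1.eventually (gt_mem_nhds (by simpa using hc))
  filter_upwards [h2, e.open_source.mem_nhds hpe,
    (e.continuousAt hpe).eventually (Metric.ball_mem_nhds _ hr)] with q hq hqe hqr
  have := h (e p) (Metric.mem_ball_self hr) (e q) hqr
  rw [e.left_inv hpe, e.left_inv hqe] at this
  exact this.trans_lt hq

/-- An immersion expands coordinate distances from the centre by at least a fixed factor near it. A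
path that leaves a small coordinate ball must therefore move a definite distance in the ambient
space, and its length is at least that distance. -/
lemma exists_inducedEDist_lt_subset [FiniteDimensional ℝ E] [T2Space M] (hf : IsImmersion n f)
    {p : M} {s : Set M} (hs : s ∈ 𝓝 p) :
    ∃ c > 0, {q | inducedEDist n f p q < c} ⊆ s := by
  have he := chartAt_mem (n := n) p
  have hpe := mem_chart_source (EuclideanSpace ℝ (Fin n)) p
  generalize chartAt (EuclideanSpace ℝ (Fin n)) p = e at he hpe
  have hz := e.map_source hpe
  set z := e p with hz_def
  have hp : e.symm z = p := e.left_inv hpe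
  -- the map `f` is injective near `p` with a linear lower bound
  have hL := ((contDiffAt_comp_symm he hf.smooth hz).differentiableAt (by simp)).hasFDerivAt
  obtain ⟨K, hK, hKL⟩ := (fderiv ℝ (f ∘ e.symm) z).exists_antilipschitzWith
    (LinearMap.ker_eq_bot.2 (hf.injective_fderiv he hz))
  have hlow : ∀ᶠ y in 𝓝 z, ‖y - z‖ ≤ 2 * K * ‖f (e.symm y) - f p‖ := by
    have hK' : (0 : ℝ) < K := hK
    have h1 := hL.isLittleO.def (c := (2 * (K : ℝ))⁻¹) (by positivity)
    filter_upwards [h1] with y hy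
    have h2 : ‖y - z‖ ≤ K * ‖fderiv ℝ (f ∘ e.symm) z (y - z)‖ := by
      have h3 := hKL.le_mul_dist y z
      rwa [dist_eq_norm, dist_eq_norm, ← map_sub] at h3
    have h3 : ‖fderiv ℝ (f ∘ e.symm) z (y - z)‖ ≤ ‖f (e.symm y) - f p‖ +
        (2 * (K : ℝ))⁻¹ * ‖y - z‖ := by
      have h4 : fderiv ℝ (f ∘ e.symm) z (y - z) = (f (e.symm y) - f p) -
          ((f ∘ e.symm) y - (f ∘ e.symm) z - fderiv ℝ (f ∘ e.symm) z (y - z)) := by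
        simp [hp]
      rw [h4]
      refine (norm_sub_le _ _).trans ?_
      gcongr
    have h5 : ‖y - z‖ ≤ K * (‖f (e.symm y) - f p‖ + (2 * (K : ℝ))⁻¹ * ‖y - z‖) :=
      h2.trans (by gcongr)
    have h6 : K * ((2 * (K : ℝ))⁻¹ * ‖y - z‖) = ‖y - z‖ / 2 := by field_simp
    rw [mul_add, h6] at h5
    linarith
  have hs' : ∀ᶠ y in 𝓝 z, e.symm y ∈ s :=
    (e.symm.continuousAt hz).eventually (by rw [hp]; exact hs)
  obtain ⟨r, hr, hr'⟩ := Metric.eventually_nhds_iff_ball.1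
    (hlow.and (hs'.and (e.open_target.mem_nhds hz)))
  have hr2 : 0 < r / 2 := by positivity
  have hsub : Metric.closedBall z (r / 2) ⊆ Metric.ball z r :=
    Metric.closedBall_subset_ball (by linarith)
  have hW : IsOpen (e.symm '' Metric.ball z (r / 2)) :=
    e.symm.isOpen_image_of_subset_source Metric.isOpen_ball
      (fun y hy => (hr' y (hsub (Metric.ball_subset_closedBall hy))).2.2)
  have hCl : IsClosed (e.symm '' Metric.closedBall z (r / 2)) :=
    ((isCompact_closedBall z (r / 2)).image_of_continuousOn (e.continuousOn_symm.mono
      fun y hy => (hr' y (hsub hy)).2.2)).isClosed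
  have hK' : (0 : ℝ) < K := hK
  -- By `hlow`, points of the closed ball of radius r / 2 at coordinate distance at least r / 2 from
  -- z have images at least this far from `f p`.
  refine ⟨ENNReal.ofReal (r / 2 / (2 * K)), by simp; positivity, fun q hq => ?_⟩
  obtain ⟨γ, h0, h1, hγ, hl⟩ := exists_path_of_inducedEDist_lt hf.smooth hq
  by_contra hqs
  have hqW : q ∉ e.symm '' Metric.ball z (r / 2) := by
    rintro ⟨y, hy, rfl⟩
    exact hqs (hr' y (hsub (Metric.ball_subset_closedBall hy))).2.1
  have hconn : IsPreconnected (γ '' Icc 0 1) := isPreconnected_Icc.image _ hγ.continuousOn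
  -- The path is connected and ends outside the coordinate ball, so it meets its frontier.
  have hcross : ∃ t ∈ Icc (0 : ℝ) 1, γ t ∈ closure (e.symm '' Metric.ball z (r / 2)) \
      e.symm '' Metric.ball z (r / 2) := by
    by_contra! hne
    have hcov : γ '' Icc 0 1 ⊆ e.symm '' Metric.ball z (r / 2) ∪
        (closure (e.symm '' Metric.ball z (r / 2)))ᶜ := by
      rintro _ ⟨t, ht, rfl⟩
      by_contra hnot
      rw [mem_union, not_or, notMem_compl_iff] at hnot
      exact hne t ht ⟨hnot.2, hnot.1⟩
    have hq' : q ∉ closure (e.symm '' Metric.ball z (r / 2)) := fun hcl =>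
      hne 1 (by simp) ⟨by rwa [h1], by rwa [h1]⟩
    obtain ⟨x, -, hx1, hx2⟩ := hconn _ _ hW isClosed_closure.isOpen_compl hcov
      ⟨p, ⟨0, by simp, h0⟩, ⟨z, Metric.mem_ball_self hr2, hp⟩⟩ ⟨q, ⟨1, by simp, h1⟩, hq'⟩
    exact hx2 (subset_closure hx1)
  obtain ⟨t, ht, hx⟩ := hcross
  have hxC : γ t ∈ e.symm '' Metric.closedBall z (r / 2) :=
    closure_minimal (image_mono Metric.ball_subset_closedBall) hCl hx.1
  obtain ⟨y, hy, hyx⟩ := hxC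
  have hy' : r / 2 ≤ ‖y - z‖ := by
    by_contra hlt
    exact hx.2 ⟨y, by simpa [dist_eq_norm] using hlt, hyx⟩
  have h2 := (hr' y (hsub hy)).1
  rw [hyx] at h2
  have h3 : edist (f p) (f (γ t)) < ENNReal.ofReal (r / 2 / (2 * K)) := by
    refine lt_of_le_of_lt ?_ hl
    have h4 : ContDiffOn ℝ 1 (f ∘ γ) (Icc 0 t) :=
      ((hf.smooth.of_le (by norm_num)).comp_contMDiffOn
        (hγ.mono (Icc_subset_Icc_right ht.2))).contDiffOn
    have h5 := enorm_sub_le_lintegral_deriv_of_contDiffOn_Icc h4 ht.1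
    rw [edist_comm, edist_eq_enorm_sub, ← h0]
    exact h5.trans (lintegral_mono_set (Icc_subset_Icc_right ht.2))
  rw [edist_comm, edist_dist, dist_eq_norm, ENNReal.ofReal_lt_ofReal_iff (by positivity),
    lt_div_iff₀ (by positivity)] at h3
  linarith

/-- The distance of the induced metric defines the topology of `M`. -/
@[reducible] def inducedPseudoEMetricSpace [FiniteDimensional ℝ E] [T2Space M]
    (hf : IsImmersion n f) : PseudoEMetricSpace M :=
  PseudoEMetricSpace.ofEDistOfTopology (inducedEDist n f) (inducedEDist_self f)
    (inducedEDist_comm f) (inducedEDist_triangle f)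
    (fun p => (Filter.basis_sets (𝓝 p)).to_hasBasis'
      (fun _ hs => exists_inducedEDist_lt_subset hf hs)
      (fun _ hc => eventually_inducedEDist_lt hf.smooth p hc))

end InducedDistance

/-! ### Hopf–Rinow and cutoff functions -/

section LengthSpace

open scoped ENNReal
open Set Metric

variable {X : Type*} [PseudoEMetricSpace X]

lemma isClosed_edist_le (p : X) (r : ℝ≥0∞) : IsClosed {q | edist p q ≤ r} :=
  isClosed_le (continuous_const.edist continuous_id) continuous_const

/-- The theorem of Hopf and Rinow: closed balls of a complete locally compact length space
are compact. -/
lemma isCompact_edist_le [LocallyCompactSpace X] [CompleteSpace X]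
    (hmid : ∀ (p q : X) (a b : ℝ≥0∞), a ≠ ⊤ → edist p q < a + b →
      ∃ m, edist p m ≤ a ∧ edist m q ≤ b) (p : X) (R : ℝ) :
    IsCompact {q | edist p q ≤ ENNReal.ofReal R} := by
  -- The set of radii with compact balls is shown to be closed and to extend to the right of each of
  -- its points in [0, R), hence to contain [0, R].
  set S : Set ℝ := {r | IsCompact {q | edist p q ≤ ENNReal.ofReal r}} with hS
  have hmono : ∀ r ∈ S, ∀ s ≤ r, s ∈ S := fun r hr s hs =>
    IsCompact.of_isClosed_subset hr (isClosed_edist_le p _) fun q hq =>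
      le_trans hq (ENNReal.ofReal_le_ofReal hs)
  -- A ball all of whose smaller concentric balls are compact is totally bounded: each of its points
  -- is within δ of the ball of radius r - δ/2, which has a finite net.
  have hlim : ∀ r : ℝ, 0 < r → (∀ s < r, s ∈ S) → r ∈ S := by
    intro r hr h
    refine TotallyBounded.isCompact_of_isClosed (EMetric.totallyBounded_iff.2 fun ε hε => ?_)
      (isClosed_edist_le p _)
    obtain ⟨δ, hδ, hδε⟩ : ∃ δ : ℝ, 0 < δ ∧ ENNReal.ofReal δ < ε / 2 := by
      obtain ⟨δ, hδ0, hδ⟩ := ENNReal.lt_iff_exists_real_btwn.1 (ENNReal.half_pos hε.ne')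
      exact ⟨δ, by simpa using hδ.1, hδ.2⟩
    obtain ⟨t, ht, hcov⟩ := EMetric.totallyBounded_iff.1
      (h (r - δ / 2) (by linarith) : IsCompact _).totallyBounded (ε / 2) (ENNReal.half_pos hε.ne')
    refine ⟨t, ht, fun q hq => ?_⟩
    have hlt : edist p q < ENNReal.ofReal (r - δ / 2) + ENNReal.ofReal δ := by
      refine lt_of_le_of_lt hq ?_
      rcases le_total 0 (r - δ / 2) with h0 | h0
      · rw [← ENNReal.ofReal_add h0 hδ.le]
        exact (ENNReal.ofReal_lt_ofReal_iff (by linarith)).2 (by linarith)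
      · rw [ENNReal.ofReal_of_nonpos h0, zero_add]
        exact (ENNReal.ofReal_lt_ofReal_iff hδ).2 (by linarith)
    obtain ⟨m, hm1, hm2⟩ := hmid p q _ _ ENNReal.ofReal_ne_top hlt
    obtain ⟨y, hy, hmy⟩ := mem_iUnion₂.1 (hcov hm1)
    refine mem_iUnion₂.2 ⟨y, hy, ?_⟩
    rw [mem_eball] at hmy ⊢
    calc edist q y ≤ edist q m + edist m y := edist_triangle _ _ _
      _ < ε / 2 + ε / 2 := by
        refine ENNReal.add_lt_add (lt_of_le_of_lt ?_ hδε) hmy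
        rwa [edist_comm]
      _ = ε := ENNReal.add_halves ε
  have hzero : (0 : ℝ) ∈ S := by
    refine TotallyBounded.isCompact_of_isClosed (EMetric.totallyBounded_iff.2 fun ε hε => ?_)
      (isClosed_edist_le p _)
    refine ⟨{p}, finite_singleton p, fun q hq => ?_⟩
    have hq0 : edist p q = 0 := by simpa using hq
    simpa [edist_comm q p, hq0] using hε
  rcases lt_or_ge R 0 with hR | hR
  · exact hmono 0 hzero R hR.le
  have hclosed : IsClosed (S ∩ Icc 0 R) := by
    have hScl : IsClosed S := by
      refine isClosed_of_closure_subset fun r hr => ?_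
      rcases le_or_gt r 0 with h0 | h0
      · exact hmono 0 hzero r h0
      refine hlim r h0 fun s hs => ?_
      obtain ⟨s', hs', hs''⟩ := mem_closure_iff.1 hr (Ioi s) isOpen_Ioi hs
      exact hmono s' hs'' s (le_of_lt hs')
    exact hScl.inter isClosed_Icc
  refine IsClosed.Icc_subset_of_forall_exists_gt hclosed hzero ?_ (right_mem_Icc.2 hR)
  rintro x ⟨hxS, hx0, -⟩ y hxy
  -- Local compactness surrounds the compact ball of radius x by a compact set containing its
  -- δ-thickening, and the length property puts the ball of radius x + δ/3 inside this thickening.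
  obtain ⟨N, hN, hxN⟩ := exists_compact_superset (hxS : IsCompact _)
  obtain ⟨δ, hδ, hthick⟩ := IsCompact.exists_thickening_subset_open hxS isOpen_interior hxN
  have hlt : x < min y (x + δ / 3) := lt_min hxy (by linarith)
  refine ⟨min y (x + δ / 3), ?_, hlt, min_le_left _ _⟩
  refine IsCompact.of_isClosed_subset hN (isClosed_edist_le p _) fun q hq =>
    interior_subset (hthick ?_)
  have hq' : edist p q < ENNReal.ofReal x + ENNReal.ofReal (δ / 2) := by
    refine lt_of_le_of_lt hq ?_
    rw [← ENNReal.ofReal_add hx0 (by linarith)]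
    refine (ENNReal.ofReal_lt_ofReal_iff (by linarith)).2 ?_
    exact lt_of_le_of_lt (min_le_right _ _) (by linarith)
  obtain ⟨m, hm1, hm2⟩ := hmid p q _ _ ENNReal.ofReal_ne_top hq'
  rw [mem_thickening_iff_exists_edist_lt]
  refine ⟨m, hm1, ?_⟩
  rw [edist_comm]
  exact lt_of_le_of_lt hm2 ((ENNReal.ofReal_lt_ofReal_iff hδ).2 (by linarith))

/-- A proper extended metric space has cutoff functions with small Lipschitz constants. -/
lemma exists_cutoff [TopologicalSpace.SeparableSpace X] [Nonempty X] [T2Space X]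
    (hc : ∀ (p : X) (R : ℝ), IsCompact {q | edist p q ≤ ENNReal.ofReal R}) :
    ∃ η : ℕ → X → ℝ, (∀ k p, 0 ≤ η k p ∧ η k p ≤ 1) ∧ (∀ k, HasCompactSupport (η k)) ∧
      (∀ k p q, edist (η k p) (η k q) ≤ ENNReal.ofReal (1 / ((k : ℝ) + 1)) * edist p q) ∧
      ∀ p, Filter.Tendsto (fun k => η k p) Filter.atTop (𝓝 1) := by
  -- Points in different components may be infinitely far apart, so one base point does not suffice.
  -- The distance to the first k + 1 terms of a dense sequence is used instead, truncated at k + 1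
  -- to make it finite.
  set x := TopologicalSpace.denseSeq X
  set F : ℕ → Set X := fun k => x '' Iic k with hF
  set h : ℕ → X → ℝ := fun k p => (min (infEDist p (F k)) (ENNReal.ofReal (k + 1))).toReal with hh
  have hh0 : ∀ k p, 0 ≤ h k p := fun k p => ENNReal.toReal_nonneg
  have hk0 : ∀ k : ℕ, (0 : ℝ) < k + 1 := fun k => by positivity
  have hh1 : ∀ k p, h k p ≤ k + 1 := fun k p =>
    ENNReal.toReal_le_of_le_ofReal (hk0 k).le (min_le_right _ _)
  have hlip : ∀ k p q, ENNReal.ofReal (h k p - h k q) ≤ edist p q := by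
    intro k p q
    have hfin : ∀ p, min (infEDist p (F k)) (ENNReal.ofReal (k + 1)) ≠ ⊤ := fun p =>
      (lt_of_le_of_lt (min_le_right _ _) ENNReal.ofReal_lt_top).ne
    rw [ENNReal.ofReal_sub _ (hh0 k q), hh]
    simp only
    rw [ENNReal.ofReal_toReal (hfin p), ENNReal.ofReal_toReal (hfin q), tsub_le_iff_left]
    rcases le_total (infEDist q (F k)) (ENNReal.ofReal (k + 1)) with h1 | h1
    · rw [min_eq_left h1]
      exact (min_le_left _ _).trans infEDist_le_infEDist_add_edist
    · rw [min_eq_right h1]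
      exact (min_le_right _ _).trans le_self_add
  refine ⟨fun k p => 1 - h k p / (k + 1), fun k p => ⟨?_, ?_⟩, fun k => ?_, fun k p q => ?_,
    fun p => ?_⟩
  · rw [sub_nonneg, div_le_one (hk0 k)]; exact hh1 k p
  · rw [sub_le_self_iff]; exact div_nonneg (hh0 k p) (hk0 k).le
  · refine HasCompactSupport.intro (K := ⋃ i ∈ Iic k, {q | edist (x i) q ≤ ENNReal.ofReal (k + 1)})
      ((finite_Iic k).isCompact_biUnion fun i _ => hc _ _) fun p hp => ?_
    have h1 : ENNReal.ofReal (k + 1) ≤ infEDist p (F k) := by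
      by_contra hlt
      obtain ⟨_, ⟨i, hi, rfl⟩, hy⟩ := infEDist_lt_iff.1 (not_le.1 hlt)
      refine hp (mem_iUnion₂.2 ⟨i, hi, ?_⟩)
      rw [mem_ofPred_eq, edist_comm]
      exact hy.le
    have h2 : h k p = k + 1 := by
      simp only [hh, min_eq_right h1]
      exact ENNReal.toReal_ofReal (hk0 k).le
    show 1 - h k p / ((k : ℝ) + 1) = 0
    rw [h2, div_self (hk0 k).ne', sub_self]
  · have hab : edist (1 - h k p / (k + 1)) (1 - h k q / (k + 1)) =
        ENNReal.ofReal (1 / ((k : ℝ) + 1)) * ENNReal.ofReal |h k p - h k q| := by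
      rw [edist_dist, Real.dist_eq, ← ENNReal.ofReal_mul (by positivity)]
      congr 1
      have : 1 - h k p / (k + 1) - (1 - h k q / (k + 1)) =
          -((1 / ((k : ℝ) + 1)) * (h k p - h k q)) := by ring
      rw [this, abs_neg, abs_mul, abs_of_pos (by positivity : 0 < 1 / ((k : ℝ) + 1))]
    rw [hab]
    gcongr
    rcases abs_choice (h k p - h k q) with h1 | h1
    · rw [h1]; exact hlip k p q
    · rw [h1, neg_sub, edist_comm]; exact hlip k q p
  -- Once k reaches an index i with the i-th term within distance 1 of p, the truncated distance at
  -- p is at most 1, and division by k + 1 sends it to zero.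
  · obtain ⟨i, hi⟩ := (TopologicalSpace.denseRange_denseSeq X).exists_mem_open
      (isOpen_eball : IsOpen (eball p 1)) ⟨p, mem_eball_self one_pos⟩
    have h1 : ∀ k ≥ i, h k p ≤ 1 := by
      intro k hk
      refine ENNReal.toReal_le_of_le_ofReal zero_le_one ((min_le_left _ _).trans ?_)
      rw [ENNReal.ofReal_one]
      refine (infEDist_le_edist_of_mem (mem_image_of_mem x (show i ∈ Iic k from hk))).trans ?_
      rw [edist_comm]
      exact (mem_eball.1 hi).le
    have h2 : Filter.Tendsto (fun k : ℕ => 1 - 1 / ((k : ℝ) + 1)) Filter.atTop (𝓝 (1 - 0)) :=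
      tendsto_one_div_add_atTop_nhds_zero_nat.const_sub 1
    rw [sub_zero] at h2
    refine tendsto_of_tendsto_of_tendsto_of_le_of_le' h2 tendsto_const_nhds ?_ ?_
    · filter_upwards [Filter.eventually_ge_atTop i] with k hk
      have := h1 k hk
      gcongr
    · filter_upwards with k
      rw [sub_le_self_iff]; exact div_nonneg (hh0 k p) (hk0 k).le

end LengthSpace

/-! ### Cutoff functions on a complete immersed submanifold -/

section Cutoff

set_option linter.unusedSectionVars false

open scoped ENNReal
open Set

variable {n : ℕ} {M : Type*} [TopologicalSpace M] [ChartedSpace (EuclideanSpace ℝ (Fin n)) M]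
  {E : Type*} [NormedAddCommGroup E] [InnerProductSpace ℝ E]
  [IsManifold (𝓡 n) ∞ M] {f : M → E}

/-- Cut a path of length below a + b at a point at distance exactly a from p, which exists by the
intermediate value theorem. The first piece has length at least a, so the second has length below b.
This is the length property used in `isCompact_edist_le`. -/
lemma exists_inducedEDist_between [FiniteDimensional ℝ E] [T2Space M] (hf : IsImmersion n f)
    (p q : M) (a b : ℝ≥0∞) (ha : a ≠ ⊤) (h : inducedEDist n f p q < a + b) :
    ∃ m, inducedEDist n f p m ≤ a ∧ inducedEDist n f m q ≤ b := by
  rcases le_or_gt (inducedEDist n f p q) a with hle | hlt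
  · exact ⟨q, hle, by simp [inducedEDist_self]⟩
  obtain ⟨γ, h0, h1, hγ, hl⟩ := exists_path_of_inducedEDist_lt hf.smooth h
  have hcont : Continuous fun m => inducedEDist n f p m := by
    let _ : PseudoEMetricSpace M := inducedPseudoEMetricSpace hf
    exact continuous_const.edist continuous_id
  obtain ⟨t, ht, hta⟩ : a ∈ (fun s => inducedEDist n f p (γ s)) '' Icc 0 1 :=
    intermediate_value_Icc (zero_le_one (α := ℝ)) (hcont.comp_continuousOn hγ.continuousOn)
      ⟨by simp [h0, inducedEDist_self], by simpa [h1] using hlt.le⟩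
  dsimp only at hta
  refine ⟨γ t, hta.le, ?_⟩
  have h2 := inducedEDist_le_lintegral hf.smooth (hγ.mono (Icc_subset_Icc_right ht.2)) ht.1
  have h3 := inducedEDist_le_lintegral hf.smooth (hγ.mono (Icc_subset_Icc_left ht.1)) ht.2
  rw [h0, hta] at h2
  rw [h1] at h3
  refine h3.trans ?_
  have h4 : (∫⁻ s in Icc 0 t, ‖deriv (f ∘ γ) s‖ₑ) + ∫⁻ s in Icc t 1, ‖deriv (f ∘ γ) s‖ₑ =
      ∫⁻ s in Icc 0 1, ‖deriv (f ∘ γ) s‖ₑ := by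
    rw [← Icc_union_Ioc_eq_Icc ht.1 ht.2, lintegral_union measurableSet_Ioc
      (disjoint_left.2 fun s hs hs' => not_lt.2 hs.2 hs'.1), restrict_Ioc_eq_restrict_Icc]
  have h5 : a + ∫⁻ s in Icc t 1, ‖deriv (f ∘ γ) s‖ₑ < a + b := by
    refine lt_of_le_of_lt ?_ hl
    rw [← h4]
    gcongr
  exact (ENNReal.add_lt_add_iff_left ha).1 h5 |>.le

/-- On a complete immersed submanifold there are compactly supported cutoff functions with
arbitrarily small Lipschitz constants. -/
lemma IsCompleteImmersion.exists_cutoff [FiniteDimensional ℝ E] [T2Space M]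
    [SecondCountableTopology M] [Nonempty M] (hc : IsCompleteImmersion n f)
    (hf : IsImmersion n f) :
    ∃ η : ℕ → M → ℝ, (∀ k p, 0 ≤ η k p ∧ η k p ≤ 1) ∧ (∀ k, HasCompactSupport (η k)) ∧
      (∀ k p q, edist (η k p) (η k q) ≤
        ENNReal.ofReal (1 / ((k : ℝ) + 1)) * inducedEDist n f p q) ∧
      ∀ p, Filter.Tendsto (fun k => η k p) Filter.atTop (𝓝 1) := by
  have hlc : LocallyCompactSpace M :=
    ChartedSpace.locallyCompactSpace (EuclideanSpace ℝ (Fin n)) M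
  have hsep : TopologicalSpace.SeparableSpace M := inferInstance
  let _ : PseudoEMetricSpace M := inducedPseudoEMetricSpace hf
  have hcomp : CompleteSpace M := by
    refine EMetric.complete_of_cauchySeq_tendsto fun u hu => hc u fun ε hε => ?_
    exact EMetric.cauchySeq_iff.1 hu ε hε
  exact MCF.exists_cutoff fun p R => isCompact_edist_le
    (fun p q a b ha h => exists_inducedEDist_between hf p q a b ha h) p R

variable {e : OpenPartialHomeomorph M (EuclideanSpace ℝ (Fin n))} {η : M → ℝ} {L : ℝ}

/-- A function which is Lipschitz for the induced distance is locally Lipschitz in charts. -/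
lemma exists_lipschitz_coord (hf : ContMDiff (𝓡 n) 𝓘(ℝ, E) ∞ f)
    (he : e ∈ IsManifold.maximalAtlas (𝓡 n) ∞ M) (hL : 0 ≤ L)
    (hη : ∀ p q, edist (η p) (η q) ≤ ENNReal.ofReal L * inducedEDist n f p q)
    {z : EuclideanSpace ℝ (Fin n)} (hz : z ∈ e.target) :
    ∃ K : NNReal, ∃ t ∈ 𝓝 z, LipschitzOnWith K (η ∘ e.symm) t := by
  obtain ⟨K, hK, r, hr, -, h⟩ := exists_inducedEDist_le_coord hf he hz
  refine ⟨⟨L * K, by positivity⟩, Metric.ball z r, Metric.ball_mem_nhds z hr, fun y hy y' hy' => ?_⟩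
  refine (hη _ _).trans ?_
  refine (mul_le_mul_right (h y hy y' hy') _).trans ?_
  rw [← ENNReal.ofReal_mul hL, ← mul_assoc, edist_comm, edist_dist, dist_eq_norm,
    ENNReal.ofReal_mul (by positivity)]
  gcongr
  exact (ENNReal.ofReal_eq_coe_nnreal _).le

/-- The derivative of a function which is Lipschitz for the induced distance. -/
lemma abs_fderiv_coord_le (hf : ContMDiff (𝓡 n) 𝓘(ℝ, E) ∞ f)
    (he : e ∈ IsManifold.maximalAtlas (𝓡 n) ∞ M) (hL : 0 ≤ L)
    (hη : ∀ p q, edist (η p) (η q) ≤ ENNReal.ofReal L * inducedEDist n f p q)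
    {z : EuclideanSpace ℝ (Fin n)} (hz : z ∈ e.target)
    (hd : DifferentiableAt ℝ (η ∘ e.symm) z) (v : EuclideanSpace ℝ (Fin n)) :
    |fderiv ℝ (η ∘ e.symm) z v| ≤ L * ‖fderiv ℝ (f ∘ e.symm) z v‖ := by
  have hline : HasDerivAt (fun s : ℝ => z + s • v) v 0 := by
    simpa using ((hasDerivAt_id (0 : ℝ)).smul_const v).const_add z
  have hg : HasDerivAt (fun s : ℝ => (η ∘ e.symm) (z + s • v)) (fderiv ℝ (η ∘ e.symm) z v) 0 := by
    have hd' : HasFDerivAt (η ∘ e.symm) (fderiv ℝ (η ∘ e.symm) z) (z + (0 : ℝ) • v) := by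
      simpa using hd.hasFDerivAt
    exact hd'.comp_hasDerivAt 0 hline
  have hcont : ContinuousAt (fun s : ℝ => ‖fderiv ℝ (f ∘ e.symm) (z + s • v) v‖) 0 := by
    have h1 : ContinuousAt (fderiv ℝ (f ∘ e.symm)) (z + (0 : ℝ) • v) := by
      rw [zero_smul, add_zero]
      exact ((contDiffAt_comp_symm he hf hz).fderiv_right (m := 0) (by norm_num)).continuousAt
    have h2 : ContinuousAt (fun s : ℝ => fderiv ℝ (f ∘ e.symm) (z + s • v)) 0 :=
      ContinuousAt.comp (f := fun s : ℝ => z + s • v) h1 hline.continuousAt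
    exact (h2.clm_apply continuousAt_const).norm
  refine le_of_forall_pos_le_add fun ε hε => ?_
  obtain ⟨δ, hδ, hδL⟩ : ∃ δ > 0, L * δ ≤ ε := by
    refine ⟨ε / (L + 1), by positivity, ?_⟩
    rw [← mul_div_assoc, div_le_iff₀ (by positivity)]
    nlinarith
  have h1 : ∀ᶠ s in 𝓝 (0 : ℝ), ‖fderiv ℝ (f ∘ e.symm) (z + s • v) v‖ <
      ‖fderiv ℝ (f ∘ e.symm) z v‖ + δ := by
    refine hcont.eventually (gt_mem_nhds ?_)
    simpa using hδ
  have h2 : ∀ᶠ s in 𝓝 (0 : ℝ), z + s • v ∈ e.target :=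
    hline.continuousAt.eventually (by simpa using e.open_target.mem_nhds hz)
  obtain ⟨r, hr, hr'⟩ := Metric.eventually_nhds_iff_ball.1 (h1.and h2)
  -- Along the short segment from z in direction v, the induced length is at most |s| times a speed
  -- within δ of the speed at z. The Lipschitz bound for η on such segments bounds its derivative.
  have h3 : ‖ContinuousLinearMap.toSpanSingleton ℝ (fderiv ℝ (η ∘ e.symm) z v)‖ ≤
      L * (‖fderiv ℝ (f ∘ e.symm) z v‖ + δ) := by
    refine hg.hasFDerivAt.le_of_lip' (by positivity) ?_
    filter_upwards [Metric.ball_mem_nhds (0 : ℝ) hr] with s hs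
    have hss : ∀ a ∈ Icc (0 : ℝ) 1, a * s ∈ Metric.ball (0 : ℝ) r := by
      intro a ha
      rw [mem_ball_zero_iff] at hs ⊢
      rw [norm_mul, Real.norm_of_nonneg ha.1]
      exact lt_of_le_of_lt (mul_le_of_le_one_left (norm_nonneg _) ha.2) hs
    have h4 := inducedEDist_segment_le (z := z) (v := s • v)
      (K := |s| * (‖fderiv ℝ (f ∘ e.symm) z v‖ + δ)) hf he
      (fun a ha => by rw [smul_smul]; exact (hr' _ (hss a ha)).2)
      (fun a ha => by
        rw [smul_smul, map_smul, norm_smul, Real.norm_eq_abs]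
        have := (hr' _ (hss a ha)).1.le
        gcongr)
    have h5 := (hη (e.symm z) (e.symm (z + s • v))).trans (mul_le_mul_right h4 _)
    rw [← ENNReal.ofReal_mul hL, edist_dist, ENNReal.ofReal_le_ofReal_iff (by positivity)] at h5
    rw [dist_comm, dist_eq_norm] at h5
    simp only [zero_smul, add_zero, sub_zero, Function.comp_apply]
    refine h5.trans (le_of_eq ?_)
    rw [Real.norm_eq_abs]
    ring
  rw [ContinuousLinearMap.norm_toSpanSingleton, Real.norm_eq_abs] at h3
  linarith

end Cutoff

/-! ### Integration by parts against Lipschitz functions -/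

section IntegrationByParts

open Set

variable {V : Type*} [NormedAddCommGroup V] [InnerProductSpace ℝ V] [FiniteDimensional ℝ V]
  [MeasurableSpace V] [BorelSpace V] {Ω K : Set V} {W X : V → ℝ}

/-- Integration by parts in an open set against a compactly supported Lipschitz function. -/
lemma integral_fderiv_mul_eq_neg (hΩ : IsOpen Ω) (hK : IsCompact K) (hKΩ : K ⊆ Ω)
    (hX : ContDiffOn ℝ 1 X Ω) (hW : LocallyLipschitzOn Ω W) (hW0 : ∀ z ∈ Ω \ K, W z = 0) (v : V) :
    IntegrableOn (fun z => X z * fderiv ℝ W z v) Ω ∧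
      IntegrableOn (fun z => fderiv ℝ X z v * W z) Ω ∧
      ∫ z in Ω, fderiv ℝ X z v * W z = -∫ z in Ω, X z * fderiv ℝ W z v := by
  -- Both factors are made global. A cutoff χ, equal to 1 near K and 0 off L, turns X into a
  -- compactly supported C¹ function, and W is extended from L' to a Lipschitz function g. The
  -- products do not change on Ω, because W vanishes off K.
  obtain ⟨L, hL, hKL, hLΩ⟩ := exists_compact_between hK hΩ hKΩ
  obtain ⟨L', hL', hLL', hLΩ'⟩ := exists_compact_between hL hΩ hLΩ
  obtain ⟨χ, hχ1, hχ0, -⟩ := exists_contMDiffMap_one_nhds_of_subset_interior (n := 1) 𝓘(ℝ, V)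
    hK.isClosed hKL
  have hχ : ContDiff ℝ 1 χ := χ.contMDiff.contDiff
  have hχ1' : ∀ z ∈ K, ∀ᶠ y in 𝓝 z, χ y = 1 := fun z hz =>
    hχ1.filter_mono (nhds_le_nhdsSet hz)
  obtain ⟨C, hC⟩ := LocallyLipschitzOn.exists_lipschitzOnWith_of_compact hL' (hW.mono hLΩ')
  obtain ⟨g, hg, hWg⟩ := hC.extend_real
  have hWg' : ∀ z ∈ L, W =ᶠ[𝓝 z] g := fun z hz =>
    Filter.mem_of_superset (mem_interior_iff_mem_nhds.1 (hLL' hz)) hWg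
  have hW0' : ∀ z ∈ Ω \ K, W =ᶠ[𝓝 z] fun _ => 0 := fun z hz =>
    Filter.mem_of_superset ((hΩ.sdiff hK.isClosed).mem_nhds hz) hW0
  set Y : V → ℝ := fun z => χ z * X z with hY
  have hY0 : ∀ z ∉ L, Y =ᶠ[𝓝 z] fun _ => 0 := fun z hz => by
    filter_upwards [hL.isClosed.isOpen_compl.mem_nhds hz] with y hy
    simp [hY, hχ0 y hy]
  have hYC : ContDiff ℝ 1 Y := by
    refine contDiff_iff_contDiffAt.2 fun z => ?_
    by_cases hz : z ∈ L
    · exact hχ.contDiffAt.mul (hX.contDiffAt (hΩ.mem_nhds (hLΩ hz)))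
    · exact contDiffAt_const.congr_of_eventuallyEq (hY0 z hz)
  have hYc : HasCompactSupport Y := HasCompactSupport.intro hL fun z hz => (hY0 z hz).self_of_nhds
  obtain ⟨D, hD⟩ := hYC.lipschitzWith_of_hasCompactSupport hYc (by simp)
  have hYd : ∀ z w, lineDeriv ℝ Y z w = fderiv ℝ Y z w := fun z w =>
    ((hYC.differentiable (by simp)) z).lineDeriv_eq_fderiv
  have h1 : ∀ z ∈ Ω, fderiv ℝ X z v * W z = fderiv ℝ Y z v * g z := by
    intro z hz
    by_cases hzK : z ∈ K
    · have : Y =ᶠ[𝓝 z] X := by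
        filter_upwards [hχ1' z hzK] with y hy
        simp [hY, hy]
      rw [this.fderiv_eq, (hWg' z (interior_subset (hKL hzK))).self_of_nhds]
    · rw [hW0 z ⟨hz, hzK⟩, mul_zero]
      by_cases hzL : z ∈ L
      · rw [← (hWg' z hzL).self_of_nhds, hW0 z ⟨hz, hzK⟩, mul_zero]
      · rw [(hY0 z hzL).fderiv_eq]
        simp
  have h1' : ∀ z ∉ Ω, fderiv ℝ Y z v * g z = 0 := fun z hz => by
    rw [(hY0 z fun h => hz (hLΩ h)).fderiv_eq]
    simp
  have h2 : ∀ᵐ z, z ∈ Ω → X z * fderiv ℝ W z v = Y z * lineDeriv ℝ g z v := by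
    filter_upwards [hg.ae_differentiableAt] with z hgz hz
    by_cases hzK : z ∈ K
    · rw [hgz.lineDeriv_eq_fderiv, (hWg' z (interior_subset (hKL hzK))).fderiv_eq, hY]
      simp [(hχ1' z hzK).self_of_nhds]
    · rw [(hW0' z ⟨hz, hzK⟩).fderiv_eq]
      by_cases hzL : z ∈ L
      · rw [hgz.lineDeriv_eq_fderiv,
          ((hWg' z hzL).symm.trans (hW0' z ⟨hz, hzK⟩)).fderiv_eq]
        simp
      · rw [(hY0 z hzL).self_of_nhds]
        simp
  have h2' : ∀ z ∉ Ω, Y z * lineDeriv ℝ g z v = 0 := fun z hz => by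
    rw [(hY0 z fun h => hz (hLΩ h)).self_of_nhds, zero_mul]
  have hi1 : Integrable fun z => fderiv ℝ Y z v * g z :=
    (((hYC.continuous_fderiv (by simp)).clm_apply continuous_const).mul
      hg.continuous).integrable_of_hasCompactSupport
      (((hYc.fderiv ℝ).comp_left (g := fun A : V →L[ℝ] ℝ => A v) (by simp)).mul_right)
  have hi2 : Integrable fun z => Y z * lineDeriv ℝ g z v := by
    refine (hYC.continuous.integrable_of_hasCompactSupport hYc).mul_bdd (c := C * ‖v‖)
      (measurable_lineDeriv hg.continuous).aestronglyMeasurable ?_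
    filter_upwards with z using norm_lineDeriv_le_of_lipschitz ℝ hg
  have h2r : (fun z => X z * fderiv ℝ W z v) =ᵐ[volume.restrict Ω]
      fun z => Y z * lineDeriv ℝ g z v := (ae_restrict_iff' hΩ.measurableSet).2 h2
  refine ⟨hi2.integrableOn.congr h2r.symm,
    (integrableOn_congr_fun h1 hΩ.measurableSet).2 hi1.integrableOn, ?_⟩
  rw [setIntegral_congr_fun hΩ.measurableSet h1, integral_congr_ae h2r,
    setIntegral_eq_integral_of_forall_compl_eq_zero h1',
    setIntegral_eq_integral_of_forall_compl_eq_zero h2']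
  have h3 := LipschitzWith.integral_lineDeriv_mul_eq (μ := volume) hg hD hYc v
  simp only [hYd, map_neg, neg_mul] at h3
  rw [integral_neg] at h3
  simp_rw [mul_comm (Y _)]
  rw [h3, neg_neg]

/-- Rademacher's theorem on small neighbourhoods, combined with the fact that a locally null set is
null. -/
lemma ae_differentiableAt_of_locallyLipschitzOn (hW : LocallyLipschitzOn Ω W) (hΩ : IsOpen Ω) :
    ∀ᵐ z ∂(volume.restrict Ω), DifferentiableAt ℝ W z := by
  rw [ae_restrict_iff' hΩ.measurableSet, ae_iff]
  refine measure_null_of_locally_null _ fun z hz => ?_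
  simp only [mem_ofPred_eq, Classical.not_imp] at hz
  obtain ⟨C, t, ht, htC⟩ := hW hz.1
  rw [hΩ.nhdsWithin_eq hz.1] at ht
  refine ⟨_, Filter.inter_mem self_mem_nhdsWithin
    (mem_nhdsWithin_of_mem_nhds (interior_mem_nhds.2 ht)), ?_⟩
  refine measure_mono_null ?_ (ae_iff.1 (htC.ae_differentiableWithinAt_of_mem (μ := volume)))
  rintro y ⟨hy, hyt⟩ h
  refine hy (fun _ => (h (interior_subset hyt)).differentiableAt (mem_interior_iff_mem_nhds.1 hyt))

end IntegrationByParts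

/-! ### The radial derivative and Green's formula in a chart -/

section RadialDerivative

set_option linter.unusedSectionVars false

open Set
open scoped InnerProductSpace

variable {n : ℕ} {M : Type*} [TopologicalSpace M] [ChartedSpace (EuclideanSpace ℝ (Fin n)) M]
  {E : Type*} [NormedAddCommGroup E] [InnerProductSpace ℝ E] [FiniteDimensional ℝ E]

lemma exists_differential_eq_sub_normalPart (f : M → E) (p : M) :
    ∃ v, differential n f p v = f p - normalPart n f p (f p) := by
  have h := Submodule.sub_starProjection_mem_orthogonal
    (K := ((differential n f p : EuclideanSpace ℝ (Fin n) →ₗ[ℝ] E).range)ᗮ) (f p)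
  rw [Submodule.orthogonal_orthogonal] at h
  exact h

variable (n) in
/-- The tangent vector at `p` which represents the tangential part of the position vector `f p`. -/
def tangentialPosition (f : M → E) (p : M) : EuclideanSpace ℝ (Fin n) :=
  Classical.choose (exists_differential_eq_sub_normalPart (n := n) f p)

lemma differential_tangentialPosition (f : M → E) (p : M) :
    differential n f p (tangentialPosition n f p) = f p - normalPart n f p (f p) :=
  Classical.choose_spec (exists_differential_eq_sub_normalPart (n := n) f p)

variable (n) in
/-- The derivative of `w` in the direction of the tangential part of the position vector. -/
def radialDeriv (f : M → E) (w : M → ℝ) (p : M) : ℝ :=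
  fderiv ℝ (w ∘ (chartAt (EuclideanSpace ℝ (Fin n)) p).symm)
    (chartAt (EuclideanSpace ℝ (Fin n)) p p) (tangentialPosition n f p)

variable [IsManifold (𝓡 n) ∞ M] {e : OpenPartialHomeomorph M (EuclideanSpace ℝ (Fin n))}
  {f : M → E} {w : M → ℝ} {K : Set M}

lemma radialDeriv_eq_zero {p : M} (h : w =ᶠ[𝓝 p] fun _ => 0) :
    radialDeriv n f w p = 0 := by
  have h1 : w ∘ (chartAt (EuclideanSpace ℝ (Fin n)) p).symm
      =ᶠ[𝓝 (chartAt (EuclideanSpace ℝ (Fin n)) p p)] fun _ => 0 := by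
    have := (chartAt (EuclideanSpace ℝ (Fin n)) p).symm.continuousAt
      (mem_chart_target (EuclideanSpace ℝ (Fin n)) p)
    rw [ContinuousAt, OpenPartialHomeomorph.left_inv _ (mem_chart_source _ p)] at this
    exact this.eventually h
  rw [radialDeriv, h1.fderiv_eq]
  simp

/-- `radialDeriv` is computed at each point in the preferred chart of that point. Here it is
identified with the flux term that integration by parts produces in one fixed chart, so that the
boundary terms of different charts can be added. -/
lemma areaElement_mul_radialDeriv (hf : IsImmersion n f)
    (he : e ∈ IsManifold.maximalAtlas (𝓡 n) ∞ M) {z : EuclideanSpace ℝ (Fin n)}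
    (hz : z ∈ e.target) (hd : DifferentiableAt ℝ (w ∘ e.symm) z) :
    areaElement f e z * radialDeriv n f w (e.symm z) =
      ∑ i, ⟪(f ∘ e.symm) z, conormal (f ∘ e.symm) i z⟫_ℝ * coordDeriv n (w ∘ e.symm) i z := by
  set p := e.symm z with hp
  have hps : p ∈ e.source := e.map_target hz
  have hep : e p = z := e.right_inv hz
  set c := chartAt (EuclideanSpace ℝ (Fin n)) p with hc
  have hcs : p ∈ c.source := mem_chart_source _ p
  have hct : c p ∈ c.target := mem_chart_target _ p
  have hcp : c.symm (c p) = p := c.left_inv hcs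
  have hps' : c.symm (c p) ∈ e.source := by rwa [hcp]
  set T := fderiv ℝ (e ∘ c.symm) (c p) with hT
  have hTz : (e ∘ c.symm) (c p) = z := by rw [Function.comp_apply, hcp, hep]
  have hw : radialDeriv n f w p = fderiv ℝ (w ∘ e.symm) z (T (tangentialPosition n f p)) := by
    have h1 : HasFDerivAt (w ∘ e.symm) (fderiv ℝ (w ∘ e.symm) z) ((e ∘ c.symm) (c p)) := by
      rw [hTz]; exact hd.hasFDerivAt
    have h2 := h1.comp (c p)
      ((contDiffAt_transition (chartAt_mem p) he hct hps').differentiableAt (by simp)).hasFDerivAt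
    rw [radialDeriv, (comp_symm_eventuallyEq w hct hps').fderiv_eq, h2.fderiv]
    rfl
  set u := f ∘ e.symm with hu
  have huz : u z = f p := rfl
  have hinj := hf.injective_fderiv he hz
  have hV : T (tangentialPosition n f p) =
      ∑ i, (∑ j, (metricMatrix n u z)⁻¹ i j * ⟪coordDeriv n u j z, u z⟫_ℝ) •
        EuclideanSpace.single i (1 : ℝ) := by
    -- Both sides have the same image under the injective differential: the tangential part of the
    -- position vector, given by the Gram matrix formula.
    refine hinj ?_
    have h1 := differential_tangentialPosition (n := n) f p
    rw [exists_differential_eq hf.smooth he hps, hep,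
      normalPart_eq_paramNormal hf.smooth he hps, hep, ← huz, paramNormal_eq_sub hinj,
      sub_sub_cancel] at h1
    simp only [ContinuousLinearMap.comp_apply] at h1
    rw [h1, map_sum]
    refine Finset.sum_congr rfl fun i _ => ?_
    rw [map_smul, Finset.sum_smul]
    rfl
  rw [hw, hV, map_sum, Finset.mul_sum]
  refine Finset.sum_congr rfl fun i _ => ?_
  rw [map_smul, smul_eq_mul, ← mul_assoc, conormal, inner_sum]
  congr 1
  rw [Finset.mul_sum]
  refine Finset.sum_congr rfl fun j _ => ?_
  rw [inner_smul_right, real_inner_comm, areaElement]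
  ring

/-- The Laplacian of the Gaussian weight `exp (-a |f|²)` of an immersion `f`. -/
def gaussianLaplacian (n : ℕ) {M : Type*} [TopologicalSpace M]
    [ChartedSpace (EuclideanSpace ℝ (Fin n)) M] {E : Type*} [NormedAddCommGroup E]
    [InnerProductSpace ℝ E] [FiniteDimensional ℝ E] (a : ℝ) (f : M → E) (p : M) : ℝ :=
  Real.exp (-a * ‖f p‖ ^ 2) * (-2 * a * n - 2 * a * ⟪f p, meanCurvature n f p⟫_ℝ +
    4 * a ^ 2 * (‖f p‖ ^ 2 - ‖normalPart n f p (f p)‖ ^ 2))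

variable [MeasurableSpace M] [BorelSpace M] [SecondCountableTopology M] [T2Space M]

/-- Green's formula in a chart. -/
lemma integral_gaussianLaplacian_mul (a : ℝ) (hf : IsImmersion n f)
    (he : e ∈ IsManifold.maximalAtlas (𝓡 n) ∞ M) (hK : IsCompact K) (hKe : K ⊆ e.source)
    (hw0 : ∀ p ∉ K, w p = 0) (hw : LocallyLipschitzOn e.target (w ∘ e.symm)) :
    Integrable (fun p => -2 * a * Real.exp (-a * ‖f p‖ ^ 2) * radialDeriv n f w p)
        (inducedMeasure n f) ∧
      Integrable (fun p => gaussianLaplacian n a f p * w p) (inducedMeasure n f) ∧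
      ∫ p, gaussianLaplacian n a f p * w p ∂(inducedMeasure n f) =
        -∫ p, -2 * a * Real.exp (-a * ‖f p‖ ^ 2) * radialDeriv n f w p ∂(inducedMeasure n f) := by
  set u := f ∘ e.symm with hu
  -- The density-weighted gradient of the Gaussian, √g gⁱʲ ∂ⱼ exp(-a|u|²), whose coordinate
  -- divergence is √g times the Laplacian.
  set X : Fin n → EuclideanSpace ℝ (Fin n) → ℝ := fun i y =>
    -2 * a * Real.exp (-a * ‖u y‖ ^ 2) * ⟪u y, conormal u i y⟫_ℝ with hX
  have hKt : IsCompact (e '' K) := hK.image_of_continuousOn (e.continuousOn.mono hKe)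
  have hKs : e '' K ⊆ e.target := by
    rintro _ ⟨p, hp, rfl⟩; exact e.map_source (hKe hp)
  have hXC : ∀ i, ContDiffOn ℝ 1 (X i) e.target := fun i z hz => by
    have h1 : ContDiffAt ℝ 2 u z := (contDiffAt_comp_symm he hf.smooth hz).of_le (WithTop.coe_le_coe.2 le_top)
    have h2 : ContDiffAt ℝ 1 u z := h1.of_le (by norm_num)
    have h3 := contDiffAt_conormal (k := 1) h1 (hf.injective_fderiv he hz) i
    exact ((contDiffAt_const.mul (contDiffAt_const.mul (h2.norm_sq ℝ)).exp).mul
      (h2.inner ℝ h3)).contDiffWithinAt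
  have hW0 : ∀ z ∈ e.target \ e '' K, (w ∘ e.symm) z = 0 := fun z hz =>
    hw0 _ fun h => hz.2 ⟨_, h, e.right_inv hz.1⟩
  have hI := fun i => integral_fderiv_mul_eq_neg e.open_target hKt hKs (hXC i) hw hW0
    (EuclideanSpace.single i 1)
  have h1 : (fun z => areaElement f e z *
      (-2 * a * Real.exp (-a * ‖f (e.symm z)‖ ^ 2) * radialDeriv n f w (e.symm z)))
      =ᵐ[volume.restrict e.target] fun z => ∑ i, X i z *
        fderiv ℝ (w ∘ e.symm) z (EuclideanSpace.single i 1) := by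
    filter_upwards [ae_differentiableAt_of_locallyLipschitzOn hw e.open_target,
      ae_restrict_mem e.open_target.measurableSet] with z hz hzt
    rw [mul_left_comm, areaElement_mul_radialDeriv hf he hzt hz, Finset.mul_sum]
    refine Finset.sum_congr rfl fun i _ => ?_
    simp only [hX, coordDeriv, hu, Function.comp_apply]
    ring
  have h2 : (fun z => areaElement f e z * (gaussianLaplacian n a f (e.symm z) * w (e.symm z)))
      =ᵐ[volume.restrict e.target] fun z => ∑ i,
        fderiv ℝ (X i) z (EuclideanSpace.single i 1) * (w ∘ e.symm) z := by
    filter_upwards [ae_restrict_mem e.open_target.measurableSet] with z hzt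
    have h3 := sum_coordDeriv_gaussian_conormal (u := u) (z := z) a
      ((contDiffAt_comp_symm he hf.smooth hzt).of_le (WithTop.coe_le_coe.2 le_top))
      (by filter_upwards [e.open_target.mem_nhds hzt] with y hy using hf.injective_fderiv he hy)
    rw [← Finset.sum_mul]
    simp only [coordDeriv] at h3
    rw [h3, gaussianLaplacian, meanCurvature_eq_paramMeanCurvature hf.smooth he (e.map_target hzt),
      normalPart_eq_paramNormal hf.smooth he (e.map_target hzt), e.right_inv hzt, ← mul_assoc]
    rfl
  have hc1 : ∀ p ∉ e.source,
      -2 * a * Real.exp (-a * ‖f p‖ ^ 2) * radialDeriv n f w p = 0 := fun p hp => by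
    rw [radialDeriv_eq_zero, mul_zero]
    filter_upwards [hK.isClosed.isOpen_compl.mem_nhds fun h => hp (hKe h)] with y hy using hw0 y hy
  have hc2 : ∀ p ∉ e.source, gaussianLaplacian n a f p * w p = 0 := fun p hp => by
    rw [hw0 p fun h => hp (hKe h), mul_zero]
  refine ⟨?_, ?_, ?_⟩
  · rw [← integrableOn_iff_integrable_of_support_subset
      (Function.support_subset_iff'.2 hc1), integrableOn_source_iff hf.smooth he]
    exact (integrable_finsetSum _ fun i _ => (hI i).1).congr h1.symm
  · rw [← integrableOn_iff_integrable_of_support_subset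
      (Function.support_subset_iff'.2 hc2), integrableOn_source_iff hf.smooth he]
    exact (integrable_finsetSum _ fun i _ => (hI i).2.1).congr h2.symm
  · rw [← setIntegral_eq_integral_of_forall_compl_eq_zero hc1,
      ← setIntegral_eq_integral_of_forall_compl_eq_zero hc2, setIntegral_source hf.smooth he,
      setIntegral_source hf.smooth he, integral_congr_ae h1, integral_congr_ae h2,
      integral_finsetSum _ fun i _ => (hI i).1, integral_finsetSum _ fun i _ => (hI i).2.1,
      ← Finset.sum_neg_distrib]
    exact Finset.sum_congr rfl fun i _ => (hI i).2.2

end RadialDerivative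

/-! ### The Laplacian of a Gaussian integrates to zero -/

section Gaffney

open Set

set_option linter.unusedSectionVars false

lemma locallyLipschitzOn_mul_of_mem_Icc {X : Type*} [PseudoEMetricSpace X] {s : Set X}
    {g h : X → ℝ} (hg : LocallyLipschitzOn s g) (hh : LocallyLipschitzOn s h)
    (hg1 : ∀ x, |g x| ≤ 1) (hh1 : ∀ x, |h x| ≤ 1) :
    LocallyLipschitzOn s fun x => g x * h x := by
  intro x hx
  obtain ⟨C, t, ht, hC⟩ := hg hx
  obtain ⟨D, t', ht', hD⟩ := hh hx
  refine ⟨D + C, t ∩ t', Filter.inter_mem ht ht', fun y hy y' hy' => ?_⟩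
  have h1 := hC hy.1 hy'.1
  have h2 := hD hy.2 hy'.2
  rw [edist_dist, Real.dist_eq] at h1 h2 ⊢
  have h3 : |g y * h y - g y' * h y'| ≤ |h y - h y'| + |g y - g y'| := by
    have : g y * h y - g y' * h y' = g y * (h y - h y') + (g y - g y') * h y' := by ring
    rw [this]
    refine (abs_add_le _ _).trans ?_
    rw [abs_mul, abs_mul]
    gcongr
    · exact mul_le_of_le_one_left (abs_nonneg _) (hg1 y)
    · exact mul_le_of_le_one_right (abs_nonneg _) (hh1 y')
  refine (ENNReal.ofReal_le_ofReal h3).trans ?_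
  rw [ENNReal.ofReal_add (abs_nonneg _) (abs_nonneg _), ENNReal.coe_add, add_mul]
  exact add_le_add h2 h1

variable {n : ℕ} {M : Type*} [TopologicalSpace M] [ChartedSpace (EuclideanSpace ℝ (Fin n)) M]
  {E : Type*} [NormedAddCommGroup E] [InnerProductSpace ℝ E] [FiniteDimensional ℝ E]
  [IsManifold (𝓡 n) ∞ M] {f : M → E} {η : M → ℝ}
  [MeasurableSpace M] [BorelSpace M] [SecondCountableTopology M] [T2Space M]

/-- Green's formula for compactly supported, locally Lipschitz functions. -/
lemma integral_gaussianLaplacian_mul_of_hasCompactSupport (a : ℝ) (hf : IsImmersion n f)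
    (hc : HasCompactSupport η) (hη1 : ∀ p, 0 ≤ η p ∧ η p ≤ 1)
    (hη : ∀ p : M, LocallyLipschitzOn (chartAt (EuclideanSpace ℝ (Fin n)) p).target
      (η ∘ (chartAt (EuclideanSpace ℝ (Fin n)) p).symm)) :
    Integrable (fun p => gaussianLaplacian n a f p * η p) (inducedMeasure n f) ∧
      ∫ p, gaussianLaplacian n a f p * η p ∂(inducedMeasure n f) =
        -∫ p, -2 * a * Real.exp (-a * ‖f p‖ ^ 2) * radialDeriv n f η p ∂(inducedMeasure n f) := by
  have hlc : LocallyCompactSpace M :=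
    ChartedSpace.locallyCompactSpace (EuclideanSpace ℝ (Fin n)) M
  -- A partition of unity reduces the claim to single charts. By compactness only finitely many of
  -- its members meet the support of η.
  obtain ⟨ζ, hζ⟩ := SmoothPartitionOfUnity.exists_isSubordinate_chartAt_source (𝓡 n) M
  have hfin : {j | (Function.support (ζ j) ∩ tsupport η).Nonempty}.Finite :=
    ζ.locallyFinite.finite_nonempty_inter_compact hc
  set J := hfin.toFinset with hJ
  have hζ01 : ∀ j p, |ζ j p| ≤ 1 := fun j p => by
    rw [abs_of_nonneg (ζ.nonneg j p)]; exact ζ.le_one j p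
  have hη01 : ∀ p, |η p| ≤ 1 := fun p => by
    rw [abs_of_nonneg (hη1 p).1]; exact (hη1 p).2
  have hsum : ∀ p, ∑ j ∈ J, ζ j p * η p = η p := by
    intro p
    by_cases hp : η p = 0
    · simp [hp]
    · rw [← Finset.sum_mul]
      have h1 := ζ.sum_eq_one (mem_univ p)
      rw [finsum_eq_sum_of_support_subset (s := J)] at h1
      · rw [h1, one_mul]
      · intro j hj
        simp only [hJ, Finite.coe_toFinset]
        exact ⟨p, hj, subset_tsupport _ hp⟩
  have hG := fun j => integral_gaussianLaplacian_mul (w := fun p => ζ j p * η p)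
    (K := tsupport (ζ j) ∩ tsupport η) a hf (chartAt_mem j)
    (hc.inter_left (isClosed_tsupport _)) (inter_subset_left.trans (hζ j))
    (fun p hp => by
      by_contra h
      exact hp ⟨subset_tsupport _ (left_ne_zero_of_mul h), subset_tsupport _ (right_ne_zero_of_mul h)⟩)
    (locallyLipschitzOn_mul_of_mem_Icc
      (g := ζ j ∘ (chartAt (EuclideanSpace ℝ (Fin n)) j).symm)
      (h := η ∘ (chartAt (EuclideanSpace ℝ (Fin n)) j).symm)
      (fun z hz => by
        obtain ⟨C, t, ht, h⟩ := ((contDiffAt_comp_symm (chartAt_mem j) (ζ j).contMDiff hz).of_le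
          (m := 1) (WithTop.coe_le_coe.2 le_top)).exists_lipschitzOnWith
        exact ⟨C, t, mem_nhdsWithin_of_mem_nhds ht, h⟩) (hη j)
      (fun z => hζ01 _ _) (fun z => hη01 _))
  have hL : (fun p => gaussianLaplacian n a f p * η p) =
      fun p => ∑ j ∈ J, gaussianLaplacian n a f p * (ζ j p * η p) := by
    funext p
    rw [← Finset.mul_sum, hsum]
  -- The radial derivative is additive only where η is differentiable, which by Rademacher's theorem
  -- is almost everywhere. The comparison is made after multiplication by the positive area element.
  have hR : (fun p => -2 * a * Real.exp (-a * ‖f p‖ ^ 2) * radialDeriv n f η p)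
      =ᵐ[inducedMeasure n f] fun p => ∑ j ∈ J, -2 * a * Real.exp (-a * ‖f p‖ ^ 2) *
        radialDeriv n f (fun p => ζ j p * η p) p := by
    refine ae_inducedMeasure_of_charts hf.smooth fun q => ?_
    filter_upwards [ae_differentiableAt_of_locallyLipschitzOn (hη q)
      (chartAt (EuclideanSpace ℝ (Fin n)) q).open_target,
      ae_restrict_mem (chartAt (EuclideanSpace ℝ (Fin n)) q).open_target.measurableSet] with z hd hz
    set e := chartAt (EuclideanSpace ℝ (Fin n)) q with he
    have hem := chartAt_mem (n := n) q
    have hζd : ∀ j, DifferentiableAt ℝ ((fun p => ζ j p * η p) ∘ e.symm) z := fun j =>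
      DifferentiableAt.mul
        ((contDiffAt_comp_symm hem (ζ j).contMDiff hz).differentiableAt (by simp)) hd
    have hA := (areaElement_pos hf hem hz).ne'
    refine mul_left_cancel₀ hA ?_
    have hR : areaElement f e z * ∑ j ∈ J, -2 * a * Real.exp (-a * ‖f (e.symm z)‖ ^ 2) *
        radialDeriv n f (fun p => ζ j p * η p) (e.symm z) = -2 * a *
        Real.exp (-a * ‖f (e.symm z)‖ ^ 2) * ∑ j ∈ J, areaElement f e z *
          radialDeriv n f (fun p => ζ j p * η p) (e.symm z) := by
      rw [← Finset.mul_sum, ← Finset.mul_sum, mul_left_comm]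
    rw [hR, Finset.sum_congr rfl fun j _ => areaElement_mul_radialDeriv hf hem hz (hζd j),
      mul_left_comm, areaElement_mul_radialDeriv hf hem hz hd, Finset.sum_comm]
    congr 1
    refine Finset.sum_congr rfl fun i _ => ?_
    rw [← Finset.mul_sum]
    congr 1
    have h2 : η ∘ e.symm = fun y => ∑ j ∈ J, ((fun p => ζ j p * η p) ∘ e.symm) y := by
      funext y
      exact (hsum _).symm
    simp only [coordDeriv]
    rw [h2, fderiv_fun_sum fun j _ => hζd j, sum_apply]
  refine ⟨?_, ?_⟩
  · rw [hL]
    exact integrable_finsetSum _ fun j _ => (hG j).2.1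
  · rw [hL, integral_congr_ae hR, integral_finsetSum _ fun j _ => (hG j).2.1,
      integral_finsetSum _ fun j _ => (hG j).1, ← Finset.sum_neg_distrib]
    exact Finset.sum_congr rfl fun j _ => (hG j).2.2

lemma norm_sub_normalPart_le (f : M → E) (p : M) (v : E) : ‖v - normalPart n f p v‖ ≤ ‖v‖ := by
  have h1 : v - normalPart n f p v = ((differential n f p :
      EuclideanSpace ℝ (Fin n) →ₗ[ℝ] E).range).starProjection v := by
    rw [normalPart, Submodule.starProjection_orthogonal']
    simp
  rw [h1]
  exact Submodule.norm_starProjection_apply_le _ _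

/-- The Lipschitz bound is applied to the tangential part of the position vector, an orthogonal
projection of f p. -/
lemma abs_radialDeriv_le {e : OpenPartialHomeomorph M (EuclideanSpace ℝ (Fin n))} {L : ℝ}
    (hf : ContMDiff (𝓡 n) 𝓘(ℝ, E) ∞ f) (he : e ∈ IsManifold.maximalAtlas (𝓡 n) ∞ M) (hL : 0 ≤ L)
    (hη : ∀ p q, edist (η p) (η q) ≤ ENNReal.ofReal L * inducedEDist n f p q) {p : M}
    (hp : p ∈ e.source) (hd : DifferentiableAt ℝ (η ∘ e.symm) (e p)) :
    |radialDeriv n f η p| ≤ L * ‖f p‖ := by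
  set c := chartAt (EuclideanSpace ℝ (Fin n)) p with hc
  have hct : c p ∈ c.target := mem_chart_target _ p
  have hcp : c.symm (c p) = p := c.left_inv (mem_chart_source _ p)
  have hps : c.symm (c p) ∈ e.source := by rwa [hcp]
  have hd' : DifferentiableAt ℝ (η ∘ c.symm) (c p) := by
    refine DifferentiableAt.congr_of_eventuallyEq ?_ (comp_symm_eventuallyEq η hct hps)
    refine DifferentiableAt.comp _ ?_
      ((contDiffAt_transition (chartAt_mem p) he hct hps).differentiableAt (by simp))
    rwa [Function.comp_apply, hcp]
  refine (abs_fderiv_coord_le hf (chartAt_mem p) hL hη hct hd' _).trans ?_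
  have h1 := differential_tangentialPosition (n := n) f p
  rw [differential_eq_fderiv_localRep (hf.mdifferentiableAt (by simp)), localRep_eq,
    extChartAt_coe_eq] at h1
  rw [h1]
  gcongr
  exact norm_sub_normalPart_le f p (f p)

/-- The integral over a complete immersed submanifold of the Laplacian of a Gaussian weight
vanishes. -/
theorem integral_gaussianLaplacian_eq_zero (a : ℝ) (hf : IsImmersion n f)
    (hc : IsCompleteImmersion n f)
    (h1 : Integrable (fun p => Real.exp (-a * ‖f p‖ ^ 2) * ‖f p‖) (inducedMeasure n f))
    (h2 : Integrable (gaussianLaplacian n a f) (inducedMeasure n f)) :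
    ∫ p, gaussianLaplacian n a f p ∂(inducedMeasure n f) = 0 := by
  rcases isEmpty_or_nonempty M with hM | hM
  · rw [Measure.eq_zero_of_isEmpty (inducedMeasure n f), integral_zero_measure]
  obtain ⟨η, hη1, hηc, hηL, hηt⟩ := hc.exists_cutoff hf
  have hk0 : ∀ k : ℕ, (0 : ℝ) ≤ 1 / ((k : ℝ) + 1) := fun k => by positivity
  have hlip : ∀ k (q : M), LocallyLipschitzOn (chartAt (EuclideanSpace ℝ (Fin n)) q).target
      (η k ∘ (chartAt (EuclideanSpace ℝ (Fin n)) q).symm) := fun k q z hz => by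
    obtain ⟨C, t, ht, h⟩ := exists_lipschitz_coord hf.smooth (chartAt_mem q) (hk0 k) (hηL k) hz
    exact ⟨C, t, mem_nhdsWithin_of_mem_nhds ht, h⟩
  have hG := fun k => integral_gaussianLaplacian_mul_of_hasCompactSupport a hf (hηc k) (hη1 k)
    (hlip k)
  have hlim1 : Filter.Tendsto
      (fun k => ∫ p, gaussianLaplacian n a f p * η k p ∂(inducedMeasure n f)) Filter.atTop
      (𝓝 (∫ p, gaussianLaplacian n a f p ∂(inducedMeasure n f))) := by
    refine tendsto_integral_of_dominated_convergence (fun p => ‖gaussianLaplacian n a f p‖)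
      (fun k => (hG k).1.aestronglyMeasurable) h2.norm (fun k => ?_) ?_
    · filter_upwards with p
      rw [norm_mul, Real.norm_of_nonneg (hη1 k p).1]
      exact mul_le_of_le_one_right (norm_nonneg _) (hη1 k p).2
    · filter_upwards with p
      simpa using (hηt p).const_mul (gaussianLaplacian n a f p)
  set I := ∫ p, Real.exp (-a * ‖f p‖ ^ 2) * ‖f p‖ ∂(inducedMeasure n f)
  -- The cutoff has Lipschitz constant 1/(k + 1), so its radial derivative is at most |f|/(k + 1).
  -- Green's formula and the integrability of |f| against the Gaussian then give decay in k.
  have hbound : ∀ k, ‖∫ p, gaussianLaplacian n a f p * η k p ∂(inducedMeasure n f)‖ ≤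
      1 / ((k : ℝ) + 1) * (2 * |a| * I) := by
    intro k
    rw [(hG k).2, norm_neg, ← integral_const_mul, ← integral_const_mul]
    refine norm_integral_le_of_norm_le ((h1.const_mul _).const_mul _) ?_
    refine ae_inducedMeasure_of_charts hf.smooth fun q => ?_
    filter_upwards [ae_differentiableAt_of_locallyLipschitzOn (hlip k q)
      (chartAt (EuclideanSpace ℝ (Fin n)) q).open_target,
      ae_restrict_mem (chartAt (EuclideanSpace ℝ (Fin n)) q).open_target.measurableSet] with z hd hz
    have hem := chartAt_mem (n := n) q
    set e := chartAt (EuclideanSpace ℝ (Fin n)) q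
    have h3 := abs_radialDeriv_le hf.smooth hem (hk0 k) (hηL k) (e.map_target hz)
      (by rwa [e.right_inv hz])
    rw [Real.norm_eq_abs, abs_mul, abs_mul, abs_mul, abs_neg, abs_two, Real.abs_exp]
    calc 2 * |a| * Real.exp (-a * ‖f (e.symm z)‖ ^ 2) * |radialDeriv n f (η k) (e.symm z)|
        ≤ 2 * |a| * Real.exp (-a * ‖f (e.symm z)‖ ^ 2) * (1 / ((k : ℝ) + 1) * ‖f (e.symm z)‖) := by
          gcongr
      _ = _ := by ring
  refine tendsto_nhds_unique hlim1 (squeeze_zero_norm hbound ?_)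
  simpa using tendsto_one_div_add_atTop_nhds_zero_nat.mul_const (2 * |a| * I)

end Gaffney

/-! ### Joint continuity in space and time -/

section Flow

open Set
open scoped InnerProductSpace

set_option linter.unusedSectionVars false

variable {n : ℕ} {M : Type*} [TopologicalSpace M] [ChartedSpace (EuclideanSpace ℝ (Fin n)) M]
  {E : Type*} [NormedAddCommGroup E] [InnerProductSpace ℝ E] [FiniteDimensional ℝ E]
  [IsManifold (𝓡 n) ∞ M] {e : OpenPartialHomeomorph M (EuclideanSpace ℝ (Fin n))}
  {x : ℝ → M → E} {t₁ t₂ t : ℝ} {z : EuclideanSpace ℝ (Fin n)}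

/-- The expression of a time-dependent map in a chart. -/
def flowRep (x : ℝ → M → E) (e : OpenPartialHomeomorph M (EuclideanSpace ℝ (Fin n)))
    (q : EuclideanSpace ℝ (Fin n) × ℝ) : E := x q.2 (e.symm q.1)

lemma IsMeanCurvatureFlow.contDiffOn_flowRep (hx : IsMeanCurvatureFlow n x t₁ t₂)
    (he : e ∈ IsManifold.maximalAtlas (𝓡 n) ∞ M) :
    ContDiffOn ℝ ∞ (flowRep x e) (e.target ×ˢ Icc t₁ t₂) := by
  rw [← contMDiffOn_iff_contDiffOn]
  have h1 : ContMDiffOn 𝓘(ℝ, EuclideanSpace ℝ (Fin n) × ℝ) (𝓡 n) ∞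
      (fun q : EuclideanSpace ℝ (Fin n) × ℝ => e.symm q.1) (e.target ×ˢ Icc t₁ t₂) :=
    (contMDiffOn_symm_of_mem_maximalAtlas he).comp contDiff_fst.contMDiff.contMDiffOn
      fun _ hq => hq.1
  have h2 : ContMDiffOn 𝓘(ℝ, EuclideanSpace ℝ (Fin n) × ℝ) 𝓘(ℝ, ℝ) ∞
      (fun q : EuclideanSpace ℝ (Fin n) × ℝ => q.2) (e.target ×ˢ Icc t₁ t₂) :=
    contDiff_snd.contMDiff.contMDiffOn
  exact hx.smooth.comp (h1.prodMk h2) fun q hq => ⟨mem_univ _, hq.2⟩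

lemma IsMeanCurvatureFlow.hasFDerivWithinAt_flowRep (hx : IsMeanCurvatureFlow n x t₁ t₂)
    (he : e ∈ IsManifold.maximalAtlas (𝓡 n) ∞ M) (hz : z ∈ e.target) (ht : t ∈ Icc t₁ t₂) :
    HasFDerivWithinAt (flowRep x e)
      (fderivWithin ℝ (flowRep x e) (e.target ×ˢ Icc t₁ t₂) (z, t))
      (e.target ×ˢ Icc t₁ t₂) (z, t) :=
  ((hx.contDiffOn_flowRep he).differentiableOn (by simp) (z, t) ⟨hz, ht⟩).hasFDerivWithinAt

lemma IsMeanCurvatureFlow.fderiv_slice (hx : IsMeanCurvatureFlow n x t₁ t₂)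
    (he : e ∈ IsManifold.maximalAtlas (𝓡 n) ∞ M) (hz : z ∈ e.target) (ht : t ∈ Icc t₁ t₂)
    (v : EuclideanSpace ℝ (Fin n)) :
    fderiv ℝ (x t ∘ e.symm) z v =
      fderivWithin ℝ (flowRep x e) (e.target ×ˢ Icc t₁ t₂) (z, t) (v, 0) := by
  have h1 : HasFDerivAt (fun y : EuclideanSpace ℝ (Fin n) => (y, t))
      ((ContinuousLinearMap.id ℝ _).prod 0) z := (hasFDerivAt_id z).prodMk (hasFDerivAt_const t z)
  have hm : MapsTo (fun y : EuclideanSpace ℝ (Fin n) => (y, t)) e.target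
      (e.target ×ˢ Icc t₁ t₂) := fun y hy => ⟨hy, ht⟩
  have h2 := HasFDerivWithinAt.comp z (hx.hasFDerivWithinAt_flowRep he hz ht)
    h1.hasFDerivWithinAt hm
  have h3 : HasFDerivAt (x t ∘ e.symm) _ z := h2.hasFDerivAt (e.open_target.mem_nhds hz)
  rw [h3.fderiv]
  rfl

/-- The flow equation replaces the second-order expression H by a first-order time derivative of a
smooth map. Joint continuity of H, up to the end times, follows at once. -/
lemma IsMeanCurvatureFlow.meanCurvature_eq_fderivWithin (hx : IsMeanCurvatureFlow n x t₁ t₂)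
    (h12 : t₁ < t₂) (he : e ∈ IsManifold.maximalAtlas (𝓡 n) ∞ M) (hz : z ∈ e.target)
    (ht : t ∈ Icc t₁ t₂) :
    meanCurvature n (x t) (e.symm z) =
      fderivWithin ℝ (flowRep x e) (e.target ×ˢ Icc t₁ t₂) (z, t) (0, 1) := by
  have h1 : HasDerivWithinAt (fun s : ℝ => (z, s)) (0, 1) (Icc t₁ t₂) t :=
    ((hasDerivAt_const t z).prodMk (hasDerivAt_id t)).hasDerivWithinAt
  have h2 := (hx.hasFDerivWithinAt_flowRep he hz ht).comp_hasDerivWithinAt t h1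
    fun s hs => ⟨hz, hs⟩
  exact (uniqueDiffOn_Icc h12 t ht).eq_deriv _ (hx.evolution t ht (e.symm z)) h2

lemma inner_meanCurvature_fderiv {f : M → E} (hf : ContMDiff (𝓡 n) 𝓘(ℝ, E) ∞ f)
    (he : e ∈ IsManifold.maximalAtlas (𝓡 n) ∞ M) (hz : z ∈ e.target)
    (v : EuclideanSpace ℝ (Fin n)) :
    ⟪meanCurvature n f (e.symm z), fderiv ℝ (f ∘ e.symm) z v⟫_ℝ = 0 := by
  rw [meanCurvature_eq_paramMeanCurvature hf he (e.map_target hz), e.right_inv hz,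
    paramMeanCurvature, sum_inner]
  refine Finset.sum_eq_zero fun i _ => ?_
  rw [sum_inner]
  refine Finset.sum_eq_zero fun j _ => ?_
  rw [inner_smul_left, inner_paramNormal_tangent, mul_zero]

lemma IsMeanCurvatureFlow.continuousOn_fderivWithin (hx : IsMeanCurvatureFlow n x t₁ t₂)
    (h12 : t₁ < t₂) (he : e ∈ IsManifold.maximalAtlas (𝓡 n) ∞ M)
    (v : EuclideanSpace ℝ (Fin n) × ℝ) :
    ContinuousOn (fun q => fderivWithin ℝ (flowRep x e) (e.target ×ˢ Icc t₁ t₂) q v)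
      (e.target ×ˢ Icc t₁ t₂) :=
  ((hx.contDiffOn_flowRep he).continuousOn_fderivWithin
    (e.open_target.uniqueDiffOn.prod (uniqueDiffOn_Icc h12)) (by simp)).clm_apply
      continuousOn_const

lemma IsMeanCurvatureFlow.continuousOn_coordDeriv (hx : IsMeanCurvatureFlow n x t₁ t₂)
    (h12 : t₁ < t₂) (he : e ∈ IsManifold.maximalAtlas (𝓡 n) ∞ M) (i : Fin n) :
    ContinuousOn (fun q : EuclideanSpace ℝ (Fin n) × ℝ => coordDeriv n (x q.2 ∘ e.symm) i q.1)
      (e.target ×ˢ Icc t₁ t₂) :=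
  (hx.continuousOn_fderivWithin h12 he (EuclideanSpace.single i 1, 0)).congr fun _ hq =>
    hx.fderiv_slice he hq.1 hq.2 _

lemma IsMeanCurvatureFlow.continuousOn_metricMatrix (hx : IsMeanCurvatureFlow n x t₁ t₂)
    (h12 : t₁ < t₂) (he : e ∈ IsManifold.maximalAtlas (𝓡 n) ∞ M) :
    ContinuousOn (fun q : EuclideanSpace ℝ (Fin n) × ℝ => metricMatrix n (x q.2 ∘ e.symm) q.1)
      (e.target ×ˢ Icc t₁ t₂) :=
  continuousOn_pi.2 fun i => continuousOn_pi.2 fun j =>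
    (hx.continuousOn_coordDeriv h12 he i).inner (𝕜 := ℝ) (hx.continuousOn_coordDeriv h12 he j)

lemma IsMeanCurvatureFlow.continuousOn_areaElement (hx : IsMeanCurvatureFlow n x t₁ t₂)
    (h12 : t₁ < t₂) (he : e ∈ IsManifold.maximalAtlas (𝓡 n) ∞ M) :
    ContinuousOn (fun q : EuclideanSpace ℝ (Fin n) × ℝ => areaElement (x q.2) e q.1)
      (e.target ×ˢ Icc t₁ t₂) :=
  (Continuous.matrix_det continuous_id).comp_continuousOn
    (hx.continuousOn_metricMatrix h12 he) |>.sqrt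

lemma continuousOn_of_charts {F : Type*} [TopologicalSpace F] {g : M × ℝ → F} {I : Set ℝ}
    (h : ∀ p : M, ContinuousOn
      (fun q : EuclideanSpace ℝ (Fin n) × ℝ =>
        g ((chartAt (EuclideanSpace ℝ (Fin n)) p).symm q.1, q.2))
      ((chartAt (EuclideanSpace ℝ (Fin n)) p).target ×ˢ I)) : ContinuousOn g (univ ×ˢ I) := by
  rintro ⟨p, t⟩ ⟨-, ht⟩
  set c := chartAt (EuclideanSpace ℝ (Fin n)) p with hc
  have hps : p ∈ c.source := mem_chart_source _ p
  have h1 : ContinuousWithinAt (fun q : M × ℝ => (c q.1, q.2)) (c.source ×ˢ I) (p, t) :=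
    ((c.continuousAt hps).continuousWithinAt.comp continuousWithinAt_fst (t := univ)
      fun _ _ => mem_univ _).prodMk continuousWithinAt_snd
  have h2 : ContinuousWithinAt (fun q : M × ℝ => g (c.symm (c q.1), q.2)) (c.source ×ˢ I) (p, t) :=
    ContinuousWithinAt.comp
      (g := fun q : EuclideanSpace ℝ (Fin n) × ℝ => g (c.symm q.1, q.2))
      (f := fun q : M × ℝ => (c q.1, q.2)) (h p (c p, t) ⟨c.map_source hps, ht⟩) h1
      fun q hq => ⟨c.map_source hq.1, hq.2⟩
  have h3 : ContinuousWithinAt g (c.source ×ˢ I) (p, t) :=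
    h2.congr (fun q hq => by rw [c.left_inv hq.1]) (by rw [c.left_inv hps])
  refine h3.mono_of_mem_nhdsWithin ?_
  rw [nhdsWithin_prod_eq, nhdsWithin_univ]
  exact Filter.prod_mem_prod (c.open_source.mem_nhds hps) self_mem_nhdsWithin

lemma IsMeanCurvatureFlow.continuousOn_meanCurvature (hx : IsMeanCurvatureFlow n x t₁ t₂)
    (h12 : t₁ < t₂) :
    ContinuousOn (fun q : M × ℝ => meanCurvature n (x q.2) q.1) (univ ×ˢ Icc t₁ t₂) :=
  continuousOn_of_charts (n := n) fun p => (hx.continuousOn_fderivWithin h12 (chartAt_mem (n := n) p) (0, 1)).congr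
    fun _ hq => hx.meanCurvature_eq_fderivWithin h12 (chartAt_mem (n := n) p) hq.1 hq.2

/-- The explicit Gram matrix formula for the projection has jointly continuous ingredients, since
the metric stays nondegenerate. -/
lemma IsMeanCurvatureFlow.continuousOn_normalPart (hx : IsMeanCurvatureFlow n x t₁ t₂)
    (h12 : t₁ < t₂) :
    ContinuousOn (fun q : M × ℝ => normalPart n (x q.2) q.1 (x q.2 q.1))
      (univ ×ˢ Icc t₁ t₂) := by
  refine continuousOn_of_charts (n := n) fun p => ?_
  have he := chartAt_mem (n := n) p
  set e := chartAt (EuclideanSpace ℝ (Fin n)) p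
  have hU := (hx.contDiffOn_flowRep he).continuousOn
  have hinv : ∀ i j, ContinuousOn (fun q : EuclideanSpace ℝ (Fin n) × ℝ =>
      (metricMatrix n (x q.2 ∘ e.symm) q.1)⁻¹ i j) (e.target ×ˢ Icc t₁ t₂) := by
    intro i j q hq
    have h1 := hx.continuousOn_metricMatrix h12 he q hq
    have h2 := (metricMatrix_det_pos ((hx.immersion q.2 hq.2).injective_fderiv he hq.1)).ne'
    have h3 : ContinuousAt (fun A : Matrix (Fin n) (Fin n) ℝ => A⁻¹ i j)
        (metricMatrix n (x q.2 ∘ e.symm) q.1) := by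
      have h4 := continuousAt_matrix_inv (metricMatrix n (x q.2 ∘ e.symm) q.1)
        (by simpa only [Ring.inverse_eq_inv'] using continuousAt_inv₀ h2)
      exact ((continuous_apply_apply i j).continuousAt).comp h4
    exact ContinuousAt.comp_continuousWithinAt
      (f := fun q : EuclideanSpace ℝ (Fin n) × ℝ => metricMatrix n (x q.2 ∘ e.symm) q.1) h3 h1
  have hF : ContinuousOn (fun q : EuclideanSpace ℝ (Fin n) × ℝ => flowRep x e q - ∑ i, ∑ j,
      ((metricMatrix n (x q.2 ∘ e.symm) q.1)⁻¹ i j *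
        ⟪coordDeriv n (x q.2 ∘ e.symm) j q.1, flowRep x e q⟫_ℝ) •
          coordDeriv n (x q.2 ∘ e.symm) i q.1) (e.target ×ˢ Icc t₁ t₂) :=
    hU.sub (continuousOn_finsetSum _ fun i _ => continuousOn_finsetSum _ fun j _ =>
      ((hinv i j).mul ((hx.continuousOn_coordDeriv h12 he j).inner (𝕜 := ℝ) hU)).smul
        (hx.continuousOn_coordDeriv h12 he i))
  refine hF.congr fun q hq => ?_
  have hi := hx.immersion q.2 hq.2
  rw [normalPart_eq_paramNormal hi.smooth he (e.map_target hq.1), e.right_inv hq.1,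
    paramNormal_eq_sub (hi.injective_fderiv he hq.1)]
  rfl

end Flow

/-! ### Evolution of area along the flow -/

section AreaEvolution

open Set
open scoped InnerProductSpace

set_option linter.unusedSectionVars false

/-- With the integrating factor exp(∫ k), the product has zero derivative in the interior.
Continuity at the end points suffices for the mean value theorem. -/
lemma eq_exp_mul_of_hasDerivAt {a b t : ℝ} {A k : ℝ → ℝ} (hk : Continuous k)
    (hA : ContinuousOn A (Icc a b)) (hd : ∀ s ∈ Ioo a b, HasDerivAt A (-k s * A s) s)
    (ht : t ∈ Icc a b) : A t = Real.exp (-∫ s in a..t, k s) * A a := by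
  have hK : ∀ s, HasDerivAt (fun s => ∫ r in a..s, k r) (k s) s := fun s =>
    intervalIntegral.integral_hasDerivAt_right (hk.intervalIntegrable _ _)
      hk.stronglyMeasurable.stronglyMeasurableAtFilter hk.continuousAt
  set B : ℝ → ℝ := fun s => Real.exp (∫ r in a..s, k r) * A s with hB
  have hBd : ∀ s ∈ Ioo a b, HasDerivAt B 0 s := fun s hs => by
    exact ((hK s).exp.mul (hd s hs)).congr_deriv (by ring)
  have hBc : ContinuousOn B (Icc a b) :=
    (Real.continuous_exp.comp_continuousOn
      (continuous_iff_continuousAt.2 fun s => (hK s).continuousAt).continuousOn).mul hA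
  have hBt : B t = B a := by
    rcases ht.1.eq_or_lt with rfl | hat
    · rfl
    · obtain ⟨c, hc, h⟩ := exists_hasDerivAt_eq_slope B (fun _ => 0) hat
        (hBc.mono (Icc_subset_Icc_right ht.2)) fun s hs => hBd s ⟨hs.1, hs.2.trans_le ht.2⟩
      rcases div_eq_zero_iff.1 h.symm with h | h <;> linarith
  simp only [hB, intervalIntegral.integral_same, Real.exp_zero, one_mul] at hBt
  rw [← hBt, ← mul_assoc, ← Real.exp_add, neg_add_cancel, Real.exp_zero, one_mul]

variable {n : ℕ} {M : Type*} [TopologicalSpace M] [ChartedSpace (EuclideanSpace ℝ (Fin n)) M]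
  {E : Type*} [NormedAddCommGroup E] [InnerProductSpace ℝ E] [FiniteDimensional ℝ E]
  {e : OpenPartialHomeomorph M (EuclideanSpace ℝ (Fin n))}
  {x : ℝ → M → E} {t₁ t₂ t : ℝ} {z : EuclideanSpace ℝ (Fin n)}

/-- The first variation formula with velocity H, which is normal. The time is interior so that
`flowRep` is C² on a full neighbourhood. -/
lemma IsMeanCurvatureFlow.hasDerivAt_areaElement [IsManifold (𝓡 n) ∞ M]
    (hx : IsMeanCurvatureFlow n x t₁ t₂)
    (he : e ∈ IsManifold.maximalAtlas (𝓡 n) ∞ M) (hz : z ∈ e.target) (ht : t ∈ Ioo t₁ t₂) :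
    HasDerivAt (fun s => areaElement (x s) e z)
      (-‖meanCurvature n (x t) (e.symm z)‖ ^ 2 * areaElement (x t) e z) t := by
  have h12 : t₁ < t₂ := ht.1.trans ht.2
  have ht' : t ∈ Icc t₁ t₂ := Ioo_subset_Icc_self ht
  have hnhds : ∀ y ∈ e.target, e.target ×ˢ Icc t₁ t₂ ∈ 𝓝 (y, t) := fun y hy =>
    prod_mem_nhds (e.open_target.mem_nhds hy) (Icc_mem_nhds ht.1 ht.2)
  have hH : ∀ y ∈ e.target, fderiv ℝ (flowRep x e) (y, t) (0, 1) =
      meanCurvature n (x t) (e.symm y) := fun y hy => by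
    rw [hx.meanCurvature_eq_fderivWithin h12 he hy ht', fderivWithin_of_mem_nhds (hnhds y hy)]
  have hi := hx.immersion t ht'
  have h1 := hasDerivAt_sqrt_det_metricMatrix (U := flowRep x e) (z := z) (t := t)
    (((hx.contDiffOn_flowRep he).contDiffAt (hnhds z hz)).of_le (WithTop.coe_le_coe.2 le_top))
    (hi.injective_fderiv he hz) (by
      filter_upwards [e.open_target.mem_nhds hz] with y hy i
      rw [hH y hy]
      exact inner_meanCurvature_fderiv hi.smooth he hy _)
  rw [hH z hz] at h1
  have h2 : meanCurvature n (x t) (e.symm z) =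
      paramMeanCurvature (fun y => flowRep x e (y, t)) z := by
    have := meanCurvature_eq_paramMeanCurvature hi.smooth he (e.map_target hz)
    rw [e.right_inv hz] at this
    exact this
  rw [← h2, real_inner_self_eq_norm_sq] at h1
  exact h1

/-- A smooth immersed solution of the mean curvature flow on `[t₁, t₂]`, continued to all times
by its initial and final values, together with the properties that its evolution has. -/
structure IsExtendedFlow (n : ℕ) {M : Type*} [TopologicalSpace M]
    [ChartedSpace (EuclideanSpace ℝ (Fin n)) M] {E : Type*} [NormedAddCommGroup E]
    [InnerProductSpace ℝ E] [FiniteDimensional ℝ E] [MeasurableSpace M]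
    (y : ℝ → M → E) (t₁ t₂ : ℝ) : Prop where
  immersion : ∀ t, IsImmersion n (y t)
  continuous : Continuous fun q : M × ℝ => y q.2 q.1
  continuous_meanCurvature : Continuous fun q : M × ℝ => meanCurvature n (y q.2) q.1
  continuous_normalPart : Continuous fun q : M × ℝ => normalPart n (y q.2) q.1 (y q.2 q.1)
  hasDerivAt : ∀ t ∈ Ioo t₁ t₂, ∀ p, HasDerivAt (fun s => y s p) (meanCurvature n (y t) p) t
  measure_eq : ∀ t ∈ Icc t₁ t₂, inducedMeasure n (y t) = (inducedMeasure n (y t₁)).withDensity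
    fun p => ENNReal.ofReal (Real.exp (-∫ s in t₁..t, ‖meanCurvature n (y s) p‖ ^ 2))

/-- Freezing the flow outside the time interval makes all relevant quantities continuous on the
whole of M × ℝ, so time integrals depend continuously on their parameters. The law for the measures
comes from integrating the area evolution at each point of each chart. -/
lemma IsMeanCurvatureFlow.isExtendedFlow [IsManifold (𝓡 n) ∞ M] [MeasurableSpace M] [BorelSpace M]
    [SecondCountableTopology M] (hx : IsMeanCurvatureFlow n x t₁ t₂) (h12 : t₁ < t₂) :
    IsExtendedFlow n (fun t => x (projIcc t₁ t₂ h12.le t)) t₁ t₂ := by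
  have hproj : ∀ t ∈ Icc t₁ t₂, (projIcc t₁ t₂ h12.le t : ℝ) = t := fun t ht => by
    rw [projIcc_of_mem h12.le ht]
  have hmap : Continuous fun q : M × ℝ => (q.1, (projIcc t₁ t₂ h12.le q.2 : ℝ)) := by
    fun_prop
  have hmem : ∀ q : M × ℝ, (q.1, (projIcc t₁ t₂ h12.le q.2 : ℝ)) ∈ univ ×ˢ Icc t₁ t₂ :=
    fun q => ⟨mem_univ _, Subtype.coe_prop _⟩
  have hH : Continuous fun q : M × ℝ =>
      meanCurvature n (x (projIcc t₁ t₂ h12.le q.2)) q.1 := by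
    have h := ContinuousOn.comp_continuous (hx.continuousOn_meanCurvature h12) hmap hmem
    exact h
  have hN : Continuous fun q : M × ℝ => normalPart n (x (projIcc t₁ t₂ h12.le q.2)) q.1
      (x (projIcc t₁ t₂ h12.le q.2) q.1) := by
    have h := ContinuousOn.comp_continuous (hx.continuousOn_normalPart h12) hmap hmem
    exact h
  have hX : Continuous fun q : M × ℝ => x (projIcc t₁ t₂ h12.le q.2) q.1 := by
    have h := ContinuousOn.comp_continuous hx.smooth.continuousOn hmap hmem
    exact h
  have hd : ∀ t ∈ Ioo t₁ t₂, ∀ p, HasDerivAt (fun s => x (projIcc t₁ t₂ h12.le s) p)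
      (meanCurvature n (x (projIcc t₁ t₂ h12.le t)) p) t := fun t ht p => by
    have ht' := Ioo_subset_Icc_self ht
    have h1 := (hx.evolution t ht' p).hasDerivAt (Icc_mem_nhds ht.1 ht.2)
    rw [hproj t ht']
    refine h1.congr_of_eventuallyEq ?_
    filter_upwards [Icc_mem_nhds ht.1 ht.2] with s hs
    rw [hproj s hs]
  have hH2 : Continuous (Function.uncurry fun (p : M) (s : ℝ) =>
      ‖meanCurvature n (x (projIcc t₁ t₂ h12.le s)) p‖ ^ 2) := by
    have h : Continuous fun q : M × ℝ => ‖meanCurvature n (x (projIcc t₁ t₂ h12.le q.2)) q.1‖ ^ 2 :=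
      hH.norm.pow 2
    exact h
  have hJ : ∀ t, Continuous fun p => Real.exp
      (-∫ s in t₁..t, ‖meanCurvature n (x (projIcc t₁ t₂ h12.le s)) p‖ ^ 2) := fun t =>
    Real.continuous_exp.comp
      (intervalIntegral.continuous_parametric_intervalIntegral_of_continuous
        hH2 continuous_const).neg
  have hA : ∀ t ∈ Icc t₁ t₂, ∀ p : M, ∀ z ∈ (chartAt (EuclideanSpace ℝ (Fin n)) p).target,
      areaElement (x t) (chartAt (EuclideanSpace ℝ (Fin n)) p) z = Real.exp (-∫ s in t₁..t,
        ‖meanCurvature n (x (projIcc t₁ t₂ h12.le s))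
          ((chartAt (EuclideanSpace ℝ (Fin n)) p).symm z)‖ ^ 2) *
        areaElement (x t₁) (chartAt (EuclideanSpace ℝ (Fin n)) p) z := by
    intro t ht p z hz
    have he := chartAt_mem (n := n) p
    set e := chartAt (EuclideanSpace ℝ (Fin n)) p
    refine eq_exp_mul_of_hasDerivAt (b := t₂) (A := fun s => areaElement (x s) e z)
      (k := fun s => ‖meanCurvature n (x (projIcc t₁ t₂ h12.le s)) (e.symm z)‖ ^ 2)
      ?_ ?_ (fun s hs => ?_) ht
    · exact (hH.comp (Continuous.prodMk_right (e.symm z))).norm.pow 2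
    · exact (hx.continuousOn_areaElement h12 he).comp
        (f := fun s : ℝ => (z, s)) (by fun_prop) fun s hs => ⟨hz, hs⟩
    · simp only [hproj s (Ioo_subset_Icc_self hs)]
      exact hx.hasDerivAt_areaElement he hz hs
  refine ⟨fun t => hx.immersion _ (Subtype.coe_prop _),
    hX, hH, hN, hd, fun t ht => ?_⟩
  have h1 : t₁ ∈ Icc t₁ t₂ := left_mem_Icc.2 h12.le
  have h2 := inducedMeasure_eq_withDensity (hx.immersion t₁ h1).smooth (hx.immersion t ht).smooth
    (hJ t) (hA t ht) fun p => (Real.exp_pos _).le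
  rw [hproj t ht, hproj t₁ h1]
  exact h2

end AreaEvolution

/-! ### Gaussian weights along the flow -/

section Weights

open Set
open scoped InnerProductSpace

variable {E : Type*} [NormedAddCommGroup E] [InnerProductSpace ℝ E]

/-- Common to the heat kernel, where θ is -(n/2) log(t₀ - s), and to the decaying weight, where θ =
0. The integral of ‖H‖² accounts for the shrinking area. -/
lemma hasDerivAt_exp_weight {θ c : ℝ → ℝ} {θ' c' a t : ℝ} {Y H : ℝ → E} (hθ : HasDerivAt θ θ' t)
    (hc : HasDerivAt c c' t) (hY : HasDerivAt Y (H t) t) (hH : Continuous H) :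
    HasDerivAt (fun s => Real.exp (θ s - c s * ‖Y s‖ ^ 2 - ∫ r in a..s, ‖H r‖ ^ 2))
      (Real.exp (θ t - c t * ‖Y t‖ ^ 2 - ∫ r in a..t, ‖H r‖ ^ 2) *
        (θ' - c' * ‖Y t‖ ^ 2 - 2 * c t * ⟪Y t, H t⟫_ℝ - ‖H t‖ ^ 2)) t := by
  have hk : Continuous fun s => ‖H s‖ ^ 2 := hH.norm.pow 2
  have hK : HasDerivAt (fun s => ∫ r in a..s, ‖H r‖ ^ 2) (‖H t‖ ^ 2) t :=
    intervalIntegral.integral_hasDerivAt_right (hk.intervalIntegrable _ _)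
      hk.stronglyMeasurable.stronglyMeasurableAtFilter hk.continuousAt
  exact (((hθ.sub (hc.mul hY.norm_sq)).sub hK).exp).congr_deriv (by simp only [Pi.sub_apply, Pi.mul_apply]; ring)

/-- The growth of the exponent `c' = 2 c²` compensates the motion of the position vector. -/
lemma exp_weight_decay {c : ℝ → ℝ} {a b : ℝ} {Y H : ℝ → E} (hab : a ≤ b)
    (hc : ∀ t ∈ Icc a b, HasDerivAt c (2 * c t ^ 2) t) (hY : ∀ t ∈ Ioo a b, HasDerivAt Y (H t) t)
    (hYc : Continuous Y) (hH : Continuous H) :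
    Real.exp (-c b * ‖Y b‖ ^ 2 - ∫ r in a..b, ‖H r‖ ^ 2) +
      1 / 2 * ∫ t in a..b, ‖H t‖ ^ 2 * Real.exp (-c t * ‖Y t‖ ^ 2 - ∫ r in a..t, ‖H r‖ ^ 2) ≤
      Real.exp (-c a * ‖Y a‖ ^ 2) := by
  set w : ℝ → ℝ := fun t => Real.exp (-c t * ‖Y t‖ ^ 2 - ∫ r in a..t, ‖H r‖ ^ 2) with hw
  have hk : Continuous fun s => ‖H s‖ ^ 2 := hH.norm.pow 2
  have hcc : ContinuousOn c (Icc a b) := fun t ht => (hc t ht).continuousAt.continuousWithinAt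
  have hwc : ContinuousOn w (Icc a b) := by
    refine Real.continuous_exp.comp_continuousOn
      ((hcc.neg.mul (hYc.norm.pow 2).continuousOn).sub ?_)
    exact (intervalIntegral.continuous_primitive (fun _ _ => hk.intervalIntegrable _ _) a).continuousOn
  have h1 := intervalIntegral.sub_le_integral_of_hasDeriv_right_of_le hab hwc
    (g' := fun t => w t * (0 - 2 * c t ^ 2 * ‖Y t‖ ^ 2 - 2 * c t * ⟪Y t, H t⟫_ℝ - ‖H t‖ ^ 2))
    (φ := fun t => -(1 / 2) * (‖H t‖ ^ 2 * w t)) (fun t ht => ?_)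
    (((hk.continuousOn.mul hwc).const_smul (-(1 / 2) : ℝ)).integrableOn_Icc) fun t ht => ?_
  · rw [intervalIntegral.integral_const_mul] at h1
    have h2 : w a = Real.exp (-c a * ‖Y a‖ ^ 2) := by simp [hw]
    rw [← h2]
    linarith
  · have h2 := hasDerivAt_exp_weight (a := a) (hasDerivAt_const t (0 : ℝ))
      (hc t (Ioo_subset_Icc_self ht)) (hY t ht) hH
    simp only [zero_sub, ← neg_mul] at h2
    simp only [zero_sub, ← neg_mul]
    exact h2.hasDerivWithinAt
  · have h3 : 0 < w t := Real.exp_pos _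
    have h4 : -(c t * ⟪Y t, H t⟫_ℝ) ≤ |c t| * (‖Y t‖ * ‖H t‖) := by
      refine (neg_le_abs _).trans ?_
      rw [abs_mul]
      gcongr
      exact abs_real_inner_le_norm _ _
    -- Young's inequality 2|c||Y||H| ≤ 2c²|Y|² + ½|H|². The growth of c pays for the first term and
    -- the loss of area for the second, with ½|H|² to spare.
    have h5 : 0 - 2 * c t ^ 2 * ‖Y t‖ ^ 2 - 2 * c t * ⟪Y t, H t⟫_ℝ - ‖H t‖ ^ 2 ≤
        -(1 / 2) * ‖H t‖ ^ 2 := by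
      have h6 := sq_nonneg (2 * (|c t| * ‖Y t‖) - ‖H t‖)
      have h7 : (|c t| * ‖Y t‖) ^ 2 = c t ^ 2 * ‖Y t‖ ^ 2 := by rw [mul_pow, sq_abs]
      nlinarith
    calc _ ≤ w t * (-(1 / 2) * ‖H t‖ ^ 2) := mul_le_mul_of_nonneg_left h5 h3.le
      _ = _ := by ring

/-- Allows a polynomial factor to be absorbed by a small gap δ between two Gaussian exponents. -/
lemma exp_neg_mul_le {δ r : ℝ} (hδ : 0 < δ) (hr : 0 ≤ r) :
    Real.exp (-δ * r) * (1 + r) ≤ 1 + 1 / δ := by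
  have h1 : Real.exp (-δ * r) ≤ 1 := Real.exp_le_one_iff.2 (by nlinarith)
  have h2 : Real.exp (-δ * r) * (δ * r) ≤ 1 := by
    have h3 : δ * r ≤ Real.exp (δ * r) := by linarith [Real.add_one_le_exp (δ * r)]
    calc Real.exp (-δ * r) * (δ * r) ≤ Real.exp (-δ * r) * Real.exp (δ * r) := by gcongr
      _ = 1 := by rw [← Real.exp_add]; simp
  have h4 : Real.exp (-δ * r) * r ≤ 1 / δ := by
    rw [le_div_iff₀ hδ]; linarith
  linarith

end Weights

/-! ### Densities in the monotonicity formula and their bounds -/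

section ShrinkDensity

open Set
open scoped InnerProductSpace

set_option linter.unusedSectionVars false

variable (n : ℕ) {M : Type*} [TopologicalSpace M] [ChartedSpace (EuclideanSpace ℝ (Fin n)) M]
  {E : Type*} [NormedAddCommGroup E] [InnerProductSpace ℝ E] [FiniteDimensional ℝ E]

/-- The logarithm of the ratio of the area elements at the times `t₁` and `q.2`. -/
def areaLoss (y : ℝ → M → E) (t₁ : ℝ) (q : M × ℝ) : ℝ :=
  ∫ s in t₁..q.2, ‖meanCurvature n (y s) q.1‖ ^ 2

/-- The density, with respect to the area at time `t₁`, of the backward heat kernel which is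
concentrated at time `t₀` in the origin. -/
def kernelDensity (y : ℝ → M → E) (t₁ t₀ : ℝ) (q : M × ℝ) : ℝ :=
  Real.exp (-(n / 2 : ℝ) * Real.log (t₀ - q.2) - 1 / (4 * (t₀ - q.2)) * ‖y q.2 q.1‖ ^ 2 -
    areaLoss n y t₁ q)

/-- The time derivative of `kernelDensity`. -/
def kernelDensityDeriv (y : ℝ → M → E) (t₁ t₀ : ℝ) (q : M × ℝ) : ℝ :=
  kernelDensity n y t₁ t₀ q * ((n / 2 : ℝ) / (t₀ - q.2) -
    1 / (4 * (t₀ - q.2) ^ 2) * ‖y q.2 q.1‖ ^ 2 -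
    2 * (1 / (4 * (t₀ - q.2))) * ⟪y q.2 q.1, meanCurvature n (y q.2) q.1⟫_ℝ -
    ‖meanCurvature n (y q.2) q.1‖ ^ 2)

/-- A Gaussian density whose integral is controlled along the flow. -/
def decayDensity (y : ℝ → M → E) (t₁ C : ℝ) (q : M × ℝ) : ℝ :=
  Real.exp (-(1 / (C - 2 * (q.2 - t₁))) * ‖y q.2 q.1‖ ^ 2 - areaLoss n y t₁ q)

/-- The vector field whose vanishing is the self-shrinker equation. -/
def shrinkerDefect (y : ℝ → M → E) (t₀ : ℝ) (q : M × ℝ) : E :=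
  meanCurvature n (y q.2) q.1 + (1 / (2 * (t₀ - q.2))) • normalPart n (y q.2) q.1 (y q.2 q.1)

/-- The quantity which dominates all integrands. -/
def dominatingDensity (y : ℝ → M → E) (t₁ C : ℝ) (q : M × ℝ) : ℝ :=
  decayDensity n y t₁ C q * (1 + ‖meanCurvature n (y q.2) q.1‖ ^ 2)

variable {n} {y : ℝ → M → E} {t₁ t₂ t₀ C t : ℝ}

/-- The exponent of the heat kernel exceeds that of `decayDensity` by a margin independent of time.
This margin absorbs the factor 1 + |y|², while the factor in |H|² is kept in `dominatingDensity`. -/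
lemma kernelDensity_mul_le (h2 : t₂ < t₀) (hC : 4 * (t₀ - t₁) < C) :
    ∃ K : ℝ, 0 ≤ K ∧ ∀ q : M × ℝ, q.2 ∈ Icc t₁ t₂ →
      kernelDensity n y t₁ t₀ q * (1 + ‖y q.2 q.1‖ ^ 2 + ‖meanCurvature n (y q.2) q.1‖ ^ 2) ≤
        K * dominatingDensity n y t₁ C q := by
  rcases lt_or_ge t₂ t₁ with hlt | h12
  · exact ⟨0, le_rfl, fun q hq => absurd (hq.1.trans hq.2) (not_le.2 hlt)⟩
  have hC0 : 0 < C := by linarith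
  -- The difference 1/(4(t₀ - t₁)) - 1/C of the two exponents at time t₁, which bounds their
  -- difference from below at all later times.
  set δ := (C - 4 * (t₀ - t₁)) / (4 * (t₀ - t₁) * C) with hδ
  have hδ0 : 0 < δ := div_pos (by linarith) (mul_pos (by linarith) hC0)
  set κ := -(n / 2 : ℝ) * Real.log (t₀ - t₂)
  refine ⟨Real.exp κ * (1 + 1 / δ), by positivity, fun q hq => ?_⟩
  have hτ : 0 < t₀ - q.2 := by linarith [hq.2]
  have hlog : -(n / 2 : ℝ) * Real.log (t₀ - q.2) ≤ κ := by
    have := Real.log_le_log (by linarith : 0 < t₀ - t₂) (by linarith [hq.2] : t₀ - t₂ ≤ t₀ - q.2)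
    have hn : (0 : ℝ) ≤ n / 2 := by positivity
    simp only [κ]
    nlinarith
  have hcoef : 1 / (C - 2 * (q.2 - t₁)) + δ ≤ 1 / (4 * (t₀ - q.2)) := by
    have h3 : 0 < C - 2 * (q.2 - t₁) := by linarith [hq.2]
    have h4 : 1 / (4 * (t₀ - q.2)) - 1 / (C - 2 * (q.2 - t₁)) =
        (C - 4 * (t₀ - t₁) + 2 * (q.2 - t₁)) / (4 * (t₀ - q.2) * (C - 2 * (q.2 - t₁))) := by
      field_simp
      ring
    have h5 : δ ≤ 1 / (4 * (t₀ - q.2)) - 1 / (C - 2 * (q.2 - t₁)) := by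
      rw [h4, hδ]
      have hs : 0 ≤ q.2 - t₁ := by linarith [hq.1]
      gcongr <;> linarith
    linarith
  set r := ‖y q.2 q.1‖ ^ 2 with hr
  set h := ‖meanCurvature n (y q.2) q.1‖ ^ 2 with hh
  have hr0 : 0 ≤ r := sq_nonneg _
  have hh0 : 0 ≤ h := sq_nonneg _
  have h6 : kernelDensity n y t₁ t₀ q ≤
      Real.exp κ * (Real.exp (-δ * r) * decayDensity n y t₁ C q) := by
    rw [kernelDensity, decayDensity, ← Real.exp_add, ← Real.exp_add, Real.exp_le_exp, ← hr]
    nlinarith [mul_le_mul_of_nonneg_right hcoef hr0]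
  have hw0 : 0 < decayDensity n y t₁ C q := Real.exp_pos _
  have h7 := exp_neg_mul_le hδ0 hr0
  calc kernelDensity n y t₁ t₀ q * (1 + r + h)
      ≤ Real.exp κ * (Real.exp (-δ * r) * decayDensity n y t₁ C q) * ((1 + r) * (1 + h)) := by
        gcongr
        nlinarith [mul_nonneg hr0 hh0]
    _ = Real.exp κ * (Real.exp (-δ * r) * (1 + r)) * (decayDensity n y t₁ C q * (1 + h)) := by ring
    _ ≤ Real.exp κ * (1 + 1 / δ) * (decayDensity n y t₁ C q * (1 + h)) := by gcongr

lemma abs_kernelDensityDeriv_le (h2 : t₂ < t₀) :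
    ∃ D : ℝ, 0 ≤ D ∧ ∀ q : M × ℝ, q.2 ∈ Icc t₁ t₂ → |kernelDensityDeriv n y t₁ t₀ q| ≤
      D * (kernelDensity n y t₁ t₀ q *
        (1 + ‖y q.2 q.1‖ ^ 2 + ‖meanCurvature n (y q.2) q.1‖ ^ 2)) := by
  set m := 1 / (t₀ - t₂) with hm
  have hm0 : 0 < m := one_div_pos.2 (by linarith)
  refine ⟨n / 2 * m + m ^ 2 / 4 + m / 2 + 1, by positivity, fun q hq => ?_⟩
  have hτ : 0 < t₀ - q.2 := by linarith [hq.2]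
  set σ := 1 / (t₀ - q.2) with hσ
  have hσ0 : 0 < σ := one_div_pos.2 hτ
  have hσm : σ ≤ m := one_div_le_one_div_of_le (by linarith) (by linarith [hq.2])
  have hu : 0 < kernelDensity n y t₁ t₀ q := Real.exp_pos _
  rw [kernelDensityDeriv, abs_mul, abs_of_pos hu, mul_left_comm]
  refine mul_le_mul_of_nonneg_left ?_ hu.le
  set r := ‖y q.2 q.1‖
  set h := ‖meanCurvature n (y q.2) q.1‖
  have h1 : |⟪y q.2 q.1, meanCurvature n (y q.2) q.1⟫_ℝ| ≤ r * h := abs_real_inner_le_norm _ _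
  set i := ⟪y q.2 q.1, meanCurvature n (y q.2) q.1⟫_ℝ
  have e1 : (n / 2 : ℝ) / (t₀ - q.2) = n / 2 * σ := by rw [hσ]; ring
  have e2 : 1 / (4 * (t₀ - q.2) ^ 2) = σ ^ 2 / 4 := by rw [hσ]; field_simp
  have e3 : 2 * (1 / (4 * (t₀ - q.2))) = σ / 2 := by rw [hσ]; field_simp; norm_num
  rw [e1, e2, e3]
  have hrh : |i| ≤ r ^ 2 + h ^ 2 := h1.trans (by nlinarith [sq_nonneg (r - h), sq_nonneg (r + h)])
  have hσ2 : σ ^ 2 ≤ m ^ 2 := by gcongr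
  calc |n / 2 * σ - σ ^ 2 / 4 * r ^ 2 - σ / 2 * i - h ^ 2|
      ≤ |n / 2 * σ| + |σ ^ 2 / 4 * r ^ 2| + |σ / 2 * i| + |h ^ 2| := by
        refine (abs_sub _ _).trans (add_le_add_left ((abs_sub _ _).trans
          (add_le_add_left (abs_sub _ _) _)) _)
    _ = n / 2 * σ + σ ^ 2 / 4 * r ^ 2 + σ / 2 * |i| + h ^ 2 := by
        rw [abs_of_nonneg (by positivity), abs_of_nonneg (by positivity), abs_mul,
          abs_of_pos (by positivity : 0 < σ / 2), abs_of_nonneg (sq_nonneg h)]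
    _ ≤ n / 2 * m * (1 + r ^ 2 + h ^ 2) + m ^ 2 / 4 * (1 + r ^ 2 + h ^ 2) +
          m / 2 * (1 + r ^ 2 + h ^ 2) + (1 + r ^ 2 + h ^ 2) := by
        have a1 : n / 2 * σ ≤ n / 2 * m * (1 + r ^ 2 + h ^ 2) := by
          calc n / 2 * σ ≤ n / 2 * m * 1 := by rw [mul_one]; gcongr
            _ ≤ _ := by gcongr; nlinarith [sq_nonneg r, sq_nonneg h]
        have a2 : σ ^ 2 / 4 * r ^ 2 ≤ m ^ 2 / 4 * (1 + r ^ 2 + h ^ 2) := by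
          gcongr; nlinarith [sq_nonneg h]
        have a3 : σ / 2 * |i| ≤ m / 2 * (1 + r ^ 2 + h ^ 2) := by
          gcongr; linarith
        have a4 : h ^ 2 ≤ 1 + r ^ 2 + h ^ 2 := by nlinarith [sq_nonneg r]
        linarith
    _ = _ := by ring

lemma norm_normalPart_le (f : M → E) (p : M) (v : E) : ‖normalPart n f p v‖ ≤ ‖v‖ :=
  Submodule.norm_starProjection_apply_le _ _

/-- Makes the dissipation term integrable wherever `dominatingDensity` is. -/
lemma norm_shrinkerDefect_sq_le (h2 : t₂ < t₀) :
    ∃ D : ℝ, 0 ≤ D ∧ ∀ q : M × ℝ, q.2 ∈ Icc t₁ t₂ → ‖shrinkerDefect n y t₀ q‖ ^ 2 ≤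
      D * (1 + ‖y q.2 q.1‖ ^ 2 + ‖meanCurvature n (y q.2) q.1‖ ^ 2) := by
  set m := 1 / (2 * (t₀ - t₂)) with hm
  have hm0 : 0 < m := one_div_pos.2 (by linarith)
  refine ⟨2 + 2 * m ^ 2, by positivity, fun q hq => ?_⟩
  have hτ : 0 < t₀ - q.2 := by linarith [hq.2]
  set σ := 1 / (2 * (t₀ - q.2)) with hσ
  have hσ0 : 0 < σ := one_div_pos.2 (by linarith)
  have hσm : σ ≤ m := one_div_le_one_div_of_le (by linarith) (by linarith [hq.2])
  have h1 : ‖shrinkerDefect n y t₀ q‖ ≤ ‖meanCurvature n (y q.2) q.1‖ + m * ‖y q.2 q.1‖ := by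
    refine (norm_add_le _ _).trans (add_le_add_right ?_ _)
    rw [norm_smul, Real.norm_of_nonneg hσ0.le]
    exact mul_le_mul hσm (norm_normalPart_le _ _ _) (norm_nonneg _) hm0.le
  set r := ‖y q.2 q.1‖
  set h := ‖meanCurvature n (y q.2) q.1‖
  calc ‖shrinkerDefect n y t₀ q‖ ^ 2 ≤ (h + m * r) ^ 2 := by gcongr
    _ ≤ 2 * h ^ 2 + 2 * m ^ 2 * r ^ 2 := by nlinarith [sq_nonneg (h - m * r)]
    _ ≤ _ := by nlinarith [mul_nonneg (sq_nonneg m) (sq_nonneg h), sq_nonneg r, sq_nonneg m]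

/-- H is a combination of normal vectors, so it sees only the normal part of the position. This lets
the square of `shrinkerDefect` be completed. -/
lemma inner_meanCurvature_normalPart (f : M → E) (p : M) :
    ⟪f p, meanCurvature n f p⟫_ℝ = ⟪normalPart n f p (f p), meanCurvature n f p⟫_ℝ := by
  rw [meanCurvature, inner_sum, inner_sum]
  refine Finset.sum_congr rfl fun i _ => ?_
  rw [inner_sum, inner_sum]
  refine Finset.sum_congr rfl fun j _ => ?_
  rw [inner_smul_right, inner_smul_right, normalPart, normalPart,
    ← Submodule.inner_starProjection_left_eq_right,
    ← Submodule.inner_starProjection_left_eq_right, Submodule.starProjection_eq_self_iff.2 (Submodule.starProjection_apply_mem _ _)]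

/-- The pointwise identity behind the monotonicity formula. -/
lemma kernelDensityDeriv_eq (q : M × ℝ) (hq : q.2 < t₀) :
    kernelDensityDeriv n y t₁ t₀ q =
      -(Real.exp (-(n / 2 : ℝ) * Real.log (t₀ - q.2)) * (Real.exp (-areaLoss n y t₁ q) *
        gaussianLaplacian n (1 / (4 * (t₀ - q.2))) (y q.2) q.1)) -
      kernelDensity n y t₁ t₀ q * ‖shrinkerDefect n y t₀ q‖ ^ 2 := by
  have hτ : t₀ - q.2 ≠ 0 := by linarith
  have h1 : kernelDensity n y t₁ t₀ q = Real.exp (-(n / 2 : ℝ) * Real.log (t₀ - q.2)) *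
      (Real.exp (-areaLoss n y t₁ q) *
        Real.exp (-(1 / (4 * (t₀ - q.2))) * ‖y q.2 q.1‖ ^ 2)) := by
    rw [kernelDensity, ← Real.exp_add, ← Real.exp_add]
    congr 1
    ring
  rw [gaussianLaplacian, shrinkerDefect, kernelDensityDeriv, h1,
    norm_add_sq_real, norm_smul, mul_pow, inner_smul_right, Real.norm_eq_abs, sq_abs,
    inner_meanCurvature_normalPart, real_inner_comm]
  -- The tangential square in the Laplacian and the normal square in the defect add up to |y|²/(4(t₀
  -- - t)²), while the terms in ⟨y, H⟩ combine to -⟨y, H⟩/(2(t₀ - t)).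
  field_simp
  ring

end ShrinkDensity

/-! ### Integrability along the flow -/

section Monotonicity

open Set
open scoped InnerProductSpace

set_option linter.unusedSectionVars false

attribute [local irreducible] meanCurvature normalPart

variable {n : ℕ} {M : Type*} [TopologicalSpace M] [ChartedSpace (EuclideanSpace ℝ (Fin n)) M]
  {E : Type*} [NormedAddCommGroup E] [InnerProductSpace ℝ E] [FiniteDimensional ℝ E]
  [IsManifold (𝓡 n) ∞ M] [MeasurableSpace M] [BorelSpace M] [SecondCountableTopology M]
  {y : ℝ → M → E} {t₁ t₂ t₀ C t : ℝ}

lemma IsExtendedFlow.continuous_areaLoss (hy : IsExtendedFlow n y t₁ t₂) :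
    Continuous (areaLoss n y t₁) := by
  have h : Continuous (Function.uncurry fun (q : M × ℝ) (s : ℝ) =>
      ‖meanCurvature n (y s) q.1‖ ^ 2) := by
    have h1 : Continuous fun r : (M × ℝ) × ℝ => ‖meanCurvature n (y r.2) r.1.1‖ ^ 2 := by
      have h2 := hy.continuous_meanCurvature.comp
        (by fun_prop : Continuous fun r : (M × ℝ) × ℝ => (r.1.1, r.2))
      exact h2.norm.pow 2
    exact h1
  exact intervalIntegral.continuous_parametric_intervalIntegral_of_continuous h continuous_snd

lemma IsExtendedFlow.continuous_normSq (hy : IsExtendedFlow n y t₁ t₂) :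
    Continuous fun q : M × ℝ => ‖y q.2 q.1‖ ^ 2 := hy.continuous.norm.pow 2

lemma IsExtendedFlow.continuous_meanCurvature_normSq (hy : IsExtendedFlow n y t₁ t₂) :
    Continuous fun q : M × ℝ => ‖meanCurvature n (y q.2) q.1‖ ^ 2 :=
  hy.continuous_meanCurvature.norm.pow 2

lemma IsExtendedFlow.measurable_kernelDensity (hy : IsExtendedFlow n y t₁ t₂) :
    Measurable (kernelDensity n y t₁ t₀) := by
  have h1 := hy.continuous_areaLoss.measurable
  have h2 := hy.continuous_normSq.measurable
  unfold kernelDensity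
  fun_prop

lemma IsExtendedFlow.measurable_kernelDensityDeriv (hy : IsExtendedFlow n y t₁ t₂) :
    Measurable (kernelDensityDeriv n y t₁ t₀) := by
  have h1 := hy.measurable_kernelDensity (t₀ := t₀)
  have h2 := hy.continuous_normSq.measurable
  have h3 := hy.continuous_meanCurvature_normSq.measurable
  have h4 : Measurable fun q : M × ℝ => ⟪y q.2 q.1, meanCurvature n (y q.2) q.1⟫_ℝ :=
    (hy.continuous.inner (𝕜 := ℝ) hy.continuous_meanCurvature).measurable
  unfold kernelDensityDeriv
  fun_prop

lemma IsExtendedFlow.measurable_dominatingDensity (hy : IsExtendedFlow n y t₁ t₂) :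
    Measurable (dominatingDensity n y t₁ C) := by
  have h1 := hy.continuous_areaLoss.measurable
  have h2 := hy.continuous_normSq.measurable
  have h3 := hy.continuous_meanCurvature_normSq.measurable
  unfold dominatingDensity decayDensity
  fun_prop

lemma IsExtendedFlow.continuous_meanCurvature_slice (hy : IsExtendedFlow n y t₁ t₂) (p : M) :
    Continuous fun s => meanCurvature n (y s) p :=
  hy.continuous_meanCurvature.comp (Continuous.prodMk_right p)

lemma IsExtendedFlow.continuous_slice (hy : IsExtendedFlow n y t₁ t₂) (p : M) :
    Continuous fun s => y s p :=
  hy.continuous.comp (Continuous.prodMk_right p)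

/-- An instance of `exp_weight_decay`: 1/(C - 2(t - t₁)) is the solution of c' = 2c² with initial
value 1/C, and the condition on C keeps it finite up to t₂. -/
lemma IsExtendedFlow.decayDensity_add_le (hy : IsExtendedFlow n y t₁ t₂)
    (hC : 2 * (t₂ - t₁) < C) (ht : t ∈ Icc t₁ t₂) (p : M) :
    decayDensity n y t₁ C (p, t) + 1 / 2 * ∫ s in t₁..t, ‖meanCurvature n (y s) p‖ ^ 2 *
      decayDensity n y t₁ C (p, s) ≤ Real.exp (-(1 / C) * ‖y t₁ p‖ ^ 2) := by
  have h := exp_weight_decay (c := fun s => 1 / (C - 2 * (s - t₁))) (Y := fun s => y s p)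
    (H := fun s => meanCurvature n (y s) p) ht.1 (fun s hs => ?_)
    (fun s hs => hy.hasDerivAt s ⟨hs.1, hs.2.trans_le ht.2⟩ p) (hy.continuous_slice p)
    (hy.continuous_meanCurvature_slice p)
  · simp only [sub_self, mul_zero, sub_zero] at h
    exact h
  · have h0 : C - 2 * (s - t₁) ≠ 0 := by linarith [hs.2, ht.2]
    have h1 : HasDerivAt (fun s => C - 2 * (s - t₁)) (-2) s := by
      simpa using (((hasDerivAt_id s).sub_const t₁).const_mul 2).const_sub C
    have h2 := h1.inv h0
    simp only [one_div]
    refine h2.congr_deriv ?_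
    field_simp

lemma IsExtendedFlow.decayDensity_le (hy : IsExtendedFlow n y t₁ t₂)
    (hC : 2 * (t₂ - t₁) < C) (ht : t ∈ Icc t₁ t₂) (p : M) :
    decayDensity n y t₁ C (p, t) ≤ Real.exp (-(1 / C) * ‖y t₁ p‖ ^ 2) := by
  refine le_trans ?_ (hy.decayDensity_add_le hC ht p)
  have : 0 ≤ ∫ s in t₁..t, ‖meanCurvature n (y s) p‖ ^ 2 * decayDensity n y t₁ C (p, s) :=
    intervalIntegral.integral_nonneg ht.1 fun s _ =>
      mul_nonneg (sq_nonneg _) (Real.exp_pos _).le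
  linarith

lemma IsExtendedFlow.continuousOn_decayDensity (hy : IsExtendedFlow n y t₁ t₂)
    (hC : 2 * (t₂ - t₁) < C) (p : M) :
    ContinuousOn (fun s => decayDensity n y t₁ C (p, s)) (Icc t₁ t₂) := by
  have h1 : Continuous fun s => areaLoss n y t₁ (p, s) :=
    hy.continuous_areaLoss.comp (Continuous.prodMk_right p)
  have h2 := hy.continuous_slice p
  have h3 : ContinuousOn (fun s : ℝ => 1 / (C - 2 * (s - t₁))) (Icc t₁ t₂) :=
    continuousOn_const.div (by fun_prop) fun s hs => by linarith [hs.2]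
  exact Real.continuous_exp.comp_continuousOn
    ((h3.neg.mul (h2.norm.pow 2).continuousOn).sub h1.continuousOn)

/-- This takes the place of a curvature bound: only the time integral of |H|² against the weight is
controlled, by the dissipation term in `decayDensity_add_le`. -/
lemma IsExtendedFlow.integrable_dominatingDensity (hy : IsExtendedFlow n y t₁ t₂)
    (h12 : t₁ ≤ t₂) (hC : 2 * (t₂ - t₁) < C)
    (hint : Integrable (fun p => Real.exp (-(1 / C) * ‖y t₁ p‖ ^ 2)) (inducedMeasure n (y t₁))) :
    Integrable (dominatingDensity n y t₁ C)
      ((inducedMeasure n (y t₁)).prod (volume.restrict (Ioc t₁ t₂))) := by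
  have hm := hy.measurable_dominatingDensity (C := C)
  have hms := hm.aestronglyMeasurable
    (μ := (inducedMeasure n (y t₁)).prod (volume.restrict (Ioc t₁ t₂)))
  have hH := fun p => (hy.continuous_meanCurvature_slice p).norm.pow 2
  have hw := hy.continuousOn_decayDensity hC
  have hc : ∀ p : M, ContinuousOn (fun s => dominatingDensity n y t₁ C (p, s)) (Icc t₁ t₂) :=
    fun p => (hw p).mul (continuous_const.add (hH p)).continuousOn
  rw [integrable_prod_iff hms]
  refine ⟨Filter.Eventually.of_forall fun p =>
    (hc p).integrableOn_Icc.mono_set Ioc_subset_Icc_self, ?_⟩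
  -- Time is integrated first. The weight contributes t₂ - t₁ times the initial Gaussian, and the
  -- part with |H|² contributes twice the initial Gaussian because of the factor 1/2 in the decay
  -- estimate.
  refine (hint.const_mul (t₂ - t₁ + 2)).mono' hms.norm.integral_prod_right' ?_
  filter_upwards with p
  have h0 : ∀ s, 0 ≤ dominatingDensity n y t₁ C (p, s) := fun s =>
    mul_nonneg (Real.exp_pos _).le (by positivity)
  rw [Real.norm_of_nonneg (integral_nonneg fun s => norm_nonneg _)]
  simp_rw [Real.norm_of_nonneg (h0 _)]
  rw [← intervalIntegral.integral_of_le h12]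
  have h1 : IntervalIntegrable (fun s => decayDensity n y t₁ C (p, s)) volume t₁ t₂ :=
    (hw p).intervalIntegrable_of_Icc h12
  have h2 : IntervalIntegrable (fun s => ‖meanCurvature n (y s) p‖ ^ 2 *
      decayDensity n y t₁ C (p, s)) volume t₁ t₂ :=
    ((hH p).continuousOn.mul (hw p)).intervalIntegrable_of_Icc h12
  have h3 : ∫ s in t₁..t₂, dominatingDensity n y t₁ C (p, s) =
      (∫ s in t₁..t₂, decayDensity n y t₁ C (p, s)) +
        ∫ s in t₁..t₂, ‖meanCurvature n (y s) p‖ ^ 2 * decayDensity n y t₁ C (p, s) := by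
    rw [← intervalIntegral.integral_add h1 h2]
    refine intervalIntegral.integral_congr fun s _ => ?_
    simp only [dominatingDensity]
    ring
  have h4 : ∫ s in t₁..t₂, decayDensity n y t₁ C (p, s) ≤
      (t₂ - t₁) * Real.exp (-(1 / C) * ‖y t₁ p‖ ^ 2) := by
    have := intervalIntegral.integral_mono_on h12 h1 (intervalIntegrable_const (μ := volume))
      fun s hs => hy.decayDensity_le hC hs p
    rwa [intervalIntegral.integral_const, smul_eq_mul] at this
  have h5 := hy.decayDensity_add_le hC (right_mem_Icc.2 h12) p
  have h6 : 0 < decayDensity n y t₁ C (p, t₂) := Real.exp_pos _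
  rw [h3]
  linarith

lemma IsExtendedFlow.hasDerivAt_kernelDensity (hy : IsExtendedFlow n y t₁ t₂) (h2 : t₂ < t₀)
    (ht : t ∈ Ioo t₁ t₂) (p : M) :
    HasDerivAt (fun s => kernelDensity n y t₁ t₀ (p, s)) (kernelDensityDeriv n y t₁ t₀ (p, t)) t := by
  have hτ : t₀ - t ≠ 0 := by linarith [ht.2]
  have h1 : HasDerivAt (fun s => t₀ - s) (-1) t := by
    simpa using (hasDerivAt_id t).const_sub t₀
  have hθ : HasDerivAt (fun s => -(n / 2 : ℝ) * Real.log (t₀ - s)) ((n / 2 : ℝ) / (t₀ - t)) t :=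
    ((h1.log hτ).const_mul _).congr_deriv (by ring)
  have hc : HasDerivAt (fun s => 1 / (4 * (t₀ - s))) (1 / (4 * (t₀ - t) ^ 2)) t := by
    have h3 := (h1.const_mul 4).inv (mul_ne_zero four_ne_zero hτ)
    simp only [one_div]
    refine h3.congr_deriv ?_
    field_simp
  exact hasDerivAt_exp_weight hθ hc (hy.hasDerivAt t ht p) (hy.continuous_meanCurvature_slice p)

lemma IsExtendedFlow.continuousOn_kernelDensity (hy : IsExtendedFlow n y t₁ t₂) (h2 : t₂ < t₀)
    (p : M) : ContinuousOn (fun s => kernelDensity n y t₁ t₀ (p, s)) (Icc t₁ t₂) := by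
  have h1 : Continuous fun s => areaLoss n y t₁ (p, s) :=
    hy.continuous_areaLoss.comp (Continuous.prodMk_right p)
  have h3 := hy.continuous_slice p
  have h4 : ContinuousOn (fun s : ℝ => t₀ - s) (Icc t₁ t₂) := by fun_prop
  have h5 : ContinuousOn (fun s : ℝ => 1 / (4 * (t₀ - s))) (Icc t₁ t₂) :=
    continuousOn_const.div (by fun_prop) fun s hs => by linarith [hs.2]
  exact Real.continuous_exp.comp_continuousOn
    (((continuousOn_const.mul (h4.log fun s hs => by linarith [hs.2])).sub
      (h5.mul (h3.norm.pow 2).continuousOn)).sub h1.continuousOn)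

lemma IsExtendedFlow.continuousOn_kernelDensityDeriv (hy : IsExtendedFlow n y t₁ t₂)
    (h2 : t₂ < t₀) (p : M) :
    ContinuousOn (fun s => kernelDensityDeriv n y t₁ t₀ (p, s)) (Icc t₁ t₂) := by
  have h3 := hy.continuous_slice p
  have hH := hy.continuous_meanCurvature_slice p
  have h4 : ContinuousOn (fun s : ℝ => (n / 2 : ℝ) / (t₀ - s)) (Icc t₁ t₂) :=
    continuousOn_const.div (by fun_prop) fun s hs => by linarith [hs.2]
  have h5 : ContinuousOn (fun s : ℝ => 1 / (4 * (t₀ - s) ^ 2)) (Icc t₁ t₂) :=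
    continuousOn_const.div (by fun_prop) fun s hs => by
      have : 0 < t₀ - s := by linarith [hs.2]
      positivity
  have h6 : ContinuousOn (fun s : ℝ => 2 * (1 / (4 * (t₀ - s)))) (Icc t₁ t₂) :=
    continuousOn_const.mul (continuousOn_const.div (by fun_prop) fun s hs => by linarith [hs.2])
  exact (hy.continuousOn_kernelDensity h2 p).mul
    (((h4.sub (h5.mul (h3.norm.pow 2).continuousOn)).sub
      (h6.mul (h3.inner (𝕜 := ℝ) hH).continuousOn)).sub (hH.norm.pow 2).continuousOn)

/-- Holds at every time, in particular at both ends, where the two values of Φ are subtracted.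
Cancelling the factor 1 + |H|² in `kernelDensity_mul_le` bounds the kernel by the decaying weight,
hence by the initial Gaussian. -/
lemma IsExtendedFlow.integrable_kernelDensity (hy : IsExtendedFlow n y t₁ t₂) (h2 : t₂ < t₀)
    (hC : 4 * (t₀ - t₁) < C) (ht : t ∈ Icc t₁ t₂)
    (hint : Integrable (fun p => Real.exp (-(1 / C) * ‖y t₁ p‖ ^ 2)) (inducedMeasure n (y t₁))) :
    Integrable (fun p => kernelDensity n y t₁ t₀ (p, t)) (inducedMeasure n (y t₁)) := by
  obtain ⟨K, hK, h⟩ := kernelDensity_mul_le (n := n) (M := M) (y := y) h2 hC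
  have hC2 : 2 * (t₂ - t₁) < C := by linarith [ht.1, ht.2]
  refine (hint.const_mul K).mono' (hy.measurable_kernelDensity.comp
    measurable_prodMk_right).aestronglyMeasurable ?_
  filter_upwards with p
  have hu : 0 < kernelDensity n y t₁ t₀ (p, t) := Real.exp_pos _
  rw [Real.norm_of_nonneg hu.le]
  have h3 := h (p, t) ht
  have h4 := hy.decayDensity_le hC2 ht p
  simp only [dominatingDensity] at h3
  have h5 : kernelDensity n y t₁ t₀ (p, t) ≤ K * decayDensity n y t₁ C (p, t) := by
    have h6 : 0 < 1 + ‖meanCurvature n (y t) p‖ ^ 2 := by positivity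
    refine le_of_mul_le_mul_right ?_ h6
    calc _ ≤ kernelDensity n y t₁ t₀ (p, t) *
          (1 + ‖y t p‖ ^ 2 + ‖meanCurvature n (y t) p‖ ^ 2) := by
          gcongr
          nlinarith [sq_nonneg ‖y t p‖]
      _ ≤ _ := h3.trans (le_of_eq (by ring))
  exact h5.trans (by gcongr)

end Monotonicity

/-! ### The monotonicity formula and its equality case -/

section Rigidity

open Set
open scoped InnerProductSpace

set_option linter.unusedSectionVars false

attribute [local irreducible] meanCurvature normalPart

variable {n : ℕ} {M : Type*} [TopologicalSpace M] [ChartedSpace (EuclideanSpace ℝ (Fin n)) M]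
  {E : Type*} [NormedAddCommGroup E] [InnerProductSpace ℝ E] [FiniteDimensional ℝ E]
  [IsManifold (𝓡 n) ∞ M] [MeasurableSpace M] [BorelSpace M] [SecondCountableTopology M]
  {y : ℝ → M → E} {t₁ t₂ t₀ C t : ℝ}

lemma IsExtendedFlow.continuous_kernelDensity_right (hy : IsExtendedFlow n y t₁ t₂) (t : ℝ) :
    Continuous fun p => kernelDensity n y t₁ t₀ (p, t) := by
  have h1 : Continuous fun p => areaLoss n y t₁ (p, t) :=
    hy.continuous_areaLoss.comp (Continuous.prodMk_left t)
  have h2 : Continuous fun p => ‖y t p‖ ^ 2 :=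
    hy.continuous_normSq.comp (Continuous.prodMk_left t)
  have h3 : Continuous fun p => Real.exp (-(n / 2 : ℝ) * Real.log (t₀ - t) -
      1 / (4 * (t₀ - t)) * ‖y t p‖ ^ 2 - areaLoss n y t₁ (p, t)) := by
    set b := Real.log (t₀ - t)
    fun_prop
  exact h3

lemma IsExtendedFlow.continuous_shrinkerDefect_right (hy : IsExtendedFlow n y t₁ t₂) (t : ℝ) :
    Continuous fun p => shrinkerDefect n y t₀ (p, t) := by
  have h1 : Continuous fun p => meanCurvature n (y t) p :=
    hy.continuous_meanCurvature.comp (Continuous.prodMk_left t)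
  have h2 : Continuous fun p => normalPart n (y t) p (y t p) :=
    hy.continuous_normalPart.comp (Continuous.prodMk_left t)
  exact h1.add (continuous_const (y := 1 / (2 * (t₀ - t))).smul h2)

lemma IsExtendedFlow.continuousOn_shrinkerDefect (hy : IsExtendedFlow n y t₁ t₂) (h2 : t₂ < t₀)
    (p : M) : ContinuousOn (fun t => shrinkerDefect n y t₀ (p, t)) (Icc t₁ t₂) := by
  have h1 := hy.continuous_meanCurvature_slice p
  have h3 : Continuous fun t => normalPart n (y t) p (y t p) :=
    hy.continuous_normalPart.comp (Continuous.prodMk_right p)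
  have h4 : ContinuousOn (fun s : ℝ => 1 / (2 * (t₀ - s))) (Icc t₁ t₂) :=
    continuousOn_const.div (by fun_prop) fun s hs => by linarith [hs.2]
  exact h1.continuousOn.add (h4.smul h3.continuousOn)

/-- The monotonicity formula in differential form. -/
lemma IsExtendedFlow.integral_kernelDensityDeriv [T2Space M] (hy : IsExtendedFlow n y t₁ t₂)
    (h2 : t₂ < t₀) (hC : 4 * (t₀ - t₁) < C) (ht : t ∈ Icc t₁ t₂)
    (hc : IsCompleteImmersion n (y t))
    (hB : Integrable (fun p => dominatingDensity n y t₁ C (p, t)) (inducedMeasure n (y t₁))) :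
    Integrable (fun p => kernelDensity n y t₁ t₀ (p, t) * ‖shrinkerDefect n y t₀ (p, t)‖ ^ 2)
        (inducedMeasure n (y t₁)) ∧
      ∫ p, kernelDensityDeriv n y t₁ t₀ (p, t) ∂(inducedMeasure n (y t₁)) =
        -∫ p, kernelDensity n y t₁ t₀ (p, t) * ‖shrinkerDefect n y t₀ (p, t)‖ ^ 2
          ∂(inducedMeasure n (y t₁)) := by
  set μ := inducedMeasure n (y t₁) with hμ
  obtain ⟨K, hK, hKle⟩ := kernelDensity_mul_le (n := n) (M := M) (y := y) h2 hC
  obtain ⟨D, hD, hDle⟩ := abs_kernelDensityDeriv_le (n := n) (M := M) (y := y) (t₁ := t₁) h2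
  obtain ⟨D', hD', hDle'⟩ := norm_shrinkerDefect_sq_le (n := n) (M := M) (y := y) (t₁ := t₁) h2
  have hu : ∀ p, 0 < kernelDensity n y t₁ t₀ (p, t) := fun p => Real.exp_pos _
  have hS : Integrable (fun p => kernelDensity n y t₁ t₀ (p, t) *
      (1 + ‖y t p‖ ^ 2 + ‖meanCurvature n (y t) p‖ ^ 2)) μ := by
    have h3 : Continuous fun p => ‖y t p‖ ^ 2 :=
      hy.continuous_normSq.comp (Continuous.prodMk_left t)
    have h4 : Continuous fun p => ‖meanCurvature n (y t) p‖ ^ 2 :=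
      hy.continuous_meanCurvature_normSq.comp (Continuous.prodMk_left t)
    refine (hB.const_mul K).mono' ((hy.continuous_kernelDensity_right t).mul
      ((continuous_const.add h3).add h4)).aestronglyMeasurable ?_
    filter_upwards with p
    rw [Real.norm_of_nonneg (mul_nonneg (hu p).le (by positivity))]
    exact hKle (p, t) ht
  have hI1 : Integrable (fun p => kernelDensityDeriv n y t₁ t₀ (p, t)) μ := by
    refine (hS.const_mul D).mono' (hy.measurable_kernelDensityDeriv.comp
      measurable_prodMk_right).aestronglyMeasurable ?_
    filter_upwards with p using hDle (p, t) ht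
  have hI2 : Integrable (fun p => kernelDensity n y t₁ t₀ (p, t) *
      ‖shrinkerDefect n y t₀ (p, t)‖ ^ 2) μ := by
    refine (hS.const_mul D').mono' ((hy.continuous_kernelDensity_right t).mul
      ((hy.continuous_shrinkerDefect_right t).norm.pow 2)).aestronglyMeasurable ?_
    filter_upwards with p
    rw [Real.norm_of_nonneg (mul_nonneg (hu p).le (by positivity)), mul_left_comm]
    exact mul_le_mul_of_nonneg_left (hDle' (p, t) ht) (hu p).le
  refine ⟨hI2, ?_⟩
  have htt : t < t₀ := ht.2.trans_lt h2
  set N := Real.exp (-(n / 2 : ℝ) * Real.log (t₀ - t)) with hN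
  have hN0 : 0 < N := Real.exp_pos _
  set a := 1 / (4 * (t₀ - t)) with ha
  have hmJ : Measurable fun p => ENNReal.ofReal (Real.exp (-areaLoss n y t₁ (p, t))) :=
    (Real.continuous_exp.comp (hy.continuous_areaLoss.comp
      (Continuous.prodMk_left t)).neg).measurable.ennreal_ofReal
  have hmeas : inducedMeasure n (y t) =
      μ.withDensity fun p => ENNReal.ofReal (Real.exp (-areaLoss n y t₁ (p, t))) :=
    hy.measure_eq t ht
  have hfin : ∀ᵐ p ∂μ, ENNReal.ofReal (Real.exp (-areaLoss n y t₁ (p, t))) < ⊤ :=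
    Filter.Eventually.of_forall fun p => ENNReal.ofReal_lt_top
  have hreal : ∀ p, (ENNReal.ofReal (Real.exp (-areaLoss n y t₁ (p, t)))).toReal =
      Real.exp (-areaLoss n y t₁ (p, t)) := fun p => ENNReal.toReal_ofReal (Real.exp_pos _).le
  have hpt : ∀ p, kernelDensityDeriv n y t₁ t₀ (p, t) =
      -(N * (Real.exp (-areaLoss n y t₁ (p, t)) * gaussianLaplacian n a (y t) p)) -
        kernelDensity n y t₁ t₀ (p, t) * ‖shrinkerDefect n y t₀ (p, t)‖ ^ 2 := fun p =>
    kernelDensityDeriv_eq (p, t) htt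
  -- The Laplacian is integrable because the other two terms of the pointwise identity are.
  have hL : Integrable (fun p => Real.exp (-areaLoss n y t₁ (p, t)) *
      gaussianLaplacian n a (y t) p) μ := by
    refine ((hI1.add hI2).const_mul (-N⁻¹)).congr ?_
    filter_upwards with p
    rw [Pi.add_apply, hpt p]
    field_simp
    ring
  have hρ : Integrable (fun p => Real.exp (-areaLoss n y t₁ (p, t)) *
      (Real.exp (-a * ‖y t p‖ ^ 2) * ‖y t p‖)) μ := by
    have h3 : Continuous fun p => areaLoss n y t₁ (p, t) :=
      hy.continuous_areaLoss.comp (Continuous.prodMk_left t)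
    have h4 : Continuous fun p => y t p := hy.continuous.comp (Continuous.prodMk_left t)
    refine (hS.const_mul N⁻¹).mono' (by fun_prop) ?_
    filter_upwards with p
    rw [Real.norm_of_nonneg (by positivity)]
    have h5 : kernelDensity n y t₁ t₀ (p, t) =
        N * (Real.exp (-areaLoss n y t₁ (p, t)) * Real.exp (-a * ‖y t p‖ ^ 2)) := by
      rw [kernelDensity, hN, ← Real.exp_add, ← Real.exp_add]
      congr 1
      simp only [ha]
      ring
    rw [h5, mul_assoc N, inv_mul_cancel_left₀ hN0.ne', ← mul_assoc]
    gcongr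
    nlinarith [sq_nonneg (‖y t p‖ - 1), sq_nonneg ‖meanCurvature n (y t) p‖]
  have hzero : ∫ p, Real.exp (-areaLoss n y t₁ (p, t)) * gaussianLaplacian n a (y t) p ∂μ = 0 := by
    -- Applied to the slice at time t with its own measure, then carried back to μ through the
    -- density exp(-`areaLoss`).
    have h3 := integral_gaussianLaplacian_eq_zero a (hy.immersion t) hc ?_ ?_
    · rw [hmeas, integral_withDensity_eq_integral_toReal_smul hmJ hfin] at h3
      simpa only [hreal, smul_eq_mul] using h3
    · rw [hmeas, integrable_withDensity_iff_integrable_smul' hmJ hfin]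
      simpa only [hreal, smul_eq_mul] using hρ
    · rw [hmeas, integrable_withDensity_iff_integrable_smul' hmJ hfin]
      simpa only [hreal, smul_eq_mul] using hL
  rw [integral_congr_ae (Filter.Eventually.of_forall hpt),
    integral_sub (f := fun p => -(N * (Real.exp (-areaLoss n y t₁ (p, t)) *
      gaussianLaplacian n a (y t) p))) (hL.const_mul N).neg hI2, integral_neg, integral_const_mul, hzero]
  simp

/-- If the integral of the backward heat kernel does not change along the flow, then the flow
is a self-shrinker. -/
theorem IsExtendedFlow.shrinkerDefect_eq_zero [T2Space M] (hy : IsExtendedFlow n y t₁ t₂)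
    (h12 : t₁ < t₂) (h2 : t₂ < t₀) (hC : 4 * (t₀ - t₁) < C)
    (hc : ∀ t ∈ Icc t₁ t₂, IsCompleteImmersion n (y t))
    (hint : Integrable (fun p => Real.exp (-(1 / C) * ‖y t₁ p‖ ^ 2)) (inducedMeasure n (y t₁)))
    (hΦ : ∫ p, kernelDensity n y t₁ t₀ (p, t₂) ∂(inducedMeasure n (y t₁)) =
      ∫ p, kernelDensity n y t₁ t₀ (p, t₁) ∂(inducedMeasure n (y t₁))) (ht : t ∈ Icc t₁ t₂)
    (p : M) : shrinkerDefect n y t₀ (p, t) = 0 := by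
  have hsf := sFinite_inducedMeasure (hy.immersion t₁).smooth
  set μ := inducedMeasure n (y t₁) with hμ
  set ν : Measure ℝ := volume.restrict (Ioc t₁ t₂) with hν
  obtain ⟨K, hK, hKle⟩ := kernelDensity_mul_le (n := n) (M := M) (y := y) h2 hC
  obtain ⟨D, hD, hDle⟩ := abs_kernelDensityDeriv_le (n := n) (M := M) (y := y) (t₁ := t₁) h2
  have hC2 : 2 * (t₂ - t₁) < C := by linarith
  have hB := hy.integrable_dominatingDensity h12.le hC2 hint
  have hsub : ∀ᵐ q ∂(μ.prod ν), q.2 ∈ Icc t₁ t₂ := by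
    have h3 : ∀ᵐ s ∂ν, s ∈ Icc t₁ t₂ := by
      filter_upwards [ae_restrict_mem measurableSet_Ioc] with s hs using Ioc_subset_Icc_self hs
    exact Measure.quasiMeasurePreserving_snd.ae h3
  have hI : Integrable (kernelDensityDeriv n y t₁ t₀) (μ.prod ν) := by
    refine (hB.const_mul (D * K)).mono' hy.measurable_kernelDensityDeriv.aestronglyMeasurable ?_
    filter_upwards [hsub] with q hq
    refine (hDle q hq).trans ?_
    rw [mul_assoc]
    exact mul_le_mul_of_nonneg_left (hKle q hq) hD
  have hslice : ∀ p : M, ∫ s, kernelDensityDeriv n y t₁ t₀ (p, s) ∂ν =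
      kernelDensity n y t₁ t₀ (p, t₂) - kernelDensity n y t₁ t₀ (p, t₁) := fun p => by
    rw [hν, ← intervalIntegral.integral_of_le h12.le]
    exact intervalIntegral.integral_eq_sub_of_hasDerivAt_of_le h12.le
      (hy.continuousOn_kernelDensity h2 p) (fun s hs => hy.hasDerivAt_kernelDensity h2 hs p)
      ((hy.continuousOn_kernelDensityDeriv h2 p).intervalIntegrable_of_Icc h12.le)
  -- By Fubini the integral over time may be done first, at fixed p. It gives the increment of the
  -- kernel, whose integral is Φ(t₂) - Φ(t₁) = 0.
  have htotal : ∫ s, ∫ p, kernelDensityDeriv n y t₁ t₀ (p, s) ∂μ ∂ν = 0 := by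
    rw [← integral_integral_swap (f := fun p s => kernelDensityDeriv n y t₁ t₀ (p, s)) hI]
    simp_rw [hslice]
    rw [integral_sub (hy.integrable_kernelDensity h2 hC (right_mem_Icc.2 h12.le) hint)
      (hy.integrable_kernelDensity h2 hC (left_mem_Icc.2 h12.le) hint), hΦ, sub_self]
  have hu : ∀ q : M × ℝ, 0 < kernelDensity n y t₁ t₀ q := fun q => Real.exp_pos _
  -- Space-time integrability of the dominating density makes almost every time slice integrable,
  -- which is all that the monotonicity identity needs.
  have hdef : ∀ᵐ s ∂ν, Integrable (fun p => kernelDensity n y t₁ t₀ (p, s) *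
        ‖shrinkerDefect n y t₀ (p, s)‖ ^ 2) μ ∧
      ∫ p, kernelDensityDeriv n y t₁ t₀ (p, s) ∂μ =
        -∫ p, kernelDensity n y t₁ t₀ (p, s) * ‖shrinkerDefect n y t₀ (p, s)‖ ^ 2 ∂μ := by
    filter_upwards [hB.prod_left_ae, ae_restrict_mem measurableSet_Ioc] with s hs hs'
    exact hy.integral_kernelDensityDeriv h2 hC (Ioc_subset_Icc_self hs')
      (hc s (Ioc_subset_Icc_self hs')) hs
  have hnn : 0 ≤ᵐ[ν] fun s => -∫ p, kernelDensityDeriv n y t₁ t₀ (p, s) ∂μ := by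
    filter_upwards [hdef] with s hs
    rw [hs.2, neg_neg]
    exact integral_nonneg fun p => mul_nonneg (hu _).le (sq_nonneg _)
  have hae : (fun s => -∫ p, kernelDensityDeriv n y t₁ t₀ (p, s) ∂μ) =ᵐ[ν] 0 := by
    refine (integral_eq_zero_iff_of_nonneg_ae hnn hI.integral_prod_right.neg).1 ?_
    rw [integral_neg, htotal, neg_zero]
  -- At such a time the defect vanishes almost everywhere on M. It is continuous and nonempty open
  -- sets have positive measure, so it vanishes at every point.
  have hQ : ∀ᵐ s ∂ν, ∀ p, shrinkerDefect n y t₀ (p, s) = 0 := by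
    filter_upwards [hdef, hae] with s hs hs0
    rw [hs.2, neg_neg] at hs0
    have h3 := (integral_eq_zero_iff_of_nonneg (fun p => mul_nonneg (hu _).le (sq_nonneg _))
      hs.1).1 hs0
    have h4 : ∀ᵐ p ∂μ, shrinkerDefect n y t₀ (p, s) = 0 := by
      filter_upwards [h3] with p hp
      simpa [(hu (p, s)).ne'] using hp
    by_contra hne
    push Not at hne
    have hopen : IsOpen {p | shrinkerDefect n y t₀ (p, s) ≠ 0} :=
      isOpen_ne_fun (hy.continuous_shrinkerDefect_right s) continuous_const
    exact (inducedMeasure_pos_of_isOpen (hy.immersion t₁) hopen hne).ne' (ae_iff.1 h4)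
  -- At fixed p the defect is continuous in time, so the exceptional times, including the end
  -- points, can be filled in.
  have h5 : (fun s => shrinkerDefect n y t₀ (p, s)) =ᵐ[volume.restrict (Icc t₁ t₂)]
      fun _ => (0 : E) := by
    rw [← restrict_Ioc_eq_restrict_Icc]
    filter_upwards [hQ] with s hs using hs p
  exact Measure.eqOn_Icc_of_ae_eq volume h12.ne h5 (hy.continuousOn_shrinkerDefect h2 p)
    continuousOn_const ht

end Rigidity

/-! ### Behaviour under translations and homotheties -/

section Homothety

open Set

set_option linter.unusedSectionVars false

variable {n : ℕ} {E : Type*} [NormedAddCommGroup E] [InnerProductSpace ℝ E]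

lemma fderiv_smul_sub (u : EuclideanSpace ℝ (Fin n) → E) (c : ℝ) (b : E)
    (z : EuclideanSpace ℝ (Fin n)) :
    fderiv ℝ (fun z => c • (u z - b)) z = c • fderiv ℝ u z := by
  have h := congrFun (fderiv_const_smul_field (𝕜 := ℝ) (f := fun z => u z - b) c) z
  rw [Pi.smul_apply, fderiv_sub_const] at h
  exact h

lemma coordDeriv_smul_sub (u : EuclideanSpace ℝ (Fin n) → E) (c : ℝ) (b : E) (i : Fin n) :
    coordDeriv n (fun z => c • (u z - b)) i = fun z => c • coordDeriv n u i z := by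
  funext z
  simp only [coordDeriv, fderiv_smul_sub]
  rfl

lemma metricMatrix_smul_sub (u : EuclideanSpace ℝ (Fin n) → E) (c : ℝ) (b : E)
    (z : EuclideanSpace ℝ (Fin n)) :
    metricMatrix n (fun z => c • (u z - b)) z = c ^ 2 • metricMatrix n u z := by
  ext i j
  simp only [metricMatrix, Matrix.gram_apply, coordDeriv_smul_sub, Matrix.smul_apply,
    inner_smul_left, inner_smul_right, conj_trivial, smul_eq_mul]
  ring

variable {M : Type*} [TopologicalSpace M] [ChartedSpace (EuclideanSpace ℝ (Fin n)) M]
  {f : M → E}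

lemma contMDiff_smul_sub (hf : ContMDiff (𝓡 n) 𝓘(ℝ, E) ∞ f) (c : ℝ) (b : E) :
    ContMDiff (𝓡 n) 𝓘(ℝ, E) ∞ fun p => c • (f p - b) :=
  ((contDiff_id.sub contDiff_const).const_smul c : ContDiff ℝ ∞ fun v : E => c • (v - b)
    ).contMDiff.comp hf

lemma differential_smul_sub (hf : ContMDiff (𝓡 n) 𝓘(ℝ, E) ∞ f) (c : ℝ) (b : E) (p : M) :
    differential n (fun p => c • (f p - b)) p = c • differential n f p := by
  have h : ContMDiff (𝓡 n) 𝓘(ℝ, E) ∞ fun p => c • (f p - b) :=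
    contMDiff_smul_sub hf c b
  rw [differential_eq_fderiv_localRep (hf.mdifferentiableAt (by simp)),
    differential_eq_fderiv_localRep (h.mdifferentiableAt (by simp))]
  have h1 : localRep n (fun p => c • (f p - b)) p = fun z => c • (localRep n f p z - b) := rfl
  rw [h1, fderiv_smul_sub]

lemma IsImmersion.smul_sub (hf : IsImmersion n f) {c : ℝ} (hc : c ≠ 0) (b : E) :
    IsImmersion n fun p => c • (f p - b) := by
  refine ⟨contMDiff_smul_sub hf.smooth c b, fun p v w h => ?_⟩
  rw [differential_smul_sub hf.smooth] at h
  exact hf.injective_differential p (smul_right_injective E hc h)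

variable [FiniteDimensional ℝ E]

lemma normalPart_smul_sub (hf : ContMDiff (𝓡 n) 𝓘(ℝ, E) ∞ f) {c : ℝ} (hc : c ≠ 0) (b : E)
    (p : M) (v : E) : normalPart n (fun p => c • (f p - b)) p v = normalPart n f p v := by
  have h : (differential n (fun p => c • (f p - b)) p : EuclideanSpace ℝ (Fin n) →ₗ[ℝ] E).range =
      (differential n f p : EuclideanSpace ℝ (Fin n) →ₗ[ℝ] E).range := by
    rw [differential_smul_sub hf]
    exact LinearMap.range_smul _ c hc
  rw [normalPart, normalPart]
  congr 3

lemma normalPart_smul (f : M → E) (p : M) (c : ℝ) (v : E) :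
    normalPart n f p (c • v) = c • normalPart n f p v := map_smul _ _ _

/-- The inverse metric scales by c⁻² and second derivatives scale by c, while normal spaces do not
change. -/
lemma meanCurvature_smul_sub [IsManifold (𝓡 n) ∞ M] (hf : IsImmersion n f) {c : ℝ} (hc : c ≠ 0)
    (b : E) (p : M) :
    meanCurvature n (fun p => c • (f p - b)) p = c⁻¹ • meanCurvature n f p := by
  have h1 : localRep n (fun p => c • (f p - b)) p = fun z => c • (localRep n f p z - b) := rfl
  have hdet : IsUnit (metricMatrix n (localRep n f p) (extChartAt (𝓡 n) p p)).det := by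
    rw [localRep_eq, extChartAt_coe_eq]
    exact (metricMatrix_det_pos
      (hf.injective_fderiv (chartAt_mem p) (mem_chart_target _ p))).ne'.isUnit
  have h2 : (c ^ 2 • metricMatrix n (localRep n f p) (extChartAt (𝓡 n) p p))⁻¹ =
      (c ^ 2)⁻¹ • (metricMatrix n (localRep n f p) (extChartAt (𝓡 n) p p))⁻¹ := by
    let k : Units ℝ := Units.mk0 (c ^ 2) (pow_ne_zero 2 hc)
    exact Matrix.inv_smul' _ k hdet
  rw [meanCurvature, meanCurvature, Finset.smul_sum]
  refine Finset.sum_congr rfl fun i _ => ?_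
  rw [Finset.smul_sum]
  refine Finset.sum_congr rfl fun j _ => ?_
  rw [h1, metricMatrix_smul_sub, h2, coordDeriv_smul_sub, normalPart_smul_sub hf.smooth hc]
  have h3 : coordDeriv n (fun z => c • coordDeriv n (localRep n f p) j z) i =
      fun z => c • coordDeriv n (coordDeriv n (localRep n f p) j) i z := by
    simpa using coordDeriv_smul_sub (coordDeriv n (localRep n f p) j) c 0 i
  rw [h3, normalPart_smul, Matrix.smul_apply, smul_smul, smul_smul, smul_eq_mul]
  congr 1
  field_simp

lemma inducedEDist_sub (hf : ContMDiff (𝓡 n) 𝓘(ℝ, E) ∞ f) (b : E) :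
    inducedEDist n (fun p => f p - b) = inducedEDist n f := by
  have h : differential n (fun p => f p - b) = differential n f := by
    funext p
    simpa using differential_smul_sub hf 1 b p
  unfold inducedEDist
  rw [h]

lemma inducedMeasure_sub [MeasurableSpace M] (f : M → E) (b : E) :
    inducedMeasure n (fun p => f p - b) = inducedMeasure n f := by
  have h : ∀ p, metricMatrix n (localRep n (fun p => f p - b) p) = metricMatrix n (localRep n f p) :=
    fun p => by
      funext z
      have h1 := metricMatrix_smul_sub (localRep n f p) 1 b z
      simp only [one_smul, one_pow] at h1
      exact h1
  unfold inducedMeasure chartMeasure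
  simp_rw [h]

lemma IsMeanCurvatureFlow.sub [IsManifold (𝓡 n) ∞ M] {x : ℝ → M → E} {t₁ t₂ : ℝ}
    (hx : IsMeanCurvatureFlow n x t₁ t₂) (b : E) :
    IsMeanCurvatureFlow n (fun t p => x t p - b) t₁ t₂ := by
  refine ⟨hx.smooth.sub contMDiffOn_const, fun t ht => ?_, fun t ht p => ?_⟩
  · simpa using (hx.immersion t ht).smul_sub one_ne_zero b
  · have h := meanCurvature_smul_sub (hx.immersion t ht) one_ne_zero b p
    simp only [one_smul, inv_one] at h
    rw [h]
    exact (hx.evolution t ht p).sub_const b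

end Homothety

/-! ### Equal heat kernel integrals at the two ends -/

section Breather

open Set

set_option linter.unusedSectionVars false

attribute [local irreducible] meanCurvature normalPart

variable {E : Type*} [NormedAddCommGroup E] [InnerProductSpace ℝ E] [FiniteDimensional ℝ E]

/-- A similarity with ratio less than one is a homothety, up to a linear isometry, with respect
to its fixed point. -/
lemma exists_fixedPoint_similarity {α : ℝ} (hα0 : 0 ≤ α) (hα1 : α < 1) {F : E → E}
    (hF : Isometry F) : ∃ (x₀ : E) (A : E →ₗᵢ[ℝ] E), ∀ v, α • F v - x₀ = α • A (v - x₀) := by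
  have hlip : LipschitzWith ⟨α, hα0⟩ fun v => α • F v := by
    refine LipschitzWith.of_dist_le_mul fun v w => ?_
    rw [dist_smul₀, hF.dist_eq, Real.norm_of_nonneg hα0]
    rfl
  -- Banach's fixed point theorem supplies the centre. The linear part exists because isometries
  -- into a strictly convex space are affine.
  have hcontr : ContractingWith ⟨α, hα0⟩ fun v => α • F v := ⟨hα1, hlip⟩
  set x₀ := hcontr.fixedPoint
  have hx₀ : α • F x₀ = x₀ := hcontr.fixedPoint_isFixedPt
  refine ⟨x₀, hF.affineIsometryOfStrictConvexSpace.linearIsometry, fun v => ?_⟩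
  have h := hF.affineIsometryOfStrictConvexSpace.map_vsub v x₀
  simp only [vsub_eq_sub, Isometry.affineIsometryOfStrictConvexSpace_apply] at h
  rw [h, smul_sub, hx₀]

/-- Moving the centre of the Gaussian to x₀ produces a cross term linear in ‖g‖, which the gap
between γ and c absorbs. -/
lemma integrable_exp_neg_of_lintegral {X : Type*} [MeasurableSpace X] {μ : Measure X}
    {g : X → E} {γ c : ℝ} (x₀ : E) (hc : 0 < c) (hγc : γ < c)
    (hm : AEStronglyMeasurable (fun p => Real.exp (-c * ‖g p - x₀‖ ^ 2)) μ)
    (hint : ∫⁻ p, ENNReal.ofReal (Real.exp (-γ * ‖g p‖ ^ 2)) ∂μ < ⊤) :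
    Integrable (fun p => Real.exp (-c * ‖g p - x₀‖ ^ 2)) μ := by
  refine ⟨hm, ?_⟩
  -- The maximum over r of 2c‖x₀‖r - (c - γ)r².
  set κ := (c * ‖x₀‖) ^ 2 / (c - γ) with hκ
  have hbound : ∀ p, Real.exp (-c * ‖g p - x₀‖ ^ 2) ≤
      Real.exp κ * Real.exp (-γ * ‖g p‖ ^ 2) := by
    intro p
    rw [← Real.exp_add, Real.exp_le_exp]
    have h1 : (‖g p‖ - ‖x₀‖) ^ 2 ≤ ‖g p - x₀‖ ^ 2 :=
      sq_le_sq' (by linarith [norm_sub_norm_le x₀ (g p), norm_sub_rev x₀ (g p)])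
        (norm_sub_norm_le _ _)
    have h2 : 0 < c - γ := by linarith
    have h3 : κ * (c - γ) = (c * ‖x₀‖) ^ 2 := div_mul_cancel₀ _ h2.ne'
    have h4 : 0 ≤ κ + (c - γ) * ‖g p‖ ^ 2 - 2 * (c * ‖x₀‖) * ‖g p‖ := by
      have h5 : 0 ≤ (κ + (c - γ) * ‖g p‖ ^ 2 - 2 * (c * ‖x₀‖) * ‖g p‖) * (c - γ) := by
        have : (κ + (c - γ) * ‖g p‖ ^ 2 - 2 * (c * ‖x₀‖) * ‖g p‖) * (c - γ) =
            ((c - γ) * ‖g p‖ - c * ‖x₀‖) ^ 2 := by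
          rw [sub_mul, add_mul, h3]; ring
        rw [this]
        exact sq_nonneg _
      exact nonneg_of_mul_nonneg_left h5 h2
    nlinarith [mul_le_mul_of_nonneg_left h1 hc.le, mul_nonneg hc.le (sq_nonneg ‖x₀‖)]
  refine lt_of_le_of_lt (b := ∫⁻ p, ENNReal.ofReal (Real.exp κ) *
    ENNReal.ofReal (Real.exp (-γ * ‖g p‖ ^ 2)) ∂μ) (lintegral_mono fun p => ?_) ?_
  · rw [Real.enorm_of_nonneg (Real.exp_pos _).le, ← ENNReal.ofReal_mul (Real.exp_pos _).le]
    exact ENNReal.ofReal_le_ofReal (hbound p)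
  · rw [lintegral_const_mul' _ _ ENNReal.ofReal_ne_top]
    exact ENNReal.mul_lt_top ENNReal.ofReal_lt_top hint

variable {n : ℕ} {M : Type*} [TopologicalSpace M] [ChartedSpace (EuclideanSpace ℝ (Fin n)) M]
  [IsManifold (𝓡 n) ∞ M] [MeasurableSpace M] [BorelSpace M] [SecondCountableTopology M]
  {y : ℝ → M → E} {t₁ t₂ t₀ : ℝ}

/-- The integral of the backward heat kernel takes the same value at both ends of a breather. -/
lemma IsExtendedFlow.integral_kernelDensity_eq (hy : IsExtendedFlow n y t₁ t₂) (h12 : t₁ ≤ t₂)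
    (h2 : t₂ < t₀) {α : ℝ} (hα : 0 < α) (hτ : t₀ - t₂ = α ^ 2 * (t₀ - t₁))
    (φ : M ≃ₘ^∞⟮𝓡 n, 𝓡 n⟯ M) (A : E →ₗᵢ[ℝ] E) (h : ∀ p, y t₂ p = α • A (y t₁ (φ p))) :
    ∫ p, kernelDensity n y t₁ t₀ (p, t₂) ∂(inducedMeasure n (y t₁)) =
      ∫ p, kernelDensity n y t₁ t₀ (p, t₁) ∂(inducedMeasure n (y t₁)) := by
  have hτ1 : 0 < t₀ - t₁ := by linarith
  have hmap := map_inducedMeasure_similarity (hy.immersion t₁).smooth (hy.immersion t₂).smooth φ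
    hα.le A 0 (by simpa using h)
  set g : M → ℝ := fun p => Real.exp (-(1 / (4 * (t₀ - t₁))) * ‖y t₁ p‖ ^ 2) with hg
  set N₁ := Real.exp (-(n / 2 : ℝ) * Real.log (t₀ - t₁)) with hN₁
  set N₂ := Real.exp (-(n / 2 : ℝ) * Real.log (t₀ - t₂)) with hN₂
  -- The normalizing power (t₀ - t)^(-n/2) compensates the factor αⁿ by which n-dimensional area
  -- scales.
  have hN : N₂ * α ^ n = N₁ := by
    rw [hN₁, hN₂, hτ, Real.log_mul (by positivity) hτ1.ne', Real.log_pow,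
      ← Real.exp_log (pow_pos hα n), Real.log_pow, ← Real.exp_add]
    congr 1
    push_cast
    ring
  have hJ : Measurable fun p => ENNReal.ofReal (Real.exp (-areaLoss n y t₁ (p, t₂))) :=
    (Real.continuous_exp.comp (hy.continuous_areaLoss.comp
      (Continuous.prodMk_left t₂)).neg).measurable.ennreal_ofReal
  have hmeas : inducedMeasure n (y t₂) = (inducedMeasure n (y t₁)).withDensity
      fun p => ENNReal.ofReal (Real.exp (-areaLoss n y t₁ (p, t₂))) :=
    hy.measure_eq t₂ (right_mem_Icc.2 h12)
  have h3 : ∫ p, g (φ p) ∂(inducedMeasure n (y t₂)) =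
      α ^ n * ∫ p, g p ∂(inducedMeasure n (y t₁)) := by
    have h4 := φ.toHomeomorph.measurableEmbedding.integral_map (μ := inducedMeasure n (y t₂)) g
    have h5 : (⇑φ.toHomeomorph : M → M) = φ := rfl
    rw [h5] at h4
    rw [← h4, hmap, integral_smul_measure, ENNReal.toReal_ofReal (by positivity), smul_eq_mul]
  rw [hmeas, integral_withDensity_eq_integral_toReal_smul hJ
    (Filter.Eventually.of_forall fun p => ENNReal.ofReal_lt_top)] at h3
  -- The Gaussian exponent is scale invariant: |y|² and t₀ - t both pick up the factor α².
  have h6 : ∀ p, kernelDensity n y t₁ t₀ (p, t₂) = N₂ *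
      ((ENNReal.ofReal (Real.exp (-areaLoss n y t₁ (p, t₂)))).toReal • g (φ p)) := by
    intro p
    have h7 : ‖y t₂ p‖ = α * ‖y t₁ (φ p)‖ := by
      rw [h, norm_smul, A.norm_map, Real.norm_of_nonneg hα.le]
    rw [ENNReal.toReal_ofReal (Real.exp_pos _).le, smul_eq_mul, kernelDensity, hN₂, hg,
      ← Real.exp_add, ← Real.exp_add]
    congr 1
    simp only [h7, hτ]
    field_simp
    ring
  have h8 : ∀ p, kernelDensity n y t₁ t₀ (p, t₁) = N₁ * g p := by
    intro p
    rw [kernelDensity, areaLoss, intervalIntegral.integral_same, sub_zero, hN₁, hg,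
      ← Real.exp_add]
    congr 1
    simp only
    ring
  simp_rw [h6, h8]
  rw [integral_const_mul, h3, ← mul_assoc, hN, integral_const_mul]

end Breather

end MCF

end

/-! ### Shrinking breathers are self-shrinkers -/

theorem theorem1p2 {n m : ℕ} {M : Type*} [TopologicalSpace M] [T2Space M]
    [SecondCountableTopology M] [ChartedSpace (EuclideanSpace ℝ (Fin n)) M]
    [IsManifold (𝓡 n) ∞ M] [MeasurableSpace M] [BorelSpace M]
    (x : ℝ → M → EuclideanSpace ℝ (Fin (n + m))) (t₁ t₂ α : ℝ)
    (hx : MCF.IsShrinkingBreather n x t₁ t₂ α)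
    (hcomplete : ∀ t ∈ Set.Icc t₁ t₂, MCF.IsCompleteImmersion n (x t))
    (γ : ℝ) (hγ : γ < (1 - α ^ 2) / (4 * (t₂ - t₁)))
    (hint : ∫⁻ p, ENNReal.ofReal (Real.exp (-γ * ‖x t₁ p‖ ^ 2))
      ∂(MCF.inducedMeasure n (x t₁)) < ⊤) :
    MCF.IsSelfShrinkingFlow n x t₁ t₂ := by
  obtain ⟨⟨hflow, h12, hα0, F, hF, φ, hφ⟩, hα1⟩ := hx
  obtain ⟨x₀, A, hA⟩ := MCF.exists_fixedPoint_similarity hα0.le hα1 hF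
  have hα2 : 0 < 1 - α ^ 2 := by nlinarith
  have hT : 0 < t₂ - t₁ := by linarith
  -- The solution of t₀ - t₂ = α²(t₀ - t₁): lengths of a self-shrinker are proportional to √(t₀ - t)
  -- and must shrink by the factor α.
  set t₀ := t₁ + (t₂ - t₁) / (1 - α ^ 2) with ht₀
  have hτ1 : (t₀ - t₁) * (1 - α ^ 2) = t₂ - t₁ := by
    rw [ht₀, add_sub_cancel_left, div_mul_cancel₀ _ hα2.ne']
  have hτ1' : 0 < t₀ - t₁ := by
    rw [ht₀, add_sub_cancel_left]
    exact div_pos hT hα2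
  have hτ2 : t₀ - t₂ = α ^ 2 * (t₀ - t₁) := by linarith
  have h2 : t₂ < t₀ := by
    have : 0 < α ^ 2 * (t₀ - t₁) := by positivity
    linarith
  have hquot : (1 - α ^ 2) / (4 * (t₂ - t₁)) = 1 / (4 * (t₀ - t₁)) := by
    rw [← hτ1]
    field_simp
  rw [hquot] at hγ
  -- The exponent must be positive for C = 1/c to make sense, whereas γ may be negative or zero;
  -- hence the maximum with 0. Room above γ is needed for recentring at x₀, and room below 1/(4(t₀ -
  -- t₁)) for the domination.
  obtain ⟨c, hc, hc'⟩ := exists_between (max_lt hγ (by positivity : (0 : ℝ) < 1 / (4 * (t₀ - t₁))))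
  have hc0 : 0 < c := (le_max_right _ _).trans_lt hc
  have hC : 4 * (t₀ - t₁) < 1 / c := by
    rw [lt_one_div (by positivity) hc0]
    exact hc'
  have hflow' := hflow.sub x₀
  have hy := hflow'.isExtendedFlow h12
  set y : ℝ → M → EuclideanSpace ℝ (Fin (n + m)) :=
    fun t p => x (Set.projIcc t₁ t₂ h12.le t) p - x₀ with hydef
  have hyt : ∀ t ∈ Set.Icc t₁ t₂, y t = fun p => x t p - x₀ := fun t ht => by
    simp only [hydef, Set.projIcc_of_mem h12.le ht]
  have h1 : t₁ ∈ Set.Icc t₁ t₂ := Set.left_mem_Icc.2 h12.le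
  have hcy : ∀ t ∈ Set.Icc t₁ t₂, MCF.IsCompleteImmersion n (y t) := fun t ht => by
    rw [hyt t ht]
    intro u hu
    rw [MCF.inducedEDist_sub (hflow.immersion t ht).smooth] at hu
    exact hcomplete t ht u hu
  have hinty : Integrable (fun p => Real.exp (-(1 / (1 / c)) * ‖y t₁ p‖ ^ 2))
      (MCF.inducedMeasure n (y t₁)) := by
    rw [hyt t₁ h1, MCF.inducedMeasure_sub, one_div_one_div]
    have hcont := (hflow.immersion t₁ h1).smooth.continuous
    exact MCF.integrable_exp_neg_of_lintegral x₀ hc0 ((le_max_left _ _).trans_lt hc)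
      (by fun_prop) hint
  have hΦ := hy.integral_kernelDensity_eq h12.le h2 hα0 hτ2 φ A fun p => by
    simp only [hyt t₁ h1, hyt t₂ (Set.right_mem_Icc.2 h12.le), ← hA, hφ]
  refine ⟨x₀, t₀, h2, fun t ht => ?_⟩
  have hτ : 0 < t₀ - t := by linarith [ht.2]
  have hs : 0 < √(t₀ - t) := Real.sqrt_pos.2 hτ
  have hi := hflow.immersion t ht
  refine ⟨hi.smul_sub (inv_ne_zero hs.ne') x₀, fun p => ?_⟩
  have hzero := hy.shrinkerDefect_eq_zero h12 h2 hC hcy hinty hΦ ht p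
  have hH := MCF.meanCurvature_smul_sub hi one_ne_zero x₀ p
  have hN := MCF.normalPart_smul_sub hi.smooth one_ne_zero x₀ p (x t p - x₀)
  simp only [one_smul, inv_one] at hH hN
  rw [MCF.shrinkerDefect, hyt t ht, hH, hN] at hzero
  rw [MCF.meanCurvature_smul_sub hi (inv_ne_zero hs.ne'),
    MCF.normalPart_smul_sub hi.smooth (inv_ne_zero hs.ne'), eq_neg_of_add_eq_zero_left hzero,
    MCF.normalPart_smul, inv_inv, smul_neg, neg_smul, smul_smul, smul_smul]
  -- What remains is the scalar identity √(t₀ - t) · 1/(2(t₀ - t)) = ½ (√(t₀ - t))⁻¹.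
  congr 2
  have hsq : √(t₀ - t) ^ 2 = t₀ - t := Real.sq_sqrt hτ.le
  rw [← hsq, Real.sqrt_sq hs.le]
  field_simp
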